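/- Call a $4$-polytope in $\mathbb R^4$ a stacked polytope $\mathrm{Stack}(n,4)$ if it is obtained from a $4$-simplex by $n$ successive stackings; a stacking replaces a polytope $P$ by $\operatorname{conv}(P\cup\{w\})$, where for some facet $F$ of $P$ that is a simplex the point $w$ lies beyond $F$ and beneath all other facets of $P$. A deep vertex truncation $\mathrm{DVT}(P)$ of a polytope $P$ is a polytope $P\cap\bigcap_v H_v^-$, where for each vertex $v$ of $P$ the set $H_v^-$ is a closed half-space not containing $v$, such that from each edge of $P$ exactly one point remains, and this point lies in the relative interior of the edge. A $4$-polytope is $2$-simple $2$-simplicial if each of its $2$-faces is a triangle and each of its edges lies in exactly three facets. Two polytopes have the same combinatorial type if their face lattices are isomorphic. **Corollary.** For every $n\ge 0$, every stacked $4$-polytope $\mathrm{Stack}(n,4)$ has $f$-vector $(5+n,\,10+4n,\,10+6n,\,5+3n)$, and its combinatorial type has a realization $P\subset\mathbb R^4$ that admits a deep vertex truncation $\mathrm{DVT}(P)$ which is a $2$-simple $2$-simplicial $4$-polytope with $f$-vector $$(10+4n,\ 30+18n,\ 30+18n,\ 10+4n).$$ In particular, there are infinitely many combinatorial types of $2$-simple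 $2$-simplicial $4$-polytopes. -/

import Mathlib

namespace PolytopeTheory

/-- The dimension of a nonempty convex set: the dimension of its affine hull. -/
noncomputable def polyDim {d : ℕ} (P : Set (EuclideanSpace ℝ (Fin d))) : ℕ :=
  Module.finrank ℝ (vectorSpan ℝ P)

/-- A `d`-polytope in `ℝᵈ`: the convex hull of finitely many points, of full dimension `d`. -/
def IsFullPolytope {d : ℕ} (P : Set (EuclideanSpace ℝ (Fin d))) : Prop :=
  (∃ s : Finset (EuclideanSpace ℝ (Fin d)), s.Nonempty ∧
    P = convexHull ℝ (s : Set (EuclideanSpace ℝ (Fin d)))) ∧ polyDim P = d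

/-- A `k`-simplex: the convex hull of `k + 1` affinely independent points. -/
def IsSimplex {d : ℕ} (k : ℕ) (P : Set (EuclideanSpace ℝ (Fin d))) : Prop :=
  ∃ v : Fin (k + 1) → EuclideanSpace ℝ (Fin d),
    AffineIndependent ℝ v ∧ P = convexHull ℝ (Set.range v)

/-- `F` is a `k`-dimensional (nonempty) face of `P`, that is, the set of points of `P` at which
some linear functional attains its maximum over `P`. The choice of the zero functional shows
that `P` is a face of itself. -/
def IsFace {d : ℕ} (k : ℕ) (P F : Set (EuclideanSpace ℝ (Fin d))) : Prop :=
  F.Nonempty ∧ IsExposed ℝ P F ∧ polyDim F = k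

/-- A facet is a face of codimension one. -/
def IsFacet {d : ℕ} (P F : Set (EuclideanSpace ℝ (Fin d))) : Prop :=
  ∃ k : ℕ, IsFace k P F ∧ k + 1 = polyDim P

/-- The number of `k`-dimensional faces. -/
noncomputable def faceCount {d : ℕ} (P : Set (EuclideanSpace ℝ (Fin d))) (k : ℕ) : ℕ :=
  Set.ncard {F | IsFace k P F}

/-- The `f`-vector `(f₀, …, f_{d-1})`. -/
noncomputable def fVector {d : ℕ} (P : Set (EuclideanSpace ℝ (Fin d))) : Fin d → ℕ :=
  fun k => faceCount P k

/-- The face lattice: all faces, including the empty face and `P`, ordered by inclusion. -/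
abbrev FaceLattice {d : ℕ} (P : Set (EuclideanSpace ℝ (Fin d))) : Type :=
  {F : Set (EuclideanSpace ℝ (Fin d)) // IsExposed ℝ P F}

/-- Combinatorial equivalence: the face lattices are isomorphic. -/
def CombEquiv {d : ℕ} (P Q : Set (EuclideanSpace ℝ (Fin d))) : Prop :=
  Nonempty (FaceLattice P ≃o FaceLattice Q)

/-- Combinatorial equivalence as an equivalence relation. -/
def combSetoid (d : ℕ) : Setoid (Set (EuclideanSpace ℝ (Fin d))) where
  r := CombEquiv
  iseqv :=
    { refl := fun P => ⟨OrderIso.refl (FaceLattice P)⟩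
      symm := fun ⟨e⟩ => ⟨e.symm⟩
      trans := fun ⟨e⟩ ⟨e'⟩ => ⟨e.trans e'⟩ }

/-- The combinatorial type of `P`. -/
def combType {d : ℕ} (P : Set (EuclideanSpace ℝ (Fin d))) : Quotient (combSetoid d) :=
  Quotient.mk (combSetoid d) P

/-- `w` lies beyond the facet `F` of the full-dimensional polytope `P`: it violates the
inequality valid for `P` that defines `F` (unique up to positive scaling). -/
def IsBeyond {d : ℕ} (P F : Set (EuclideanSpace ℝ (Fin d))) (w : EuclideanSpace ℝ (Fin d)) :
    Prop :=
  ∃ (l : EuclideanSpace ℝ (Fin d) →L[ℝ] ℝ) (c : ℝ),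
    (∀ x ∈ P, l x ≤ c) ∧ F = {x ∈ P | l x = c} ∧ c < l w

/-- `w` lies beneath the facet `F` of the full-dimensional polytope `P`: it satisfies strictly
the inequality valid for `P` that defines `F`. -/
def IsBeneath {d : ℕ} (P F : Set (EuclideanSpace ℝ (Fin d))) (w : EuclideanSpace ℝ (Fin d)) :
    Prop :=
  ∃ (l : EuclideanSpace ℝ (Fin d) →L[ℝ] ℝ) (c : ℝ),
    (∀ x ∈ P, l x ≤ c) ∧ F = {x ∈ P | l x = c} ∧ l w < c

/-- `P'` arises from `P` by stacking a pyramid onto a facet `F` that is a simplex: a new vertex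
`w` is added beyond `F` and beneath all other facets. -/
def IsStacking {d : ℕ} (P P' : Set (EuclideanSpace ℝ (Fin d))) : Prop :=
  ∃ (F : Set (EuclideanSpace ℝ (Fin d))) (w : EuclideanSpace ℝ (Fin d)),
    IsFacet P F ∧ (∃ k, IsSimplex k F) ∧ IsBeyond P F w ∧
    (∀ G, IsFacet P G → G ≠ F → IsBeneath P G w) ∧
    P' = convexHull ℝ (insert w P)

/-- `IsStacked n P`: the polytope `P` in `ℝᵈ` is obtained from some `d`-simplex by `n` successive
stackings, i.e. `P` is one of the polytopes `Stack(n, d)`. -/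
inductive IsStacked {d : ℕ} : ℕ → Set (EuclideanSpace ℝ (Fin d)) → Prop
  | simplex (P : Set (EuclideanSpace ℝ (Fin d))) : IsSimplex d P → IsStacked 0 P
  | stack (n : ℕ) (P P' : Set (EuclideanSpace ℝ (Fin d))) :
      IsStacked n P → IsStacking P P' → IsStacked (n + 1) P'

/-- `Q` is a deep vertex truncation of `P`: it is obtained by cutting off each vertex `v` of `P`
by a closed half-space `{x | l v x ≤ c v}` not containing `v`, in such a way that from each edge
of `P` exactly one point remains, which lies in the relative interior of the edge. -/
def IsDeepVertexTruncation {d : ℕ} (P Q : Set (EuclideanSpace ℝ (Fin d))) : Prop :=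
  ∃ (l : EuclideanSpace ℝ (Fin d) → (EuclideanSpace ℝ (Fin d) →L[ℝ] ℝ))
    (c : EuclideanSpace ℝ (Fin d) → ℝ),
    (∀ v ∈ P.exposedPoints ℝ, c v < l v v) ∧
    Q = P ∩ ⋂ v ∈ P.exposedPoints ℝ, {x | l v x ≤ c v} ∧
    ∀ e, IsFace 1 P e → ∃ p ∈ intrinsicInterior ℝ e, e ∩ Q = {p}

/-- A `2`-simple `2`-simplicial `4`-polytope: every `2`-face is a triangle, and every edge lies
in exactly three facets (equivalently, every `2`-face of the dual polytope is a triangle). -/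
def Is2Simple2Simplicial (P : Set (EuclideanSpace ℝ (Fin 4))) : Prop :=
  IsFullPolytope P ∧
  (∀ G, IsFace 2 P G → IsSimplex 2 G) ∧
  (∀ e, IsFace 1 P e → Set.ncard {F | IsFacet P F ∧ e ⊆ F} = 3)

end PolytopeTheory

open PolytopeTheory

/-! A stacked 4-polytope is simplicial, and its face lattice depends only on the abstract complex
that records the stackings (`exists_realizes_of_isStacked`, `Realizes.nonempty_orderIso`). Hence its
f-vector is a count, each stacking adding (1, 4, 6, 3), and it is enough to find one realization of
every `StackedComplex` that can be truncated well.

The truncation is carried through the induction as a family of affine functionals a_i with a_i(y_i)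
= -1, positive at the other vertices (`IsTruncation`). The zero of a_i divides the segment from y_i
to y_j in the ratio 1 : a_i(y_j), so the cuts at the two ends of an edge meet it in one common point
exactly when a_i(y_j) a_j(y_i) = 1. A product greater than 1 at non-edges keeps the parts cut off at
non-adjacent vertices disjoint.

The key step is `IsTruncation.exists_apex`. Some relatively interior point x of the facet T
satisfies a_m(x) > 0 for all m; the new apex w is put beyond T, close to x. The values b(w) = -1 and
b(y_v) = 1 / a_v(w) for v in T determine an affine functional b, since w and the vertices of T are
affinely independent. As w approaches T, b grows without bound at every vertex outside T, so the
product condition holds at the new non-edges.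

The truncated polytope Q is then analysed through the sets of inequalities that are tight at its
points (`IsTruncation.truncActive_cases`, `truncLabels`). Its vertices are the edge points. Its
edges are the pairs of a triangle τ of the complex and a vertex i of τ. Its 2-faces are the medial
triangles of the τ and the vertex figures of the tetrahedra, so all are triangles. Its facets come
from the vertices and the facets of P. The edge (i, τ) lies in the cut at i and in the two facets
through τ, which is 2-simplicity. The f-vector of Q is therefore (f₁, 3f₂, f₂ + 4f₃, f₀ + f₃) in
terms of that of P, and it is unbounded in n, which gives infinitely many types. -/

open PolytopeTheory

/-! ### Polyhedra given by inequalities, with faces described by tight sets. -/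

section HPolytope

variable {ι E : Type*} [NormedAddCommGroup E] [NormedSpace ℝ E]

/-- The polyhedron cut out by finitely many affine inequalities. -/
def hpoly (I : Finset ι) (h : ι → E →ᵃ[ℝ] ℝ) : Set E := {x | ∀ i ∈ I, 0 ≤ h i x}

open Classical in
/-- The inequalities that are tight at a point. -/
noncomputable def active (I : Finset ι) (h : ι → E →ᵃ[ℝ] ℝ) (x : E) : Finset ι :=
  I.filter fun i => h i x = 0

/-- The subset of a polyhedron on which the inequalities in `A` are tight. -/
def hface (I : Finset ι) (h : ι → E →ᵃ[ℝ] ℝ) (A : Finset ι) : Set E :=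
  {x | x ∈ hpoly I h ∧ ∀ i ∈ A, h i x = 0}

variable {I : Finset ι} {h : ι → E →ᵃ[ℝ] ℝ}

lemma mem_active {x : E} {i : ι} : i ∈ active I h x ↔ i ∈ I ∧ h i x = 0 := by
  simp [active]

lemma active_subset (x : E) : active I h x ⊆ I := fun _ hi => (mem_active.1 hi).1

lemma mem_hface_active {x : E} (hx : x ∈ hpoly I h) : x ∈ hface I h (active I h x) :=
  ⟨hx, fun _ hi => (mem_active.1 hi).2⟩

/-- The point x itself tests the inclusion. Faces are thus ordered by reverse inclusion of their
tight sets, as long as these are the tight sets of actual points. -/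
lemma hface_active_subset_iff {x : E} (hx : x ∈ hpoly I h) {B : Finset ι} (hB : B ⊆ I) :
    hface I h (active I h x) ⊆ hface I h B ↔ B ⊆ active I h x := by
  constructor
  · intro hs i hi
    exact mem_active.2 ⟨hB hi, (hs (mem_hface_active hx)).2 i hi⟩
  · intro hs y hy
    exact ⟨hy.1, fun i hi => hy.2 i (hs hi)⟩

lemma hface_active_inj {x y : E} (hx : x ∈ hpoly I h) (hy : y ∈ hpoly I h)
    (hxy : hface I h (active I h x) = hface I h (active I h y)) :
    active I h x = active I h y :=
  ((hface_active_subset_iff hy (active_subset x)).1 hxy.ge).antisymm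
    ((hface_active_subset_iff hx (active_subset y)).1 hxy.le)

lemma affineMap_lineMap (f : E →ᵃ[ℝ] ℝ) (x y : E) (t : ℝ) :
    f (x + t • (y - x)) = f x + t * (f y - f x) := by
  have := f.apply_lineMap x y t
  simp only [AffineMap.lineMap_apply, vsub_eq_sub, vadd_eq_add, smul_eq_mul] at this
  rw [add_comm x, this, add_comm]

lemma affineMap_add_smul (f : E →ᵃ[ℝ] ℝ) (x d : E) (t : ℝ) :
    f (x + t • d) = f x + t * f.linear d := by
  have := f.map_vadd x (t • d)
  simp only [vadd_eq_add, map_smul, smul_eq_mul] at this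
  rw [add_comm x, this, add_comm]

/-- Moving slightly from a point of a polyhedron in a direction along which all tight
inequalities stay tight. -/
lemma exists_pos_add_smul_mem_hface {x : E} (hx : x ∈ hpoly I h) {d : E}
    (hd : ∀ i ∈ active I h x, (h i).linear d = 0) :
    ∃ t : ℝ, 0 < t ∧ x + t • d ∈ hface I h (active I h x) := by
  have key : ∀ᶠ t : ℝ in nhdsWithin 0 (Set.Ioi 0), ∀ i ∈ I, 0 ≤ h i x + t * (h i).linear d := by
    rw [Filter.eventually_all_finset]
    intro i hi
    by_cases h0 : h i x = 0
    · simp [h0, hd i (mem_active.2 ⟨hi, h0⟩)]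
    · have hp : 0 < h i x := lt_of_le_of_ne (hx i hi) (Ne.symm h0)
      have hc : Continuous fun t : ℝ => h i x + t * (h i).linear d := by fun_prop
      have := (hc.tendsto 0).eventually (lt_mem_nhds (a := 0) (by simpa using hp))
      exact (this.filter_mono nhdsWithin_le_nhds).mono fun t ht => ht.le
  obtain ⟨t, ht, ht0⟩ := (key.and self_mem_nhdsWithin).exists
  refine ⟨t, ht0, fun i hi => ?_, fun i hi => ?_⟩
  · rw [affineMap_add_smul]; exact ht i hi
  · rw [affineMap_add_smul, hd i hi, (mem_active.1 hi).2]; simp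

/-- A point of a polyhedron is in the relative interior of its face: segments ending there can be
prolonged. -/
lemma exists_prolongation {x y : E} (hx : x ∈ hpoly I h) (hy : y ∈ hface I h (active I h x)) :
    ∃ t : ℝ, 0 < t ∧ x + t • (x - y) ∈ hface I h (active I h x) := by
  refine exists_pos_add_smul_mem_hface hx fun i hi => ?_
  have := (h i).linearMap_vsub x y
  simp only [vsub_eq_sub] at this
  rw [this, hy.2 i hi, (mem_active.1 hi).2, sub_zero]

/-- A direction that annihilates the tight functionals can be followed a little way from x, because
the other inequalities are strict there. This computes dimensions of faces. -/
lemma vectorSpan_hface_active {x : E} (hx : x ∈ hpoly I h) :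
    vectorSpan ℝ (hface I h (active I h x)) =
      ⨅ i ∈ active I h x, LinearMap.ker (h i).linear := by
  apply le_antisymm
  · rw [vectorSpan_def, Submodule.span_le]
    rintro _ ⟨a, ha, b, hb, rfl⟩
    simp only [SetLike.mem_coe, Submodule.mem_iInf, LinearMap.mem_ker]
    intro i hi
    simp only [(h i).linearMap_vsub, ha.2 i hi, hb.2 i hi, vsub_self]
  · intro d hd
    simp only [Submodule.mem_iInf, LinearMap.mem_ker] at hd
    obtain ⟨t, ht, hm⟩ := exists_pos_add_smul_mem_hface hx hd
    have := vsub_mem_vectorSpan ℝ hm (mem_hface_active hx)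
    simp only [vsub_eq_sub, add_sub_cancel_left] at this
    exact (Submodule.smul_mem_iff _ ht.ne').1 this

/-- Prolonging the segment from y beyond x would put x strictly inside a segment of the polyhedron.
-/
lemma eq_of_mem_extremePoints {x y : E} (hx : x ∈ (hpoly I h).extremePoints ℝ)
    (hy : y ∈ hface I h (active I h x)) : y = x := by
  obtain ⟨t, ht, hm⟩ := exists_prolongation hx.1 hy
  refine hx.2 hy.1 hm.1 ⟨t / (1 + t), 1 / (1 + t), by positivity, by positivity, ?_, ?_⟩
  · field_simp; ring
  · have h1 : 1 + t ≠ 0 := by positivity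
    rw [← sub_eq_zero]
    have : (t / (1 + t)) • y + (1 / (1 + t)) • (x + t • (x - y)) - x =
        ((1 + t) / (1 + t) - 1) • x := by
      module
    rw [this, div_self h1]; simp

lemma convex_hface (A : Finset ι) : Convex ℝ (hface I h A) := by
  intro x hx y hy a b ha hb hab
  have e : ∀ i, h i (a • x + b • y) = a * h i x + b * h i y := by
    intro i
    have := affineMap_lineMap (h i) x y b
    have e2 : a • x + b • y = x + b • (y - x) := by
      rw [← eq_sub_iff_add_eq] at hab; subst hab; module
    rw [e2, this]; rw [← eq_sub_iff_add_eq] at hab; subst hab; ring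
  refine ⟨fun i hi => ?_, fun i hi => ?_⟩
  · rw [e]; exact add_nonneg (mul_nonneg ha (hx.1 i hi)) (mul_nonneg hb (hy.1 i hi))
  · rw [e, hx.2 i hi, hy.2 i hi]; simp

lemma hface_empty : hface I h ∅ = hpoly I h := by
  ext x; simp [hface]

/-- Take x in F with the fewest tight inequalities. The midpoint of x and any y in F has only
inequalities tight that are tight at both, so by minimality all those tight at x are tight at y.
Conversely, if they are tight at y, the segment from y can be prolonged beyond x; since the exposing
functional is maximal at x, it is at least as large at y. -/
lemma exists_eq_hface_active {F : Set E} (hF : IsExposed ℝ (hpoly I h) F) (hne : F.Nonempty) :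
    ∃ x ∈ F, F = hface I h (active I h x) := by
  classical
  have hsub := hF.subset
  have hconv : Convex ℝ F := hF.convex (hface_empty (I := I) (h := h) ▸ convex_hface ∅)
  obtain ⟨x, hxF, hmin⟩ : ∃ x ∈ F, ∀ y ∈ F, (active I h x).card ≤ (active I h y).card := by
    have := WellFounded.has_min (measure fun x : E => (active I h x).card).wf F hne
    obtain ⟨x, hx, hm⟩ := this
    exact ⟨x, hx, fun y hy => not_lt.1 (hm y hy)⟩
  refine ⟨x, hxF, Set.Subset.antisymm (fun y hy => ⟨hsub hy, ?_⟩) ?_⟩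
  · have hmF : x + (1 / 2 : ℝ) • (y - x) ∈ F := hconv.add_smul_sub_mem hxF hy (by norm_num)
    have hsubset : active I h (x + (1 / 2 : ℝ) • (y - x)) ⊆ active I h x ∩ active I h y := by
      intro i hi
      obtain ⟨hiI, hi0⟩ := mem_active.1 hi
      rw [affineMap_lineMap] at hi0
      have h1 := hsub hxF i hiI
      have h2 := hsub hy i hiI
      exact Finset.mem_inter.2
        ⟨mem_active.2 ⟨hiI, by linarith⟩, mem_active.2 ⟨hiI, by linarith⟩⟩
    have hle := hmin _ hmF
    have heq := Finset.eq_of_subset_of_card_le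
      (hsubset.trans Finset.inter_subset_left) hle
    intro i hi
    exact (mem_active.1 (Finset.mem_inter.1 (hsubset (heq ▸ hi))).2).2
  · intro y hy
    obtain ⟨l, rfl⟩ := hF hne
    refine ⟨hy.1, fun z hz => ?_⟩
    obtain ⟨t, ht, hm⟩ := exists_prolongation (hsub hxF) hy
    have h1 := hxF.2 _ hm.1
    simp only [map_add, map_smul, map_sub, smul_eq_mul] at h1
    have h2 : l x ≤ l y := by nlinarith
    exact (hxF.2 z hz).trans h2

/-- A face has a point at which only the inequalities valid as equations on the whole face are
tight. So each inequality outside A may be refuted by its own witness; no common witness has to be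
constructed. -/
lemma exists_active_eq {A : Finset ι} (hA : A ⊆ I)
    (hexp : IsExposed ℝ (hpoly I h) (hface I h A))
    (hne : (hface I h A).Nonempty)
    (hcl : ∀ i ∈ I, i ∉ A → ∃ y ∈ hface I h A, h i y ≠ 0) :
    ∃ x ∈ hpoly I h, active I h x = A := by
  obtain ⟨x, hx, he⟩ := exists_eq_hface_active hexp hne
  refine ⟨x, hx.1, Finset.Subset.antisymm (fun i hi => ?_)
    fun i hi => mem_active.2 ⟨hA hi, hx.2 i hi⟩⟩
  by_contra hiA
  obtain ⟨y, hy, hy0⟩ := hcl i (active_subset x hi) hiA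
  exact hy0 ((he ▸ hy).2 i hi)

/-- The sum of the functionals in A is nonnegative on the polyhedron and vanishes only where every
summand does. Its negated linear part exposes the face. -/
lemma isExposed_hface [FiniteDimensional ℝ E] {A : Finset ι} (hA : A ⊆ I) :
    IsExposed ℝ (hpoly I h) (hface I h A) := by
  rintro ⟨x₀, hx₀⟩
  let l : E →ₗ[ℝ] ℝ := -∑ i ∈ A, (h i).linear
  have hl : ∀ x y, l x - l y = ∑ i ∈ A, h i y - ∑ i ∈ A, h i x := by
    intro x y
    rw [← map_sub, ← Finset.sum_sub_distrib]
    simp only [l, LinearMap.neg_apply, LinearMap.sum_apply, ← Finset.sum_neg_distrib]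
    refine Finset.sum_congr rfl fun i _ => ?_
    have := (h i).linearMap_vsub x y
    simp only [vsub_eq_sub] at this
    rw [this]; ring
  refine ⟨LinearMap.toContinuousLinearMap l, ?_⟩
  ext x
  simp only [LinearMap.coe_toContinuousLinearMap', Set.mem_ofPred_eq]
  constructor
  · intro hx
    refine ⟨hx.1, fun y hy => ?_⟩
    have h1 := hl y x
    rw [Finset.sum_eq_zero hx.2] at h1
    have h2 : 0 ≤ ∑ i ∈ A, h i y := Finset.sum_nonneg fun i hi => hy i (hA hi)
    linarith
  · rintro ⟨hx, hmax⟩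
    have h1 := hl x₀ x
    rw [Finset.sum_eq_zero hx₀.2] at h1
    have h2 := hmax x₀ hx₀.1
    have h3 : ∑ i ∈ A, h i x = 0 :=
      le_antisymm (by linarith) (Finset.sum_nonneg fun i hi => hx i (hA hi))
    exact ⟨hx, (Finset.sum_eq_zero_iff_of_nonneg fun i hi => hx i (hA hi)).1 h3⟩

end HPolytope

/-! ### Convex hulls of finite families and a criterion for affine independence. -/

section Hulls

variable {κ E : Type*} [NormedAddCommGroup E] [NormedSpace ℝ E]

lemma affineMap_sum (f : E →ᵃ[ℝ] ℝ) (s : Finset κ) (w : κ → ℝ) (y : κ → E)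
    (hw : ∑ k ∈ s, w k = 1) : f (∑ k ∈ s, w k • y k) = ∑ k ∈ s, w k * f (y k) := by
  rw [← Finset.affineCombination_eq_linear_combination s y w hw,
    Finset.map_affineCombination s y w hw, Finset.affineCombination_eq_linear_combination _ _ _ hw]
  rfl

lemma mem_convexHull_image_iff (s : Finset κ) (y : κ → E) (x : E) :
    x ∈ convexHull ℝ (y '' (s : Set κ)) ↔
      ∃ w : κ → ℝ, (∀ k ∈ s, 0 ≤ w k) ∧ ∑ k ∈ s, w k = 1 ∧ ∑ k ∈ s, w k • y k = x := by
  classical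
  constructor
  · intro hx
    refine convexHull_min (t := {x | ∃ w : κ → ℝ, (∀ k ∈ s, 0 ≤ w k) ∧ ∑ k ∈ s, w k = 1 ∧
      ∑ k ∈ s, w k • y k = x}) ?_ ?_ hx
    · rintro _ ⟨k, hk, rfl⟩
      have hk' : k ∈ s := hk
      refine ⟨Pi.single k 1, fun j _ => ?_, ?_, ?_⟩
      · by_cases hjk : j = k
        · subst hjk; simp
        · simp [Pi.single_eq_of_ne hjk]
      · simp [Pi.single_apply, hk']
      · simp [Pi.single_apply, hk']
    · rintro _ ⟨w, hw0, hw1, rfl⟩ _ ⟨v, hv0, hv1, rfl⟩ a b ha hb hab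
      refine ⟨fun k => a * w k + b * v k, fun k hk => ?_, ?_, ?_⟩
      · exact add_nonneg (mul_nonneg ha (hw0 k hk)) (mul_nonneg hb (hv0 k hk))
      · rw [Finset.sum_add_distrib, ← Finset.mul_sum, ← Finset.mul_sum, hw1, hv1]; simpa using hab
      · simp only [add_smul, Finset.sum_add_distrib, Finset.smul_sum, mul_smul]
  · rintro ⟨w, hw0, hw1, rfl⟩
    exact (convex_convexHull ℝ _).sum_mem hw0 hw1
      fun k hk => subset_convexHull ℝ _ ⟨k, hk, rfl⟩

/-- A supporting hyperplane meets the hull of a finite family in the hull of a subfamily. -/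
lemma mem_convexHull_filter {s t : Finset κ} {y : κ → E} {x : E}
    (hx : x ∈ convexHull ℝ (y '' (s : Set κ))) (f : E →ᵃ[ℝ] ℝ)
    (hpos : ∀ k ∈ s, k ∉ t → 0 < f (y k)) (hnn : ∀ k ∈ s, 0 ≤ f (y k)) (hf : f x ≤ 0)
    (hts : t ⊆ s) :
    x ∈ convexHull ℝ (y '' (t : Set κ)) := by
  obtain ⟨w, hw0, hw1, rfl⟩ := (mem_convexHull_image_iff s y x).1 hx
  rw [affineMap_sum f s w y hw1] at hf
  have h0 : ∀ k ∈ s, w k * f (y k) = 0 :=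
    (Finset.sum_eq_zero_iff_of_nonneg fun k hk => mul_nonneg (hw0 k hk) (hnn k hk)).1
      (le_antisymm hf (Finset.sum_nonneg fun k hk => mul_nonneg (hw0 k hk) (hnn k hk)))
  have hz : ∀ k ∈ s, k ∉ t → w k = 0 := fun k hk hkt =>
    (mul_eq_zero.1 (h0 k hk)).resolve_right (hpos k hk hkt).ne'
  refine (mem_convexHull_image_iff t y _).2 ⟨w, fun k hk => hw0 k (hts hk), ?_, ?_⟩
  · rw [← hw1]; exact Finset.sum_subset hts hz
  · exact Finset.sum_subset hts fun k hk hkt => by rw [hz k hk hkt, zero_smul]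

/-- A family of points with a dual family of affine functionals is affinely independent. -/
lemma affineIndependent_of_dual [Fintype κ] (p : κ → E) (φ : κ → E →ᵃ[ℝ] ℝ)
    (h0 : ∀ i j, i ≠ j → φ i (p j) = 0) (h1 : ∀ i, φ i (p i) ≠ 0) : AffineIndependent ℝ p := by
  rw [affineIndependent_iff_of_fintype]
  intro w hw hs i
  have hlin : ∀ f : E →ᵃ[ℝ] ℝ, ∑ j, w j * f (p j) = 0 := by
    intro f
    rw [Finset.weightedVSub_eq_linear_combination _ hw] at hs
    have e : ∀ j, f (p j) = f.linear (p j) + f 0 := fun j => by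
      have := f.map_vadd 0 (p j); simpa using this
    simp only [e, mul_add, Finset.sum_add_distrib, ← Finset.sum_mul, hw, zero_mul, add_zero]
    have := congrArg f.linear hs
    simpa [map_sum] using this
  have := hlin (φ i)
  rw [Finset.sum_eq_single i (fun j _ hj => by rw [h0 i j hj.symm, mul_zero]) (by simp)] at this
  exact (mul_eq_zero.1 this).resolve_right (h1 i)

end Hulls

/-! ### The simplicial complexes of stacked 4-polytopes and their face numbers. -/

section Combinatorics

open Finset

/-- The faces of the simplicial complex with facets `𝓕`. -/
def faces (𝓕 : Finset (Finset ℕ)) : Finset (Finset ℕ) := 𝓕.biUnion powerset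

/-- The faces with exactly `k` vertices. -/
def facesCard (𝓕 : Finset (Finset ℕ)) (k : ℕ) : Finset (Finset ℕ) := {σ ∈ faces 𝓕 | σ.card = k}

/-- The facets after stacking a pyramid with apex `w` onto the facet `T`. -/
def stackAt (𝓕 : Finset (Finset ℕ)) (T : Finset ℕ) (w : ℕ) : Finset (Finset ℕ) :=
  𝓕.erase T ∪ T.image fun v => insert w (T.erase v)

/-- The combinatorics of stacked `4`-polytopes: the vertices are `0, …, 4 + n`, and the second
argument is the set of facets. -/
inductive StackedComplex : ℕ → Finset (Finset ℕ) → Prop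
  | simplex : StackedComplex 0 ((range 5).powersetCard 4)
  | stack (n : ℕ) (𝓕 : Finset (Finset ℕ)) (T : Finset ℕ) :
      StackedComplex n 𝓕 → T ∈ 𝓕 → StackedComplex (n + 1) (stackAt 𝓕 T (5 + n))

/-- A family of `4`-sets covering `0, …, N - 1` in which every ridge lies in two facets. -/
structure IsPseudoManifold (N : ℕ) (𝓕 : Finset (Finset ℕ)) : Prop where
  lt : ∀ T ∈ 𝓕, ∀ k ∈ T, k < N
  card : ∀ T ∈ 𝓕, T.card = 4
  ridge : ∀ σ ∈ faces 𝓕, σ.card = 3 → {T ∈ 𝓕 | σ ⊆ T}.card = 2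
  cover : ∀ k < N, ∃ T ∈ 𝓕, k ∈ T
  nonempty : 𝓕.Nonempty

variable {N w : ℕ} {𝓕 : Finset (Finset ℕ)} {T σ τ : Finset ℕ}

lemma mem_faces : σ ∈ faces 𝓕 ↔ ∃ T ∈ 𝓕, σ ⊆ T := by simp [faces]

lemma mem_facesCard {k : ℕ} : σ ∈ facesCard 𝓕 k ↔ σ ∈ faces 𝓕 ∧ σ.card = k := by
  simp [facesCard]

lemma faces_mono (hσ : σ ∈ faces 𝓕) (h : τ ⊆ σ) : τ ∈ faces 𝓕 := by
  obtain ⟨T, hT, hs⟩ := mem_faces.1 hσ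
  exact mem_faces.2 ⟨T, hT, h.trans hs⟩

lemma mem_faces_of_mem (hT : T ∈ 𝓕) : T ∈ faces 𝓕 := mem_faces.2 ⟨T, hT, Subset.rfl⟩

lemma mem_stackAt {U : Finset ℕ} :
    U ∈ stackAt 𝓕 T w ↔ (U ∈ 𝓕 ∧ U ≠ T) ∨ ∃ v ∈ T, U = insert w (T.erase v) := by
  simp only [stackAt, mem_union, mem_erase, mem_image, and_comm, eq_comm]

lemma insert_erase_injOn (hw : w ∉ T) : Set.InjOn (fun v => insert w (T.erase v)) (T : Set ℕ) := by
  intro u hu v hv huv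
  by_contra hne
  have : u ∈ insert w (T.erase v) := mem_insert_of_mem (mem_erase.2 ⟨hne, hu⟩)
  rw [← show insert w (T.erase u) = insert w (T.erase v) from huv] at this
  rcases mem_insert.1 this with rfl | h'
  · exact hw hu
  · exact notMem_erase u T h'

namespace IsPseudoManifold

variable (h : IsPseudoManifold N 𝓕)
include h

lemma eq_of_subset {U : Finset ℕ} (hT : T ∈ 𝓕) (hU : U ∈ 𝓕) (hs : T ⊆ U) : T = U :=
  eq_of_subset_of_card_le hs (by rw [h.card T hT, h.card U hU])

lemma lt_of_mem_faces (hσ : σ ∈ faces 𝓕) {k : ℕ} (hk : k ∈ σ) : k < N := by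
  obtain ⟨T, hT, hs⟩ := mem_faces.1 hσ
  exact h.lt T hT k (hs hk)

lemma card_le_of_mem_faces (hσ : σ ∈ faces 𝓕) : σ.card ≤ 4 := by
  obtain ⟨T, hT, hs⟩ := mem_faces.1 hσ
  exact (card_le_card hs).trans (h.card T hT).le

lemma mem_of_mem_faces (hσ : σ ∈ faces 𝓕) (hc : σ.card = 4) : σ ∈ 𝓕 := by
  obtain ⟨T, hT, hs⟩ := mem_faces.1 hσ
  rwa [eq_of_subset_of_card_le hs (by rw [h.card T hT, hc])]

lemma facesCard_four : facesCard 𝓕 4 = 𝓕 := by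
  ext σ
  rw [mem_facesCard]
  exact ⟨fun hσ => h.mem_of_mem_faces hσ.1 hσ.2, fun hσ => ⟨mem_faces_of_mem hσ, h.card σ hσ⟩⟩

/-- The second facet through the ridge opposite v cannot contain v, since it would then contain T.
-/
lemma exists_adjacent (hT : T ∈ 𝓕) {v : ℕ} (hv : v ∈ T) :
    ∃ U ∈ 𝓕, T.erase v ⊆ U ∧ v ∉ U := by
  have hσ : T.erase v ∈ faces 𝓕 := mem_faces.2 ⟨T, hT, erase_subset _ _⟩
  have hc := h.ridge _ hσ (by rw [card_erase_of_mem hv, h.card T hT])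
  obtain ⟨U, hU, hne⟩ := exists_mem_ne (by rw [hc]; norm_num) T
  obtain ⟨hU, hs⟩ := mem_filter.1 hU
  refine ⟨U, hU, hs, fun hvU => hne ?_⟩
  refine (h.eq_of_subset hT hU ?_).symm
  rw [← insert_erase hv]
  exact insert_subset hvU hs

/-- In other words, a face is the intersection of the facets containing it. This is what lets faces
be recovered from their sets of cofaces. -/
lemma exists_notMem (hσ : σ ∈ faces 𝓕) {v : ℕ} (hv : v ∉ σ) : ∃ T ∈ 𝓕, σ ⊆ T ∧ v ∉ T := by
  obtain ⟨T, hT, hs⟩ := mem_faces.1 hσ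
  by_cases hvT : v ∈ T
  · obtain ⟨U, hU, hsub, hvU⟩ := h.exists_adjacent hT hvT
    exact ⟨U, hU, (subset_erase.2 ⟨hs, hv⟩).trans hsub, hvU⟩
  · exact ⟨T, hT, hs, hvT⟩

lemma exists_lt_notMem (hT : T ∈ 𝓕) : ∃ u < N, u ∉ T := by
  obtain ⟨v, hv⟩ : T.Nonempty := card_pos.1 (by rw [h.card T hT]; norm_num)
  obtain ⟨U, hU, -, hvU⟩ := h.exists_adjacent hT hv
  obtain ⟨u, huU, huT⟩ : ∃ u ∈ U, u ∉ T := by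
    by_contra! hall
    exact hvU (h.eq_of_subset hU hT hall ▸ hv)
  exact ⟨u, h.lt U hU u huU, huT⟩

lemma exists_mem_notMem {U : Finset ℕ} (hT : T ∈ 𝓕) (hU : U ∈ 𝓕) (hne : T ≠ U) :
    ∃ k ∈ T, k ∉ U := by
  by_contra! hall
  exact hne (h.eq_of_subset hT hU hall)

variable (hT : T ∈ 𝓕) (hw : ∀ U ∈ 𝓕, w ∉ U)
include hT hw

/-- Stacking loses T alone and adds the cones with apex w over the proper faces of T. -/
lemma mem_faces_stackAt :
    σ ∈ faces (stackAt 𝓕 T w) ↔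
      (w ∉ σ ∧ σ ∈ faces 𝓕 ∧ σ ≠ T) ∨ (w ∈ σ ∧ σ.erase w ⊂ T) := by
  rw [mem_faces]
  constructor
  · rintro ⟨U, hU, hs⟩
    rcases mem_stackAt.1 hU with ⟨hU, hne⟩ | ⟨v, hv, rfl⟩
    · refine Or.inl ⟨fun hwσ => hw U hU (hs hwσ), mem_faces.2 ⟨U, hU, hs⟩, fun hσT => ?_⟩
      exact hne (h.eq_of_subset hT hU (hσT ▸ hs)).symm
    · have hsub : σ.erase w ⊂ T :=
        (subset_insert_iff.1 hs).trans_ssubset (erase_ssubset hv)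
      by_cases hwσ : w ∈ σ
      · exact Or.inr ⟨hwσ, hsub⟩
      · rw [erase_eq_of_notMem hwσ] at hsub
        exact Or.inl ⟨hwσ, mem_faces.2 ⟨T, hT, hsub.1⟩, hsub.ne⟩
  · have aux : ∀ ρ, ρ ⊂ T → ∃ U ∈ stackAt 𝓕 T w, insert w ρ ⊆ U := by
      intro ρ hρ
      obtain ⟨v, hv, hvρ⟩ := exists_of_ssubset hρ
      exact ⟨_, mem_stackAt.2 (Or.inr ⟨v, hv, rfl⟩),
        insert_subset_insert _ (subset_erase.2 ⟨hρ.1, hvρ⟩)⟩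
    rintro (⟨hwσ, hσ, hne⟩ | ⟨hwσ, hs⟩)
    · obtain ⟨U, hU, hs⟩ := mem_faces.1 hσ
      by_cases hUT : U = T
      · subst hUT
        obtain ⟨U', hU', hs'⟩ := aux σ (hs.ssubset_of_ne hne)
        exact ⟨U', hU', (subset_insert _ _).trans hs'⟩
      · exact ⟨U, mem_stackAt.2 (Or.inl ⟨hU, hUT⟩), hs⟩
    · obtain ⟨U', hU', hs'⟩ := aux _ hs
      exact ⟨U', hU', by rwa [insert_erase hwσ] at hs'⟩

lemma card_stackAt : (stackAt 𝓕 T w).card = 𝓕.card + 3 := by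
  rw [stackAt, card_union_of_disjoint, card_erase_of_mem hT,
    card_image_of_injOn (insert_erase_injOn (hw T hT)), h.card T hT]
  · have := card_pos.2 ⟨T, hT⟩; omega
  · rw [disjoint_left]
    intro U hU hU'
    obtain ⟨v, -, rfl⟩ := mem_image.1 hU'
    exact hw _ (mem_erase.1 hU).2 (mem_insert_self _ _)

/-- Since T has four vertices, no face with at most three is lost, and every k-subset of T is
proper, so its cone is a new face. -/
lemma card_facesCard_stackAt {k : ℕ} (hk : k ≤ 2) :
    (facesCard (stackAt 𝓕 T w) (k + 1)).card = (facesCard 𝓕 (k + 1)).card + Nat.choose 4 k := by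
  have hinj : Set.InjOn (insert w) (T.powersetCard k : Set (Finset ℕ)) := by
    intro ρ hρ ρ' hρ' he
    have h1 : w ∉ ρ := fun hc => hw T hT ((mem_powersetCard.1 hρ).1 hc)
    have h2 : w ∉ ρ' := fun hc => hw T hT ((mem_powersetCard.1 hρ').1 hc)
    rw [← erase_insert h1, ← erase_insert h2, he]
  have hset : facesCard (stackAt 𝓕 T w) (k + 1) =
      facesCard 𝓕 (k + 1) ∪ (T.powersetCard k).image (insert w) := by
    ext σ
    simp only [mem_union, mem_facesCard, mem_image, mem_powersetCard, h.mem_faces_stackAt hT hw]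
    constructor
    · rintro ⟨⟨-, hσ, -⟩ | ⟨hwσ, hs⟩, hc⟩
      · exact Or.inl ⟨hσ, hc⟩
      · exact Or.inr ⟨σ.erase w, ⟨hs.1, by rw [card_erase_of_mem hwσ, hc]; rfl⟩, insert_erase hwσ⟩
    · rintro (⟨hσ, hc⟩ | ⟨ρ, ⟨hρ, hc⟩, rfl⟩)
      · refine ⟨Or.inl ⟨?_, hσ, ?_⟩, hc⟩
        · obtain ⟨U, hU, hs⟩ := mem_faces.1 hσ
          exact fun hc => hw U hU (hs hc)
        · rintro rfl; have := h.card _ hT; omega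
      · have hwρ : w ∉ ρ := fun hc => hw T hT (hρ hc)
        refine ⟨Or.inr ⟨mem_insert_self _ _, ?_⟩, by rw [card_insert_of_notMem hwρ, hc]⟩
        rw [erase_insert hwρ]
        refine hρ.ssubset_of_ne ?_
        rintro rfl; have := h.card _ hT; omega
  rw [hset, card_union_of_disjoint, card_image_of_injOn hinj, card_powersetCard, h.card T hT]
  rw [disjoint_left]
  intro σ hσ hσ'
  obtain ⟨ρ, -, rfl⟩ := mem_image.1 hσ'
  obtain ⟨U, hU, hs⟩ := mem_faces.1 (mem_facesCard.1 hσ).1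
  exact hw U hU (hs (mem_insert_self _ _))

/-- For an old ridge inside T, the cone over it takes the place of T; for an old ridge not in T
nothing changes. A ridge through w uses two vertices of T, and the cones containing it correspond to
the two remaining vertices. -/
lemma card_ridge_stackAt (hσ : σ ∈ faces (stackAt 𝓕 T w)) (hc : σ.card = 3) :
    {U ∈ stackAt 𝓕 T w | σ ⊆ U}.card = 2 := by
  have hwT := hw T hT
  rcases (h.mem_faces_stackAt hT hw).1 hσ with ⟨hwσ, hσ', -⟩ | ⟨hwσ, hs⟩
  · have hold := h.ridge σ hσ' hc
    by_cases hσT : σ ⊆ T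
    · obtain ⟨v, hvT, hvσ⟩ : ∃ v ∈ T, v ∉ σ := by
        by_contra! hall
        have := card_le_card (show T ⊆ σ from hall)
        rw [h.card T hT] at this; omega
      have hσe : σ = T.erase v := eq_of_subset_of_card_le (subset_erase.2 ⟨hσT, hvσ⟩)
        (by rw [card_erase_of_mem hvT, h.card T hT, hc])
      have hset : ({U ∈ stackAt 𝓕 T w | σ ⊆ U} : Finset (Finset ℕ)) =
          insert (insert w σ) (({U ∈ 𝓕 | σ ⊆ U} : Finset (Finset ℕ)).erase T) := by
        ext U
        simp only [mem_filter, mem_stackAt, mem_insert, mem_erase]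
        constructor
        · rintro ⟨⟨hU, hne⟩ | ⟨u, hu, rfl⟩, hs⟩
          · exact Or.inr ⟨hne, hU, hs⟩
          · left
            have : u = v := by
              by_contra hne
              have huσ : u ∈ σ := hσe ▸ mem_erase.2 ⟨hne, hu⟩
              rcases mem_insert.1 (hs huσ) with rfl | h'
              · exact hwσ huσ
              · exact notMem_erase u T h'
            rw [this, hσe]
        · rintro (rfl | ⟨hne, hU, hs⟩)
          · exact ⟨Or.inr ⟨v, hvT, by rw [hσe]⟩, subset_insert _ _⟩
          · exact ⟨Or.inl ⟨hU, hne⟩, hs⟩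
      rw [hset, card_insert_of_notMem, card_erase_of_mem (mem_filter.2 ⟨hT, hσT⟩), hold]
      intro hmem
      exact hw _ (mem_filter.1 (mem_erase.1 hmem).2).1 (mem_insert_self _ _)
    · rw [← hold]
      congr 1
      ext U
      simp only [mem_filter, mem_stackAt]
      constructor
      · rintro ⟨⟨hU, -⟩ | ⟨u, hu, rfl⟩, hs⟩
        · exact ⟨hU, hs⟩
        · exact absurd ((subset_insert_iff_of_notMem hwσ).1 hs |>.trans (erase_subset _ _)) hσT
      · rintro ⟨hU, hs⟩
        exact ⟨Or.inl ⟨hU, by rintro rfl; exact hσT hs⟩, hs⟩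
  · have hset : ({U ∈ stackAt 𝓕 T w | σ ⊆ U} : Finset (Finset ℕ)) =
        (T \ σ.erase w).image fun v => insert w (T.erase v) := by
      ext U
      simp only [mem_filter, mem_stackAt, mem_image, mem_sdiff]
      constructor
      · rintro ⟨⟨hU, -⟩ | ⟨u, hu, rfl⟩, hs'⟩
        · exact absurd (hs' hwσ) (hw U hU)
        · refine ⟨u, ⟨hu, fun huσ => ?_⟩, rfl⟩
          exact notMem_erase u T (subset_insert_iff.1 hs' huσ)
      · rintro ⟨u, ⟨hu, huσ⟩, rfl⟩
        exact ⟨Or.inr ⟨u, hu, rfl⟩,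
          subset_insert_iff.2 (subset_erase.2 ⟨hs.1, huσ⟩)⟩
    rw [hset, card_image_of_injOn ((insert_erase_injOn (hw T hT)).mono (by simp)),
      card_sdiff_of_subset hs.1, card_erase_of_mem hwσ, hc, h.card T hT]

end IsPseudoManifold

lemma IsPseudoManifold.stackAt (h : IsPseudoManifold N 𝓕) (hT : T ∈ 𝓕) :
    IsPseudoManifold (N + 1) (stackAt 𝓕 T N) := by
  have hw : ∀ U ∈ 𝓕, N ∉ U := fun U hU hN => lt_irrefl _ (h.lt U hU N hN)
  refine ⟨?_, ?_, fun σ hσ hc => h.card_ridge_stackAt hT hw hσ hc, ?_, ?_⟩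
  · intro U hU k hk
    rcases mem_stackAt.1 hU with ⟨hU, -⟩ | ⟨v, hv, rfl⟩
    · exact (h.lt U hU k hk).trans (Nat.lt_succ_self _)
    · rcases mem_insert.1 hk with rfl | hk
      · exact Nat.lt_succ_self _
      · exact (h.lt T hT k (mem_of_mem_erase hk)).trans (Nat.lt_succ_self _)
  · intro U hU
    rcases mem_stackAt.1 hU with ⟨hU, -⟩ | ⟨v, hv, rfl⟩
    · exact h.card U hU
    · rw [card_insert_of_notMem fun hc => hw T hT (mem_of_mem_erase hc), card_erase_of_mem hv,
        h.card T hT]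
  · obtain ⟨v, hv⟩ : T.Nonempty := card_pos.1 (by rw [h.card T hT]; norm_num)
    intro k hk
    have hface : ({k} : Finset ℕ) ∈ faces (_root_.stackAt 𝓕 T N) := by
      rw [h.mem_faces_stackAt hT hw]
      rcases Nat.lt_succ_iff_lt_or_eq.1 hk with hk | rfl
      · left
        obtain ⟨U, hU, hkU⟩ := h.cover k hk
        refine ⟨by simpa using hk.ne', mem_faces.2 ⟨U, hU, by simpa using hkU⟩, ?_⟩
        rintro rfl
        have := h.card _ hT
        simp at this
      · right
        refine ⟨by simp, ?_⟩
        simpa using ⟨v, hv⟩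
    obtain ⟨U, hU, hs⟩ := mem_faces.1 hface
    exact ⟨U, hU, hs (by simp)⟩
  · obtain ⟨v, hv⟩ : T.Nonempty := card_pos.1 (by rw [h.card T hT]; norm_num)
    exact ⟨_, mem_stackAt.2 (Or.inr ⟨v, hv, rfl⟩)⟩

lemma facesCard_simplex {k : ℕ} (hk : k ≤ 4) :
    facesCard ((range 5).powersetCard 4) k = (range 5).powersetCard k := by
  ext σ
  simp only [mem_facesCard, mem_faces, mem_powersetCard]
  constructor
  · rintro ⟨⟨T, ⟨hT, -⟩, hs⟩, hc⟩
    exact ⟨hs.trans hT, hc⟩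
  · rintro ⟨hs, hc⟩
    obtain ⟨T, h1, h2, h3⟩ := exists_subsuperset_card_eq hs (by omega : σ.card ≤ 4) (by simp)
    exact ⟨⟨T, ⟨h2, h3⟩, h1⟩, hc⟩

lemma isPseudoManifold_simplex : IsPseudoManifold 5 ((range 5).powersetCard 4) where
  lt T hT k hk := mem_range.1 ((mem_powersetCard.1 hT).1 hk)
  card T hT := (mem_powersetCard.1 hT).2
  ridge := by decide
  cover := by decide
  nonempty := by decide

lemma StackedComplex.isPseudoManifold {n : ℕ} (h : StackedComplex n 𝓕) :
    IsPseudoManifold (5 + n) 𝓕 := by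
  induction h with
  | simplex => exact isPseudoManifold_simplex
  | stack n 𝓕 T _ hT ih => exact ih.stackAt hT

lemma StackedComplex.card_eq {n : ℕ} (h : StackedComplex n 𝓕) :
    (facesCard 𝓕 1).card = 5 + n ∧ (facesCard 𝓕 2).card = 10 + 4 * n ∧
      (facesCard 𝓕 3).card = 10 + 6 * n ∧ 𝓕.card = 5 + 3 * n := by
  induction h with
  | simplex =>
    simp only [facesCard_simplex (show 1 ≤ 4 by norm_num), facesCard_simplex (show 2 ≤ 4 by norm_num),
      facesCard_simplex (show 3 ≤ 4 by norm_num), card_powersetCard, card_range]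
    decide
  | stack n 𝓕 T h hT ih =>
    have hM := h.isPseudoManifold
    have hw : ∀ U ∈ 𝓕, 5 + n ∉ U := fun U hU hN => lt_irrefl _ (hM.lt U hU _ hN)
    have h0 := hM.card_facesCard_stackAt hT hw (k := 0) (by norm_num)
    have h1 := hM.card_facesCard_stackAt hT hw (k := 1) (by norm_num)
    have h2 := hM.card_facesCard_stackAt hT hw (k := 2) (by norm_num)
    have h3 := hM.card_stackAt hT hw
    norm_num [Nat.choose] at h0 h1 h2
    omega

lemma exists_stackedComplex (n : ℕ) : ∃ 𝓕, StackedComplex n 𝓕 := by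
  induction n with
  | zero => exact ⟨_, .simplex⟩
  | succ n ih =>
    obtain ⟨𝓕, h⟩ := ih
    obtain ⟨T, hT⟩ := h.isPseudoManifold.nonempty
    exact ⟨_, .stack n 𝓕 T h hT⟩

end Combinatorics

/-! ### Geometric realizations of a complex and their face lattices. -/

section Realization

open Finset

/-- Euclidean four-space. -/
abbrev E4 := EuclideanSpace ℝ (Fin 4)

/-- The convex hull of the points of a family with labels in `σ`. -/
abbrev hull (y : ℕ → E4) (σ : Finset ℕ) : Set E4 := convexHull ℝ (y '' (σ : Set ℕ))

/-- `g` is nonnegative on the points `y 0, …, y (N - 1)`, and vanishes exactly at those with label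
in `T`. -/
def IsSupporting (N : ℕ) (y : ℕ → E4) (T : Finset ℕ) (g : E4 →ᵃ[ℝ] ℝ) : Prop :=
  (∀ k ∈ T, g (y k) = 0) ∧ ∀ k < N, k ∉ T → 0 < g (y k)

/-- The hull of `y 0, …, y (N - 1)` is a simplicial `4`-polytope whose facets are the simplices
with vertex labels in `𝓕`. -/
structure Realizes (N : ℕ) (𝓕 : Finset (Finset ℕ)) (y : ℕ → E4) : Prop where
  supp : ∀ T ∈ 𝓕, ∃ g, IsSupporting N y T g
  indep : ∀ T ∈ 𝓕, AffineIndependent ℝ fun k : T => y k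
  mem : ∀ x, (∀ T ∈ 𝓕, ∀ g, IsSupporting N y T g → 0 ≤ g x) → x ∈ hull y (range N)

lemma affineMap_eq_linear_add {E : Type*} [NormedAddCommGroup E] [NormedSpace ℝ E]
    (f : E →ᵃ[ℝ] ℝ) (x : E) : f x = f.linear x + f 0 := by
  have := f.map_vadd 0 x
  simpa using this

/-- Barycentric coordinates with respect to a `4`-simplex, written as a pyramid. -/
lemma exists_coords {T : Finset ℕ} {y : ℕ → E4} (hi : AffineIndependent ℝ fun k : T => y k)
    (hc : T.card = 4) {g : E4 →ᵃ[ℝ] ℝ} (h0 : ∀ k ∈ T, g (y k) = 0) {o : E4} (ho : g o ≠ 0) :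
    ∃ β : ℕ → E4 →ᵃ[ℝ] ℝ, (∀ i ∈ T, ∀ j ∈ T, β i (y j) = if i = j then 1 else 0) ∧
      (∀ i ∈ T, β i o = 0) ∧ (∀ x, ∑ i ∈ T, β i x + g x / g o = 1) ∧
      ∀ x, ∑ i ∈ T, β i x • y i + (g x / g o) • o = x := by
  classical
  let p : Option T → E4 := fun k => k.elim o fun k => y k
  have hind : AffineIndependent ℝ p := by
    rw [affineIndependent_iff_of_fintype]
    intro w hw hs
    rw [weightedVSub_eq_linear_combination _ hw] at hs
    rw [Fintype.sum_option] at hs hw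
    simp only [p, Option.elim] at hs
    -- Applying `g` to the dependency kills every point of `T` and isolates the weight of the apex.
    have hg : w none * g o = 0 := by
      have h1 := congrArg g.linear hs
      simp only [map_add, map_sum, map_smul, smul_eq_mul, map_zero] at h1
      have e : ∀ x, g.linear x = g x - g 0 := fun x => by rw [affineMap_eq_linear_add g x]; ring
      simp only [e, mul_sub, sum_sub_distrib] at h1
      rw [sum_eq_zero fun k _ => by rw [h0 k k.2, mul_zero], ← sum_mul] at h1
      linear_combination h1 + g 0 * hw
    have hn : w none = 0 := (mul_eq_zero.1 hg).resolve_right ho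
    rw [hn, zero_smul, zero_add] at hs
    rw [hn, zero_add] at hw
    rw [affineIndependent_iff] at hi
    have := hi univ (fun k => w (some k)) hw hs
    rintro (_ | k)
    · exact hn
    · exact this k (mem_univ _)
  have htop : affineSpan ℝ (Set.range p) = ⊤ := by
    rw [hind.affineSpan_eq_top_iff_card_eq_finrank_add_one]
    simp [hc]
  let b : AffineBasis (Option T) ℝ E4 := ⟨p, hind, htop⟩
  have hb : ∀ k, b k = p k := fun _ => rfl
  have hsum := fun x => b.sum_coord_apply_eq_one x
  have hlin := fun x => b.linear_combination_coord_eq_self x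
  simp only [Fintype.sum_option, hb] at hsum hlin
  have hnone : ∀ x, b.coord none x = g x / g o := by
    intro x
    have h1 := congrArg g (hlin x)
    have h2 := hsum x
    rw [eq_div_iff ho, ← h1, affineMap_eq_linear_add g (_ + _)]
    have e : ∀ x, g.linear x = g x - g 0 := fun x => by rw [affineMap_eq_linear_add g x]; ring
    simp only [map_add, map_sum, map_smul, smul_eq_mul, p, Option.elim]
    simp only [e, mul_sub, sum_sub_distrib]
    rw [sum_eq_zero fun k _ => by rw [h0 k k.2, mul_zero], ← sum_mul]
    linear_combination g 0 * h2
  refine ⟨fun i => if h : i ∈ T then b.coord (some ⟨i, h⟩) else 0, ?_, ?_, ?_, ?_⟩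
  · intro i hi' j hj
    simp only [hi', dite_true]
    have : y j = b (some ⟨j, hj⟩) := rfl
    rw [this, b.coord_apply]
    simp
  · intro i hi'
    simp only [hi', dite_true]
    have : o = b none := rfl
    rw [this, b.coord_apply]
    simp
  · intro x
    rw [← hnone, ← hsum x, add_comm, ← sum_coe_sort T]
    congr 1
    exact sum_congr rfl fun k _ => by simp
  · intro x
    conv_rhs => rw [← hlin x]
    rw [← hnone, add_comm, ← sum_coe_sort T]
    congr 1
    exact sum_congr rfl fun k _ => by simp [p]

/-- Evaluation of an affine map in barycentric coordinates. -/
lemma affineMap_coords {T : Finset ℕ} {y : ℕ → E4} {o x : E4} {c : ℕ → ℝ} {t : ℝ}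
    (h1 : ∑ i ∈ T, c i + t = 1) (h2 : ∑ i ∈ T, c i • y i + t • o = x) (f : E4 →ᵃ[ℝ] ℝ) :
    f x = ∑ i ∈ T, c i * f (y i) + t * f o := by
  have e : ∀ x, f.linear x = f x - f 0 := fun x => by rw [affineMap_eq_linear_add f x]; ring
  rw [← h2, affineMap_eq_linear_add f (_ + _)]
  simp only [map_add, map_sum, map_smul, smul_eq_mul]
  simp only [e, mul_sub, sum_sub_distrib]
  rw [← sum_mul]
  linear_combination (-f 0) * h1

variable {N : ℕ} {𝓕 : Finset (Finset ℕ)} {y : ℕ → E4} {T σ τ : Finset ℕ}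

lemma IsSupporting.nonneg {g : E4 →ᵃ[ℝ] ℝ} (hg : IsSupporting N y T g) {k : ℕ} (hk : k < N) :
    0 ≤ g (y k) := by
  by_cases hkT : k ∈ T
  · exact (hg.1 k hkT).ge
  · exact (hg.2 k hk hkT).le

lemma IsSupporting.eq_zero_iff {g : E4 →ᵃ[ℝ] ℝ} (hg : IsSupporting N y T g) {k : ℕ} (hk : k < N) :
    g (y k) = 0 ↔ k ∈ T :=
  ⟨fun h => by_contra fun hkT => (hg.2 k hk hkT).ne' h, hg.1 k⟩

namespace Realizes

lemma affineIndependent (hR : Realizes N 𝓕 y) (hσ : σ ∈ faces 𝓕) :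
    AffineIndependent ℝ fun k : σ => y k := by
  obtain ⟨T, hT, hs⟩ := mem_faces.1 hσ
  exact (hR.indep T hT).comp_embedding (Subtype.impEmbedding _ _ fun _ hk => hs hk)

/-- The supporting functional of a facet is unique up to positive scaling. -/
lemma supporting_unique (hR : Realizes N 𝓕 y) (hM : IsPseudoManifold N 𝓕) (hT : T ∈ 𝓕)
    {g g' : E4 →ᵃ[ℝ] ℝ} (hg : IsSupporting N y T g) (hg' : IsSupporting N y T g') :
    ∃ c : ℝ, 0 < c ∧ ∀ x, g' x = c * g x := by
  obtain ⟨u, hu, huT⟩ := hM.exists_lt_notMem hT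
  have h1 := hg.2 u hu huT
  obtain ⟨β, -, -, hs, hl⟩ := exists_coords (hR.indep T hT) (hM.card T hT) hg.1 h1.ne'
  refine ⟨g' (y u) / g (y u), div_pos (hg'.2 u hu huT) h1, fun x => ?_⟩
  rw [affineMap_coords (hs x) (hl x) g',
    sum_eq_zero fun k hk => by rw [hg'.1 k hk, mul_zero]]
  ring

/-- A choice of facet functionals. -/
lemma exists_supporting (hR : Realizes N 𝓕 y) :
    ∃ g : Finset ℕ → E4 →ᵃ[ℝ] ℝ, ∀ T ∈ 𝓕, IsSupporting N y T (g T) := by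
  classical
  choose! g hg using hR.supp
  exact ⟨g, hg⟩

variable {g : Finset ℕ → E4 →ᵃ[ℝ] ℝ}

/-- The field `mem` asks for all supporting functionals; uniqueness up to positive scaling reduces
this to one chosen functional per facet. -/
lemma hull_eq_hpoly (hR : Realizes N 𝓕 y) (hM : IsPseudoManifold N 𝓕)
    (hg : ∀ T ∈ 𝓕, IsSupporting N y T (g T)) : hull y (range N) = hpoly 𝓕 g := by
  apply Set.Subset.antisymm
  · refine convexHull_min ?_ (hface_empty (I := 𝓕) (h := g) ▸ convex_hface ∅)
    rintro _ ⟨k, hk, rfl⟩ T hT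
    exact (hg T hT).nonneg (mem_range.1 hk)
  · intro x hx
    refine hR.mem x fun T hT g' hg' => ?_
    obtain ⟨c, hc, he⟩ := hR.supporting_unique hM hT (hg T hT) hg'
    rw [he]
    exact mul_nonneg hc.le (hx T hT)

lemma mem_hpoly (hg : ∀ T ∈ 𝓕, IsSupporting N y T (g T)) {k : ℕ} (hk : k < N) : y k ∈ hpoly 𝓕 g :=
  fun T hT => (hg T hT).nonneg hk

/-- The sum of the functionals of all facets through σ is positive at every vertex outside σ,
because some facet through σ misses that vertex. A convex combination where the sum vanishes
therefore uses only vertices of σ. -/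
lemma hull_eq_hface (hR : Realizes N 𝓕 y) (hM : IsPseudoManifold N 𝓕)
    (hg : ∀ T ∈ 𝓕, IsSupporting N y T (g T)) (hσ : σ ∈ faces 𝓕) :
    hull y σ = hface 𝓕 g {T ∈ 𝓕 | σ ⊆ T} := by
  apply Set.Subset.antisymm
  · refine convexHull_min ?_ (convex_hface _)
    rintro _ ⟨k, hk, rfl⟩
    exact ⟨mem_hpoly hg (hM.lt_of_mem_faces hσ hk), fun T hT =>
      (hg T (mem_filter.1 hT).1).1 k ((mem_filter.1 hT).2 hk)⟩
  · intro x hx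
    have hxP : x ∈ hull y (range N) := by rw [hR.hull_eq_hpoly hM hg]; exact hx.1
    let f : E4 →ᵃ[ℝ] ℝ := ∑ T ∈ 𝓕 with σ ⊆ T, g T
    have hf : ∀ z, f z = ∑ T ∈ 𝓕 with σ ⊆ T, g T z := fun z => by
      simp only [f]
      exact map_sum (AddMonoidHom.mk' (fun h : E4 →ᵃ[ℝ] ℝ => h z) fun _ _ => rfl) _ _
    refine mem_convexHull_filter hxP f ?_ ?_ ?_
      (fun k hk => mem_range.2 (hM.lt_of_mem_faces hσ hk))
    · intro k hk hkσ
      rw [hf]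
      obtain ⟨T, hT, hs, hkT⟩ := hM.exists_notMem hσ hkσ
      exact sum_pos' (fun U hU => (hg U (mem_filter.1 hU).1).nonneg (mem_range.1 hk))
        ⟨T, mem_filter.2 ⟨hT, hs⟩, (hg T hT).2 k (mem_range.1 hk) hkT⟩
    · intro k hk
      rw [hf]
      exact sum_nonneg fun U hU => (hg U (mem_filter.1 hU).1).nonneg (mem_range.1 hk)
    · rw [hf, sum_eq_zero hx.2]

/-- A boundary point lies in the relative interior of a unique simplex. -/
lemma exists_carrier (hR : Realizes N 𝓕 y) (hM : IsPseudoManifold N 𝓕)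
    (hg : ∀ T ∈ 𝓕, IsSupporting N y T (g T)) {x : E4} (hx : x ∈ hpoly 𝓕 g)
    (hne : (active 𝓕 g x).Nonempty) :
    ∃ σ ∈ faces 𝓕, ∃ w : ℕ → ℝ, (∀ k ∈ σ, 0 < w k) ∧ ∑ k ∈ σ, w k = 1 ∧
      ∑ k ∈ σ, w k • y k = x ∧ active 𝓕 g x = {T ∈ 𝓕 | σ ⊆ T} := by
  classical
  obtain ⟨T, hT⟩ := hne
  obtain ⟨hT, hx0⟩ := mem_active.1 hT
  have hxP : x ∈ hull y (range N) := by rw [hR.hull_eq_hpoly hM hg]; exact hx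
  have hxT : x ∈ hull y T := mem_convexHull_filter hxP (g T)
    (fun k hk => (hg T hT).2 k (mem_range.1 hk)) (fun k hk => (hg T hT).nonneg (mem_range.1 hk))
    hx0.le fun k hk => mem_range.2 (hM.lt T hT k hk)
  obtain ⟨w, hw0, hw1, hw⟩ := (mem_convexHull_image_iff T y x).1 hxT
  have hz : ∀ k ∈ T, k ∉ {k ∈ T | w k ≠ 0} → w k = 0 := fun k hk hk' => by
    by_contra h0; exact hk' (mem_filter.2 ⟨hk, h0⟩)
  refine ⟨{k ∈ T | w k ≠ 0}, mem_faces.2 ⟨T, hT, filter_subset _ _⟩, w, fun k hk => ?_, ?_, ?_, ?_⟩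
  · obtain ⟨hk, hk0⟩ := mem_filter.1 hk
    exact lt_of_le_of_ne (hw0 k hk) (Ne.symm hk0)
  · rw [← hw1]; exact sum_subset (filter_subset _ _) hz
  · rw [← hw]; exact sum_subset (filter_subset _ _) fun k hk hk' => by rw [hz k hk hk', zero_smul]
  · ext U
    simp only [mem_active, mem_filter, and_congr_right_iff]
    intro hU
    have hgk : ∀ k ∈ T, 0 ≤ w k * g U (y k) := fun k hk =>
      mul_nonneg (hw0 k hk) ((hg U hU).nonneg (hM.lt T hT k hk))
    rw [← hw, affineMap_sum _ _ _ _ hw1, sum_eq_zero_iff_of_nonneg hgk]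
    constructor
    · intro hall k hk
      obtain ⟨hk, hk0⟩ := mem_filter.1 hk
      exact ((hg U hU).eq_zero_iff (hM.lt T hT k hk)).1
        ((mul_eq_zero.1 (hall k hk)).resolve_left hk0)
    · intro hs k hk
      by_cases h0 : w k = 0
      · rw [h0, zero_mul]
      · rw [(hg U hU).1 k (hs (mem_filter.2 ⟨hk, h0⟩)), mul_zero]

lemma exists_interior (hM : IsPseudoManifold N 𝓕)
    (hg : ∀ T ∈ 𝓕, IsSupporting N y T (g T)) : ∃ x ∈ hpoly 𝓕 g, active 𝓕 g x = ∅ := by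
  refine exists_active_eq (empty_subset _) (isExposed_hface (empty_subset _)) ?_ ?_
  · obtain ⟨T, hT⟩ := hM.nonempty
    obtain ⟨u, hu, -⟩ := hM.exists_lt_notMem hT
    exact ⟨y u, by rw [hface_empty]; exact mem_hpoly hg hu⟩
  · intro T hT _
    obtain ⟨u, hu, huT⟩ := hM.exists_lt_notMem hT
    exact ⟨y u, by rw [hface_empty]; exact mem_hpoly hg hu, ((hg T hT).2 u hu huT).ne'⟩

lemma polyDim_hull (hR : Realizes N 𝓕 y) (hM : IsPseudoManifold N 𝓕) :
    polyDim (hull y (range N)) = 4 := by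
  obtain ⟨g, hg⟩ := hR.exists_supporting
  obtain ⟨x, hx, ha⟩ := exists_interior hM hg
  have := vectorSpan_hface_active hx
  rw [ha, hface_empty] at this
  have htop : vectorSpan ℝ (hpoly 𝓕 g) = ⊤ := by rw [this]; simp
  rw [hR.hull_eq_hpoly hM hg, polyDim, htop]
  simp

lemma isFullPolytope (hR : Realizes N 𝓕 y) (hM : IsPseudoManifold N 𝓕) :
    IsFullPolytope (hull y (range N)) := by
  classical
  refine ⟨⟨(range N).image y, ?_, by rw [coe_image]⟩, hR.polyDim_hull hM⟩
  obtain ⟨T, hT⟩ := hM.nonempty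
  obtain ⟨u, hu, -⟩ := hM.exists_lt_notMem hT
  exact ⟨y u, mem_image_of_mem _ (mem_range.2 hu)⟩

/-- A nonempty exposed face is cut out by the tight set of one of its points: if that set is empty
the face is everything, otherwise it is the carrier simplex of the point. The empty exposed face
comes from the empty simplex. -/
lemma isExposed_iff (hR : Realizes N 𝓕 y) (hM : IsPseudoManifold N 𝓕) {F : Set E4} :
    IsExposed ℝ (hull y (range N)) F ↔ ∃ σ, (σ ∈ faces 𝓕 ∨ σ = range N) ∧ F = hull y σ := by
  obtain ⟨g, hg⟩ := hR.exists_supporting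
  constructor
  · intro hF
    rcases F.eq_empty_or_nonempty with rfl | hne
    · obtain ⟨T, hT⟩ := hM.nonempty
      exact ⟨∅, Or.inl (faces_mono (mem_faces_of_mem hT) (empty_subset _)), by simp [hull]⟩
    · rw [hR.hull_eq_hpoly hM hg] at hF
      obtain ⟨x, hx, rfl⟩ := exists_eq_hface_active hF hne
      rcases (active 𝓕 g x).eq_empty_or_nonempty with h0 | h0
      · exact ⟨_, Or.inr rfl, by rw [h0, hface_empty, hR.hull_eq_hpoly hM hg]⟩
      · obtain ⟨σ, hσ, -, -, -, -, ha⟩ := hR.exists_carrier hM hg hx.1 h0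
        exact ⟨σ, Or.inl hσ, by rw [ha, hR.hull_eq_hface hM hg hσ]⟩
  · rintro ⟨σ, hσ | rfl, rfl⟩
    · rw [hR.hull_eq_hface hM hg hσ, hR.hull_eq_hpoly hM hg]
      exact isExposed_hface (filter_subset _ _)
    · exact IsExposed.refl _

lemma mem_of_mem_hull (hR : Realizes N 𝓕 y) (hM : IsPseudoManifold N 𝓕) (hσ : σ ∈ faces 𝓕)
    {k : ℕ} (hk : k < N) (hm : y k ∈ hull y σ) : k ∈ σ := by
  obtain ⟨g, hg⟩ := hR.exists_supporting
  by_contra hkσ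
  obtain ⟨T, hT, hs, hkT⟩ := hM.exists_notMem hσ hkσ
  rw [hR.hull_eq_hface hM hg hσ] at hm
  exact ((hg T hT).2 k hk hkT).ne' (hm.2 T (mem_filter.2 ⟨hT, hs⟩))

lemma hull_subset_iff (hR : Realizes N 𝓕 y) (hM : IsPseudoManifold N 𝓕)
    (hσ : σ ∈ faces 𝓕 ∨ σ = range N) (hτ : τ ∈ faces 𝓕 ∨ τ = range N) :
    hull y σ ⊆ hull y τ ↔ σ ⊆ τ := by
  have hlt : ∀ k ∈ σ, k < N := by
    rcases hσ with hσ | rfl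
    · exact fun k => hM.lt_of_mem_faces hσ
    · exact fun k => mem_range.1
  constructor
  · intro hs k hk
    have hm := hs (subset_convexHull ℝ _ ⟨k, hk, rfl⟩)
    rcases hτ with hτ | rfl
    · exact hR.mem_of_mem_hull hM hτ (hlt k hk) hm
    · exact mem_range.2 (hlt k hk)
  · intro hs
    exact convexHull_mono (Set.image_mono (by exact_mod_cast hs))

/-- The face lattice of a realization depends only on the simplicial complex. -/
lemma nonempty_orderIso (hR : Realizes N 𝓕 y) (hM : IsPseudoManifold N 𝓕) :
    Nonempty ({σ : Finset ℕ // σ ∈ faces 𝓕 ∨ σ = range N} ≃o FaceLattice (hull y (range N))) := by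
  let e : {σ : Finset ℕ // σ ∈ faces 𝓕 ∨ σ = range N} ↪o FaceLattice (hull y (range N)) :=
    OrderEmbedding.ofMapLEIff
      (fun σ => ⟨hull y σ.1, (hR.isExposed_iff hM).2 ⟨σ.1, σ.2, rfl⟩⟩)
      fun σ τ => hR.hull_subset_iff hM σ.2 τ.2
  refine ⟨RelIso.ofSurjective e ?_⟩
  rintro ⟨F, hF⟩
  obtain ⟨σ, hσ, rfl⟩ := (hR.isExposed_iff hM).1 hF
  exact ⟨⟨σ, hσ⟩, rfl⟩

/-- This allows a given stacked polytope to be exchanged for a realization of the same complex that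
is chosen for its truncation. -/
lemma combEquiv {y' : ℕ → E4} (hR : Realizes N 𝓕 y) (hR' : Realizes N 𝓕 y')
    (hM : IsPseudoManifold N 𝓕) : CombEquiv (hull y (range N)) (hull y' (range N)) := by
  obtain ⟨e⟩ := hR.nonempty_orderIso hM
  obtain ⟨e'⟩ := hR'.nonempty_orderIso hM
  exact ⟨e.symm.trans e'⟩

lemma isSimplex_hull (hR : Realizes N 𝓕 y) (hσ : σ ∈ faces 𝓕) {k : ℕ} (hc : σ.card = k + 1) :
    IsSimplex k (hull y σ) := by
  let e := (σ.equivFinOfCardEq hc).symm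
  refine ⟨fun i => y (e i), (hR.affineIndependent hσ).comp_embedding e.toEmbedding, ?_⟩
  refine congrArg (convexHull ℝ) (Set.ext fun x => ?_)
  constructor
  · rintro ⟨k, hk, rfl⟩
    exact ⟨e.symm ⟨k, hk⟩, by simp⟩
  · rintro ⟨i, rfl⟩
    exact ⟨_, (e i).2, rfl⟩

end Realizes

lemma vectorSpan_convexHull_eq {E : Type*} [NormedAddCommGroup E] [NormedSpace ℝ E] (s : Set E) :
    vectorSpan ℝ (convexHull ℝ s) = vectorSpan ℝ s := by
  rw [← direction_affineSpan, affineSpan_convexHull, direction_affineSpan]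

lemma polyDim_of_isSimplex {d k : ℕ} {F : Set (EuclideanSpace ℝ (Fin d))} (h : IsSimplex k F) :
    polyDim F = k := by
  obtain ⟨v, hv, rfl⟩ := h
  rw [polyDim, vectorSpan_convexHull_eq]
  exact hv.finrank_vectorSpan (by simp)

namespace Realizes

/-- A simplex with k + 1 vertices has dimension k, and the bound on k excludes the polytope itself.
-/
lemma isFace_iff (hR : Realizes N 𝓕 y) (hM : IsPseudoManifold N 𝓕) {k : ℕ} (hk : k < 4)
    {F : Set E4} : IsFace k (hull y (range N)) F ↔ ∃ σ ∈ facesCard 𝓕 (k + 1), F = hull y σ := by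
  constructor
  · rintro ⟨hne, hF, hd⟩
    obtain ⟨σ, hσ | rfl, rfl⟩ := (hR.isExposed_iff hM).1 hF
    · refine ⟨σ, mem_facesCard.2 ⟨hσ, ?_⟩, rfl⟩
      have hpos : 0 < σ.card := by
        rw [card_pos, nonempty_iff_ne_empty]
        rintro rfl
        simp [hull] at hne
      obtain ⟨m, hm⟩ := Nat.exists_eq_succ_of_ne_zero hpos.ne'
      rw [polyDim_of_isSimplex (hR.isSimplex_hull hσ hm)] at hd
      rw [hm, hd]
    · rw [hR.polyDim_hull hM] at hd; omega
  · rintro ⟨σ, hσ, rfl⟩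
    obtain ⟨hσ, hc⟩ := mem_facesCard.1 hσ
    refine ⟨?_, (hR.isExposed_iff hM).2 ⟨σ, Or.inl hσ, rfl⟩,
      polyDim_of_isSimplex (hR.isSimplex_hull hσ hc)⟩
    obtain ⟨i, hi⟩ : σ.Nonempty := card_pos.1 (by omega)
    exact ⟨y i, subset_convexHull ℝ _ ⟨i, hi, rfl⟩⟩

lemma faceCount_eq (hR : Realizes N 𝓕 y) (hM : IsPseudoManifold N 𝓕) {k : ℕ} (hk : k < 4) :
    faceCount (hull y (range N)) k = (facesCard 𝓕 (k + 1)).card := by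
  have hset : {F | IsFace k (hull y (range N)) F} =
      hull y '' (facesCard 𝓕 (k + 1) : Set (Finset ℕ)) := by
    ext F
    rw [Set.mem_ofPred_eq, hR.isFace_iff hM hk]
    simp [eq_comm]
  rw [faceCount, hset, Set.InjOn.ncard_image, Set.ncard_coe_finset]
  intro σ hσ τ hτ he
  have hσ' := Or.inl (b := σ = range N) (mem_facesCard.1 hσ).1
  have hτ' := Or.inl (b := τ = range N) (mem_facesCard.1 hτ).1
  exact ((hR.hull_subset_iff hM hσ' hτ').1 he.le).antisymm
    ((hR.hull_subset_iff hM hτ' hσ').1 he.ge)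

lemma isFacet_iff (hR : Realizes N 𝓕 y) (hM : IsPseudoManifold N 𝓕) {F : Set E4} :
    IsFacet (hull y (range N)) F ↔ ∃ T ∈ 𝓕, F = hull y T := by
  rw [← hM.facesCard_four]
  unfold IsFacet
  rw [hR.polyDim_hull hM]
  constructor
  · rintro ⟨k, hF, hk⟩
    obtain rfl : k = 3 := by omega
    exact (hR.isFace_iff hM (by norm_num)).1 hF
  · exact fun h => ⟨3, (hR.isFace_iff hM (by norm_num)).2 h, rfl⟩

lemma exposedPoints_eq (hR : Realizes N 𝓕 y) (hM : IsPseudoManifold N 𝓕) :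
    (hull y (range N)).exposedPoints ℝ = y '' (range N : Set ℕ) := by
  ext x
  rw [mem_exposedPoints_iff_exposed_singleton]
  constructor
  · intro hx
    have hface : IsFace 0 (hull y (range N)) {x} :=
      ⟨Set.singleton_nonempty x, hx, by simp [polyDim]⟩
    obtain ⟨σ, hσ, he⟩ := (hR.isFace_iff hM (by norm_num)).1 hface
    obtain ⟨hσ, hc⟩ := mem_facesCard.1 hσ
    obtain ⟨k, rfl⟩ := card_eq_one.1 hc
    simp only [hull, coe_singleton, Set.image_singleton, convexHull_singleton,
      Set.singleton_eq_singleton_iff] at he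
    exact ⟨k, mem_coe.2 (mem_range.2 (hM.lt_of_mem_faces hσ (mem_singleton_self k))), he.symm⟩
  · rintro ⟨k, hk, rfl⟩
    obtain ⟨T, hT, hkT⟩ := hM.cover k (mem_range.1 hk)
    refine (hR.isExposed_iff hM).2
      ⟨{k}, Or.inl (mem_faces.2 ⟨T, hT, singleton_subset_iff.2 hkT⟩), by simp [hull]⟩

end Realizes

end Realization

/-! ### Geometric stacking realizes combinatorial stacking. -/

section Stacking

open Finset

variable {N : ℕ} {𝓕 : Finset (Finset ℕ)} {y : ℕ → E4} {T σ τ : Finset ℕ} {w : E4}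

lemma hull_congr {y' : ℕ → E4} (h : ∀ k ∈ σ, y k = y' k) : hull y σ = hull y' σ :=
  congrArg (convexHull ℝ) (Set.image_congr fun k hk => h k hk)

lemma hull_mono (h : σ ⊆ τ) : hull y σ ⊆ hull y τ :=
  convexHull_mono (Set.image_mono (by exact_mod_cast h))

lemma update_apply_lt {k : ℕ} (hk : k < N) : Function.update y N w k = y k :=
  Function.update_of_ne hk.ne _ _

lemma hull_update_range : hull (Function.update y N w) (range (N + 1)) =
    convexHull ℝ (insert w (hull y (range N))) := by
  have h1 : hull y (range N) = hull (Function.update y N w) (range N) :=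
    hull_congr fun k hk => (update_apply_lt (mem_range.1 hk)).symm
  apply Set.Subset.antisymm
  · refine convexHull_mono ?_
    rintro _ ⟨k, hk, rfl⟩
    rcases Nat.lt_succ_iff_lt_or_eq.1 (mem_range.1 hk) with hk | rfl
    · rw [update_apply_lt hk]
      exact Set.mem_insert_of_mem _ (subset_convexHull ℝ _ ⟨k, by simpa using hk, rfl⟩)
    · simp
  · refine convexHull_min (Set.insert_subset ?_ ?_) (convex_convexHull ℝ _)
    · exact subset_convexHull ℝ _ ⟨N, by simp, by simp⟩
    · rw [h1]
      exact hull_mono (range_subset_range.2 (Nat.le_succ N))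

lemma IsSupporting.update {g : E4 →ᵃ[ℝ] ℝ} (hg : IsSupporting N y T g) (hT : ∀ k ∈ T, k < N)
    (hw : 0 < g w) : IsSupporting (N + 1) (Function.update y N w) T g := by
  refine ⟨fun k hk => by rw [update_apply_lt (hT k hk)]; exact hg.1 k hk, fun k hk hkT => ?_⟩
  rcases Nat.lt_succ_iff_lt_or_eq.1 hk with hk | rfl
  · rw [update_apply_lt hk]; exact hg.2 k hk hkT
  · simpa using hw

namespace Realizes

/-- Stacking a realization onto a facet realizes the stacked complex. -/
lemma stack (hR : Realizes N 𝓕 y) (hM : IsPseudoManifold N 𝓕) (hT : T ∈ 𝓕)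
    (hbeyond : ∀ g, IsSupporting N y T g → g w < 0)
    (hbeneath : ∀ U ∈ 𝓕, U ≠ T → ∀ g, IsSupporting N y U g → 0 < g w) :
    Realizes (N + 1) (stackAt 𝓕 T N) (Function.update y N w) := by
  classical
  obtain ⟨g, hg⟩ := hR.exists_supporting
  have hgw : g T w < 0 := hbeyond _ (hg T hT)
  have hlt := hM.lt T hT
  have hNT : N ∉ T := fun h => lt_irrefl _ (hlt N h)
  have hupd : ∀ k ∈ T, Function.update y N w k = y k := fun k hk => update_apply_lt (hlt k hk)
  obtain ⟨β, hβ, hβw, hβ1, hβx⟩ := exists_coords (hR.indep T hT) (hM.card T hT) (hg T hT).1 hgw.ne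
  have hnew : ∀ v ∈ T, ∃ f, IsSupporting (N + 1) (Function.update y N w)
      (insert N (T.erase v)) f := by
    intro v hv
    obtain ⟨U, hU, hs, hvU⟩ := hM.exists_adjacent hT hv
    have hUw : 0 < g U w := hbeneath U hU (by rintro rfl; exact hvU hv) _ (hg U hU)
    -- The hyperplane through `w` and the ridge shared by `T` and `U` lies in the pencil of the two
    -- facet hyperplanes. The coefficients make the combination vanish at `w`, and both are positive
    -- because `w` is beyond `T` and beneath `U`.
    refine ⟨(-g T w) • g U + g U w • g T, fun k hk => ?_, fun k hk hkT => ?_⟩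
    · rcases mem_insert.1 hk with rfl | hk
      · simp; ring
      · rw [hupd k (mem_of_mem_erase hk)]
        simp [(hg T hT).1 k (mem_of_mem_erase hk), (hg U hU).1 k (hs hk)]
    · rw [mem_insert, not_or] at hkT
      have hk' : k < N := lt_of_le_of_ne (Nat.lt_succ_iff.1 hk) hkT.1
      rw [update_apply_lt hk']
      simp only [AffineMap.coe_add, AffineMap.coe_smul, Pi.add_apply, Pi.smul_apply, smul_eq_mul]
      by_cases hkv : k = v
      · subst hkv
        rw [(hg T hT).1 k hv, mul_zero, add_zero]
        exact mul_pos (neg_pos.2 hgw) ((hg U hU).2 k hk' hvU)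
      · have hkT' : k ∉ T := fun hkT' => hkT.2 (mem_erase.2 ⟨hkv, hkT'⟩)
        exact add_pos_of_nonneg_of_pos
          (mul_nonneg (neg_pos.2 hgw).le ((hg U hU).nonneg hk'))
          (mul_pos hUw ((hg T hT).2 k hk' hkT'))
  refine ⟨fun U hU => ?_, fun U hU => ?_, fun x hx => ?_⟩
  · rcases mem_stackAt.1 hU with ⟨hU, hne⟩ | ⟨v, hv, rfl⟩
    · exact ⟨g U, (hg U hU).update (hM.lt U hU) (hbeneath U hU hne _ (hg U hU))⟩
    · exact hnew v hv
  · rcases mem_stackAt.1 hU with ⟨hU, hne⟩ | ⟨v, hv, rfl⟩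
    · have : (fun k : U => Function.update y N w k) = fun k : U => y k :=
        funext fun k => update_apply_lt (hM.lt U hU k k.2)
      rw [this]
      exact hR.indep U hU
    -- Among the vertices of the new facet `g T` detects only `w`, and the coordinates `β k`, taken
    -- with apex `w`, detect the others.
    · refine affineIndependent_of_dual _ (fun k => if (k : ℕ) = N then g T else β k) ?_ ?_
      · rintro ⟨i, hi⟩ ⟨j, hj⟩ hij
        have hij : i ≠ j := fun h => hij (Subtype.ext h)
        simp only
        rcases mem_insert.1 hi with rfl | hi' <;> rcases mem_insert.1 hj with rfl | hj'
        · exact absurd rfl hij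
        · rw [if_pos rfl, hupd j (mem_of_mem_erase hj')]
          exact (hg T hT).1 j (mem_of_mem_erase hj')
        · rw [if_neg (hlt i (mem_of_mem_erase hi')).ne, Function.update_self]
          exact hβw i (mem_of_mem_erase hi')
        · rw [if_neg (hlt i (mem_of_mem_erase hi')).ne, hupd j (mem_of_mem_erase hj'),
            hβ i (mem_of_mem_erase hi') j (mem_of_mem_erase hj'), if_neg hij]
      · rintro ⟨i, hi⟩
        simp only
        rcases mem_insert.1 hi with rfl | hi
        · rw [if_pos rfl, Function.update_self]; exact hgw.ne
        · rw [if_neg (hlt i (mem_of_mem_erase hi)).ne, hupd i (mem_of_mem_erase hi),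
            hβ i (mem_of_mem_erase hi) i (mem_of_mem_erase hi), if_pos rfl]
          exact one_ne_zero
  -- On the inner side of `T` all old inequalities hold, so `x` lies in the old polytope. Beyond
  -- `T`, `x` lies in the simplex spanned by `T` and `w`: its coordinate at `w` is `g T x / g T w >
  -- 0`, and its coordinate at `v` has the sign of the functional of the new facet opposite `v`.
  · rcases le_or_gt 0 (g T x) with h0 | h0
    · have hxP : x ∈ hull y (range N) := by
        refine hR.mem x fun U hU f hf => ?_
        by_cases hUT : U = T
        · subst hUT
          obtain ⟨c, hc, he⟩ := hR.supporting_unique hM hT (hg U hT) hf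
          rw [he]; exact mul_nonneg hc.le h0
        · exact hx U (mem_stackAt.2 (Or.inl ⟨hU, hUT⟩)) f
            (hf.update (hM.lt U hU) (hbeneath U hU hUT f hf))
      rw [hull_update_range]
      exact subset_convexHull ℝ _ (Set.mem_insert_of_mem _ hxP)
    · have hβ0 : ∀ v ∈ T, 0 ≤ β v x := by
        intro v hv
        obtain ⟨f, hf⟩ := hnew v hv
        have hfx := hx _ (mem_stackAt.2 (Or.inr ⟨v, hv, rfl⟩)) f hf
        have hfw : f w = 0 := by simpa using hf.1 N (mem_insert_self _ _)
        rw [affineMap_coords (hβ1 x) (hβx x) f, hfw, mul_zero, add_zero,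
          sum_eq_single v (fun k hk hkv => ?_) (fun h => absurd hv h)] at hfx
        · have hpos := hf.2 v ((hlt v hv).trans (Nat.lt_succ_self N))
            (by simp [(hlt v hv).ne])
          rw [hupd v hv] at hpos
          exact nonneg_of_mul_nonneg_left hfx hpos
        · have := hf.1 k (mem_insert_of_mem (mem_erase.2 ⟨hkv, hk⟩))
          rw [hupd k hk] at this
          rw [this, mul_zero]
      rw [hull_update_range, ← hβx x]
      have hTN : ∀ k ∈ T, y k ∈ convexHull ℝ (insert w (hull y (range N))) := fun k hk =>
        subset_convexHull ℝ _ (Set.mem_insert_of_mem _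
          (subset_convexHull ℝ _ ⟨k, by simpa using hlt k hk, rfl⟩))
      have hwm : w ∈ convexHull ℝ (insert w (hull y (range N))) :=
        subset_convexHull ℝ _ (Set.mem_insert _ _)
      have := (convex_convexHull ℝ (insert w (hull y (range N)))).sum_mem
        (t := insert N T) (w := fun k => if k = N then g T x / g T w else β k x)
        (z := Function.update y N w) ?_ ?_ ?_
      · rw [sum_insert hNT, if_pos rfl, Function.update_self, add_comm] at this
        convert this using 2
        exact sum_congr rfl fun k hk => by rw [if_neg (hlt k hk).ne, hupd k hk]
      · intro k hk
        rcases mem_insert.1 hk with rfl | hk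
        · rw [if_pos rfl]; exact (div_pos_of_neg_of_neg h0 hgw).le
        · rw [if_neg (hlt k hk).ne]; exact hβ0 k hk
      · rw [sum_insert hNT, if_pos rfl, ← hβ1 x, add_comm]
        congr 1
        exact sum_congr rfl fun k hk => by rw [if_neg (hlt k hk).ne]
      · intro k hk
        rcases mem_insert.1 hk with rfl | hk
        · rw [Function.update_self]; exact hwm
        · rw [hupd k hk]; exact hTN k hk

/-- A linear inequality defining the facet of a realization yields a supporting functional. -/
lemma isSupporting_of_isFacet (hR : Realizes N 𝓕 y) (hM : IsPseudoManifold N 𝓕) (hT : T ∈ 𝓕)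
    {l : E4 →L[ℝ] ℝ} {c : ℝ} (hle : ∀ x ∈ hull y (range N), l x ≤ c)
    (heq : hull y T = {x ∈ hull y (range N) | l x = c}) :
    IsSupporting N y T (AffineMap.const ℝ E4 c - l.toLinearMap.toAffineMap) := by
  refine ⟨fun k hk => ?_, fun k hk hkT => ?_⟩
  · have : y k ∈ hull y T := subset_convexHull ℝ _ ⟨k, hk, rfl⟩
    rw [heq] at this
    simp [this.2]
  · have hkP : y k ∈ hull y (range N) := subset_convexHull ℝ _ ⟨k, by simpa using hk, rfl⟩
    have hne : l (y k) ≠ c := fun h => hkT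
      (hR.mem_of_mem_hull hM (mem_faces_of_mem hT) hk (by rw [heq]; exact ⟨hkP, h⟩))
    have := lt_of_le_of_ne (hle _ hkP) hne
    simpa using this

end Realizes

lemma realizes_simplex (b : AffineBasis (Fin 5) ℝ E4) :
    ∃ y, Realizes 5 ((range 5).powersetCard 4) y ∧ hull y (range 5) = convexHull ℝ (Set.range b) ∧
      ∀ k : Fin 5, y k = b k := by
  let y : ℕ → E4 := fun k => if h : k < 5 then b ⟨k, h⟩ else 0
  have hy : ∀ k (h : k < 5), y k = b ⟨k, h⟩ := fun k h => by simp [y, h]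
  have hsupp : ∀ u (hu : u < 5), IsSupporting 5 y ((range 5).erase u) (b.coord ⟨u, hu⟩) := by
    intro u hu
    refine ⟨fun k hk => ?_, fun k hk hku => ?_⟩
    · obtain ⟨hku, hk⟩ := mem_erase.1 hk
      rw [hy k (mem_range.1 hk), b.coord_apply, if_neg]
      simpa [Fin.ext_iff] using hku.symm
    · obtain rfl : k = u := by
        by_contra hne; exact hku (mem_erase.2 ⟨hne, mem_range.2 hk⟩)
      rw [hy k hk, b.coord_apply, if_pos rfl]
      exact one_pos
  have hT : ∀ T ∈ (range 5).powersetCard 4, ∃ u < 5, T = (range 5).erase u := by decide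
  have hset : y '' (range 5 : Set ℕ) = Set.range b := by
    ext x
    constructor
    · rintro ⟨k, hk, rfl⟩
      exact ⟨⟨k, mem_range.1 hk⟩, (hy k _).symm⟩
    · rintro ⟨k, rfl⟩
      exact ⟨k, by simp, hy k k.2⟩
  refine ⟨y, ⟨fun T h => ?_, fun T h => ?_, fun x hx => ?_⟩, by rw [hull, hset],
    fun k => hy k k.2⟩
  · obtain ⟨u, hu, rfl⟩ := hT T h
    exact ⟨_, hsupp u hu⟩
  · have hlt : ∀ k ∈ T, k < 5 := fun k hk => mem_range.1 ((mem_powersetCard.1 h).1 hk)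
    have := b.ind.comp_embedding (⟨fun k : T => ⟨k, hlt k k.2⟩, fun i j hij =>
      Subtype.ext (congrArg Fin.val hij)⟩ : T ↪ Fin 5)
    convert this using 2 with k
    exact hy k (hlt k k.2)
  · rw [hull, hset, b.convexHull_eq_nonneg_coord]
    intro i
    refine hx ((range 5).erase i) ?_ _ (hsupp i i.2)
    rw [mem_powersetCard]
    exact ⟨erase_subset _ _, by rw [card_erase_of_mem (by simp)]; simp⟩

/-- Every stacked polytope realizes some stacked complex. -/
lemma exists_realizes_of_isStacked {n : ℕ} {S : Set E4} (hS : IsStacked n S) :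
    ∃ 𝓕 y, StackedComplex n 𝓕 ∧ Realizes (5 + n) 𝓕 y ∧ S = hull y (range (5 + n)) := by
  induction hS with
  | simplex P hP =>
    obtain ⟨v, hv, rfl⟩ := hP
    obtain ⟨y, hR, he, -⟩ := realizes_simplex ⟨v, hv, by
      rw [hv.affineSpan_eq_top_iff_card_eq_finrank_add_one]; simp⟩
    exact ⟨_, y, .simplex, hR, he.symm⟩
  | stack n P P' _ hst ih =>
    obtain ⟨𝓕, y, hC, hR, rfl⟩ := ih
    have hM := hC.isPseudoManifold
    obtain ⟨F, w, hF, -, ⟨l, c, hle, heq, hlt⟩, hben, rfl⟩ := hst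
    obtain ⟨T, hT, rfl⟩ := (hR.isFacet_iff hM).1 hF
    refine ⟨_, Function.update y (5 + n) w, .stack n 𝓕 T hC hT, ?_, hull_update_range.symm⟩
    -- Beyond and beneath are known for one defining inequality of each facet; uniqueness of
    -- supporting functionals transfers the sign to all of them.
    refine hR.stack hM hT (fun g hg => ?_) fun U hU hne g hg => ?_
    · obtain ⟨r, hr, he⟩ := hR.supporting_unique hM hT
        (hR.isSupporting_of_isFacet hM hT hle heq) hg
      rw [he]
      refine mul_neg_of_pos_of_neg hr ?_
      simpa using hlt
    · have hUT : hull y U ≠ hull y T := fun h => hne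
        (hM.eq_of_subset hU hT ((hR.hull_subset_iff hM (Or.inl (mem_faces_of_mem hU))
          (Or.inl (mem_faces_of_mem hT))).1 h.le))
      obtain ⟨l, c, hle, heq, hlt⟩ := hben _ ((hR.isFacet_iff hM).2 ⟨U, hU, rfl⟩) hUT
      obtain ⟨r, hr, he⟩ := hR.supporting_unique hM hU
        (hR.isSupporting_of_isFacet hM hU hle heq) hg
      rw [he]
      refine mul_pos hr ?_
      simpa using hlt

end Stacking

/-! ### The truncating functionals and their continuation under stacking. -/

section Truncation

open Finset

/-- Affine functionals `a i`, negative exactly at the vertex `y i`, whose zero sets meet each edge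
`y i`, `y j` in a common point, and such that the cut-off parts at the ends of a non-edge do not
meet. -/
structure IsTruncation (N : ℕ) (𝓕 : Finset (Finset ℕ)) (y : ℕ → E4) (a : ℕ → E4 →ᵃ[ℝ] ℝ) :
    Prop where
  self : ∀ i < N, a i (y i) = -1
  pos : ∀ i < N, ∀ j < N, i ≠ j → 0 < a i (y j)
  edge : ∀ i < N, ∀ j < N, i ≠ j → {i, j} ∈ faces 𝓕 → a i (y j) * a j (y i) = 1
  nonedge : ∀ i < N, ∀ j < N, i ≠ j → {i, j} ∉ faces 𝓕 → 1 < a i (y j) * a j (y i)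

/-- The point of the segment from `y i` to `y j` at which `a i` vanishes. -/
noncomputable def edgePoint (y : ℕ → E4) (a : ℕ → E4 →ᵃ[ℝ] ℝ) (i j : ℕ) : E4 :=
  y i + (1 / (1 + a i (y j))) • (y j - y i)

variable {N : ℕ} {𝓕 : Finset (Finset ℕ)} {y : ℕ → E4} {a : ℕ → E4 →ᵃ[ℝ] ℝ} {T σ τ : Finset ℕ}
  {w : E4}

/-- The edge point is the average of `y i` and `y j` with weights `a i (y j)` and 1. -/
lemma apply_edgePoint {i j : ℕ} (h : 0 < a i (y j)) (f : E4 →ᵃ[ℝ] ℝ) :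
    f (edgePoint y a i j) = (a i (y j) * f (y i) + f (y j)) / (1 + a i (y j)) := by
  rw [edgePoint, affineMap_lineMap]
  field_simp
  ring

namespace IsTruncation

variable (hA : IsTruncation N 𝓕 y a)
include hA

lemma apply_edgePoint_nonneg {i j : ℕ} (hi : i < N) (hj : j < N) (hij : i ≠ j)
    {f : E4 →ᵃ[ℝ] ℝ} (h0 : 0 ≤ f (y i)) (h1 : 0 ≤ f (y j)) : 0 ≤ f (edgePoint y a i j) := by
  have hp := hA.pos i hi j hj hij
  rw [apply_edgePoint hp]
  positivity

lemma apply_edgePoint_pos {i j : ℕ} (hi : i < N) (hj : j < N) (hij : i ≠ j)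
    {f : E4 →ᵃ[ℝ] ℝ} (h0 : 0 ≤ f (y i)) (h1 : 0 ≤ f (y j)) (h : 0 < f (y i) ∨ 0 < f (y j)) :
    0 < f (edgePoint y a i j) := by
  have hp := hA.pos i hi j hj hij
  rw [apply_edgePoint hp]
  rcases h with h | h <;> positivity

lemma apply_edgePoint_left {i j : ℕ} (hi : i < N) (hj : j < N) (hij : i ≠ j) :
    a i (edgePoint y a i j) = 0 := by
  rw [apply_edgePoint (hA.pos i hi j hj hij), hA.self i hi]
  ring

/-- This is where the product condition on edges enters: it makes the cut at j pass through the
point determined by the cut at i. -/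
lemma apply_edgePoint_right {i j : ℕ} (hi : i < N) (hj : j < N) (hij : i ≠ j)
    (he : {i, j} ∈ faces 𝓕) : a j (edgePoint y a i j) = 0 := by
  rw [apply_edgePoint (hA.pos i hi j hj hij), hA.self j hj, hA.edge i hi j hj hij he]
  ring

lemma apply_edgePoint_of_ne {i j m : ℕ} (hi : i < N) (hj : j < N) (hij : i ≠ j) (hm : m < N)
    (hmi : m ≠ i) (hmj : m ≠ j) : 0 < a m (edgePoint y a i j) :=
  hA.apply_edgePoint_pos hi hj hij (hA.pos m hm i hi hmi).le (hA.pos m hm j hj hmj).le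
    (Or.inl (hA.pos m hm i hi hmi))

lemma apply_edgePoint_nonneg_of_edge {i j m : ℕ} (hi : i < N) (hj : j < N) (hij : i ≠ j)
    (hm : m < N) (he : {i, j} ∈ faces 𝓕) : 0 ≤ a m (edgePoint y a i j) := by
  by_cases hmi : m = i
  · rw [hmi, hA.apply_edgePoint_left hi hj hij]
  by_cases hmj : m = j
  · rw [hmj, hA.apply_edgePoint_right hi hj hij he]
  exact (hA.apply_edgePoint_of_ne hi hj hij hm hmi hmj).le

/-- Every facet contains a relatively interior point that is not cut off. -/
lemma exists_point (hM : IsPseudoManifold N 𝓕) (hT : T ∈ 𝓕) :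
    ∃ x, (∀ m < N, 0 < a m x) ∧ (∀ f : E4 →ᵃ[ℝ] ℝ, (∀ k ∈ T, f (y k) = 0) → f x = 0) ∧
      ∀ f : E4 →ᵃ[ℝ] ℝ, (∀ k ∈ T, 0 ≤ f (y k)) → (∃ k ∈ T, 0 < f (y k)) → 0 < f x := by
  obtain ⟨i, j, k, l, hij, hik, hil, hjk, hjl, hkl, rfl⟩ := card_eq_four.1 (hM.card T hT)
  have hlt := hM.lt _ hT
  have hi : i < N := hlt i (by simp)
  have hj : j < N := hlt j (by simp)
  have hk : k < N := hlt k (by simp)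
  have hl : l < N := hlt l (by simp)
  have hface : ∀ s : Finset ℕ, s ⊆ {i, j, k, l} → s ∈ faces 𝓕 := fun s hs =>
    mem_faces.2 ⟨_, hT, hs⟩
  have e1 : {i, j} ∈ faces 𝓕 := hface _ (by intro x; simp; tauto)
  have e2 : {k, l} ∈ faces 𝓕 := hface _ (by intro x; simp; tauto)
  have hmid : ∀ f : E4 →ᵃ[ℝ] ℝ, f (edgePoint y a i j +
      (1 / 2 : ℝ) • (edgePoint y a k l - edgePoint y a i j)) =
      (f (edgePoint y a i j) + f (edgePoint y a k l)) / 2 := fun f => by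
    rw [affineMap_lineMap]; ring
  -- The midpoint of the edge points of two opposite edges of the tetrahedron. At an edge point only
  -- the functionals of its two ends vanish, and the two edges share no end; moreover all four
  -- vertices enter with positive weight.
  refine ⟨edgePoint y a i j + (1 / 2 : ℝ) • (edgePoint y a k l - edgePoint y a i j),
    fun m hm => ?_, fun f hf => ?_, fun f hf hpos => ?_⟩
  · rw [hmid]
    have h1 := hA.apply_edgePoint_nonneg_of_edge hi hj hij hm e1
    have h2 := hA.apply_edgePoint_nonneg_of_edge hk hl hkl hm e2
    by_cases hm1 : m = i ∨ m = j
    · have := hA.apply_edgePoint_of_ne hk hl hkl hm (by rintro rfl; tauto) (by rintro rfl; tauto)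
      linarith
    · rw [not_or] at hm1
      have := hA.apply_edgePoint_of_ne hi hj hij hm hm1.1 hm1.2
      linarith
  · rw [hmid, apply_edgePoint (hA.pos i hi j hj hij), apply_edgePoint (hA.pos k hk l hl hkl),
      hf i (by simp), hf j (by simp), hf k (by simp), hf l (by simp)]
    simp
  · rw [hmid]
    have fi := hf i (by simp)
    have fj := hf j (by simp)
    have fk := hf k (by simp)
    have fl := hf l (by simp)
    have h1 := hA.apply_edgePoint_nonneg hi hj hij fi fj
    have h2 := hA.apply_edgePoint_nonneg hk hl hkl fk fl
    obtain ⟨m, hm, hmf⟩ := hpos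
    have : (0 < f (y i) ∨ 0 < f (y j)) ∨ (0 < f (y k) ∨ 0 < f (y l)) := by
      simp only [mem_insert, mem_singleton] at hm
      rcases hm with rfl | rfl | rfl | rfl <;> tauto
    rcases this with h | h
    · have := hA.apply_edgePoint_pos hi hj hij fi fj h
      linarith
    · have := hA.apply_edgePoint_pos hk hl hkl fk fl h
      linarith

/-- Pairs of old vertices keep their status, and the new vertex is joined exactly to those of T, so
the hypotheses supply the new cases. Positivity of b at an old vertex follows from the sign of its
product with the positive number `a j w`. -/
lemma stack (hM : IsPseudoManifold N 𝓕) (hT : T ∈ 𝓕) {b : E4 →ᵃ[ℝ] ℝ}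
    (haw : ∀ m < N, 0 < a m w) (hbw : b w = -1) (hb : ∀ v ∈ T, b (y v) * a v w = 1)
    (hb' : ∀ u < N, u ∉ T → 1 < b (y u) * a u w) :
    IsTruncation (N + 1) (stackAt 𝓕 T N) (Function.update y N w) (Function.update a N b) := by
  have hw : ∀ U ∈ 𝓕, N ∉ U := fun U hU hN => lt_irrefl _ (hM.lt U hU N hN)
  have hlt : ∀ {m}, m < N + 1 → m < N ∨ m = N := Nat.lt_succ_iff_lt_or_eq.1
  have hya : ∀ {k}, k < N → Function.update y N w k = y k := fun hk => update_apply_lt hk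
  have haa : ∀ {k}, k < N → Function.update a N b k = a k :=
    fun hk => Function.update_of_ne hk.ne _ _
  have hold : ∀ i < N, ∀ j < N, ({i, j} ∈ faces (stackAt 𝓕 T N) ↔ {i, j} ∈ faces 𝓕) := by
    intro i hi j hj
    rw [hM.mem_faces_stackAt hT hw]
    have h1 : N ∉ ({i, j} : Finset ℕ) := by
      simp only [mem_insert, mem_singleton]; omega
    have h2 : ({i, j} : Finset ℕ) ≠ T := by
      intro h
      have := hM.card T hT
      have := card_le_two (a := i) (b := j)
      rw [h] at this; omega
    tauto
  have hnew : ∀ j < N, ({N, j} ∈ faces (stackAt 𝓕 T N) ↔ j ∈ T) := by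
    intro j hj
    rw [hM.mem_faces_stackAt hT hw]
    have h1 : ({N, j} : Finset ℕ).erase N = {j} := by
      rw [erase_insert]; simpa using hj.ne'
    have h2 : ({j} : Finset ℕ) ≠ T := by
      rintro rfl
      have := hM.card _ hT
      simp at this
    rw [h1, ssubset_iff_subset_ne, singleton_subset_iff]
    simp [h2]
  have hbpos : ∀ j < N, 0 < b (y j) := by
    intro j hj
    have h1 : 0 < b (y j) * a j w := by
      by_cases hjT : j ∈ T
      · rw [hb j hjT]; exact one_pos
      · exact one_pos.trans (hb' j hj hjT)
    exact (mul_pos_iff_of_pos_right (haw j hj)).1 h1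
  refine ⟨?_, ?_, ?_, ?_⟩
  · intro i hi
    rcases hlt hi with hi | rfl
    · rw [hya hi, haa hi]; exact hA.self i hi
    · simpa using hbw
  · intro i hi j hj hij
    rcases hlt hi with hi | rfl <;> rcases hlt hj with hj | rfl
    · rw [hya hj, haa hi]; exact hA.pos i hi j hj hij
    · rw [haa hi, Function.update_self]; exact haw i hi
    · rw [hya hj, Function.update_self]; exact hbpos j hj
    · exact absurd rfl hij
  · intro i hi j hj hij he
    rcases hlt hi with hi | rfl <;> rcases hlt hj with hj | rfl
    · rw [hya hj, haa hi, hya hi, haa hj]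
      exact hA.edge i hi j hj hij ((hold i hi j hj).1 he)
    · rw [pair_comm, hnew i hi] at he
      rw [haa hi, hya hi, Function.update_self, Function.update_self, mul_comm]
      exact hb i he
    · rw [hnew j hj] at he
      rw [haa hj, hya hj, Function.update_self, Function.update_self]
      exact hb j he
    · exact absurd rfl hij
  · intro i hi j hj hij he
    rcases hlt hi with hi | rfl <;> rcases hlt hj with hj | rfl
    · rw [hya hj, haa hi, hya hi, haa hj]
      exact hA.nonedge i hi j hj hij (fun h => he ((hold i hi j hj).2 h))
    · rw [pair_comm, hnew i hi] at he
      rw [haa hi, hya hi, Function.update_self, Function.update_self, mul_comm]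
      exact hb' i hi he
    · rw [hnew j hj] at he
      rw [haa hj, hya hj, Function.update_self, Function.update_self]
      exact hb' j hj he
    · exact absurd rfl hij

/-- A point beyond a facet, close to a suitable point of the facet, at which the truncation can be
continued. -/
lemma exists_apex (hR : Realizes N 𝓕 y) (hM : IsPseudoManifold N 𝓕) (hT : T ∈ 𝓕)
    {g : Finset ℕ → E4 →ᵃ[ℝ] ℝ} (hg : ∀ U ∈ 𝓕, IsSupporting N y U (g U)) :
    ∃ (w : E4) (b : E4 →ᵃ[ℝ] ℝ), g T w < 0 ∧ (∀ U ∈ 𝓕, U ≠ T → 0 < g U w) ∧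
      (∀ m < N, 0 < a m w) ∧ b w = -1 ∧ (∀ v ∈ T, b (y v) * a v w = 1) ∧
      ∀ u < N, u ∉ T → 1 < b (y u) * a u w := by
  obtain ⟨x, hxa, hx0, hxp⟩ := hA.exists_point hM hT
  obtain ⟨o, ho, hoT⟩ := hM.exists_lt_notMem hT
  have hgo : 0 < g T (y o) := (hg T hT).2 o ho hoT
  have hlt := hM.lt T hT
  obtain ⟨β, hβ, -, -, -⟩ := exists_coords (hR.indep T hT) (hM.card T hT) (hg T hT).1 hgo.ne'
  have hβx : ∀ v ∈ T, 0 < β v x := by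
    intro v hv
    refine hxp _ (fun k hk => ?_) ⟨v, hv, ?_⟩
    · rw [hβ v hv k hk]; split_ifs <;> norm_num
    · rw [hβ v hv v hv, if_pos rfl]; exact one_pos
  -- The ray through `x` pointing away from an inner vertex `y o`. It leaves the polytope at `ε =
  -- 0`, with `g T (p ε) = -ε * g T (y o)`.
  let p : ℝ → E4 := fun ε => x + (-ε) • (y o - x)
  have hp : ∀ (f : E4 →ᵃ[ℝ] ℝ) ε, f (p ε) = f x + (-ε) * (f (y o) - f x) := fun f ε =>
    affineMap_lineMap f _ _ _
  have hcont : ∀ f : E4 →ᵃ[ℝ] ℝ, ContinuousAt (fun ε => f (p ε)) 0 := by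
    intro f
    simp only [hp]
    fun_prop
  have hp0 : ∀ f : E4 →ᵃ[ℝ] ℝ, f (p 0) = f x := fun f => by simp [hp]
  have hpos : ∀ f : E4 →ᵃ[ℝ] ℝ, 0 < f x → ∀ᶠ ε in nhds (0 : ℝ), 0 < f (p ε) := fun f hf =>
    (hcont f).eventually_const_lt (by simpa only [hp0] using hf)
  let B : ℝ → ℝ := fun ε => ∑ v ∈ T, β v (p ε) / a v (p ε)
  -- For `ε > 0` this equals `ε * (b (y u) * a u (p ε) - 1)` with the functional `b` chosen below.
  -- Multiplying by `ε` removes the pole of `b` at 0, so positivity can be tested at `ε = 0` and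
  -- extended by continuity.
  let Φ : ℕ → ℝ → ℝ := fun u ε => (ε * ∑ v ∈ T, β v (y u) / a v (p ε) +
    (1 + B ε) * (g T (y u) / g T (y o))) * a u (p ε) - ε
  have hne : ∀ v ∈ T, a v (p 0) ≠ 0 := fun v hv => by rw [hp0]; exact (hxa v (hlt v hv)).ne'
  have hB : ContinuousAt B 0 :=
    tendsto_finsetSum _ fun v hv => (hcont _).div (hcont _) (hne v hv)
  have hΦ : ∀ u < N, u ∉ T → ∀ᶠ ε in nhds (0 : ℝ), 0 < Φ u ε := by
    intro u hu huT
    have hc : ContinuousAt (Φ u) 0 := by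
      have h1 : ContinuousAt (fun ε => ∑ v ∈ T, β v (y u) / a v (p ε)) 0 :=
        tendsto_finsetSum _ fun v hv => continuousAt_const.div (hcont _) (hne v hv)
      exact (((continuousAt_id.mul h1).add ((continuousAt_const.add hB).mul
        continuousAt_const)).mul (hcont _)).sub continuousAt_id
    refine hc.eventually_const_lt ?_
    have hB0 : 0 ≤ B 0 := sum_nonneg fun v hv => by
      rw [hp0, hp0]; exact div_nonneg (hβx v hv).le (hxa v (hlt v hv)).le
    have h1 := (hg T hT).2 u hu huT
    have h2 := hxa u hu
    simp only [Φ, zero_mul, zero_add, sub_zero, hp0]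
    positivity
  have hev : ∀ᶠ ε in nhdsWithin (0 : ℝ) (Set.Ioi 0), 0 < ε ∧
      (∀ U ∈ 𝓕.erase T, 0 < g U (p ε)) ∧ (∀ m ∈ range N, 0 < a m (p ε)) ∧
      ∀ u ∈ range N \ T, 0 < Φ u ε := by
    refine Filter.Eventually.and self_mem_nhdsWithin
      (Filter.Eventually.filter_mono nhdsWithin_le_nhds ?_)
    refine .and ?_ (.and ?_ ?_)
    · rw [Filter.eventually_all_finset]
      intro U hU
      obtain ⟨hne, hU⟩ := mem_erase.1 hU
      obtain ⟨k, hk, hkU⟩ := hM.exists_mem_notMem hT hU hne.symm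
      exact hpos _ (hxp _ (fun k hk => (hg U hU).nonneg (hlt k hk))
        ⟨k, hk, (hg U hU).2 k (hlt k hk) hkU⟩)
    · rw [Filter.eventually_all_finset]
      exact fun m hm => hpos _ (hxa m (mem_range.1 hm))
    · rw [Filter.eventually_all_finset]
      intro u hu
      obtain ⟨hu, huT⟩ := mem_sdiff.1 hu
      exact hΦ u (mem_range.1 hu) huT
  obtain ⟨ε, hε, h1, h2, h3⟩ := hev.exists
  have hgT : g T (p ε) = -(ε * g T (y o)) := by
    rw [hp, hx0 _ (hg T hT).1]; ring
  have hgT' : g T (p ε) < 0 := by rw [hgT]; exact neg_neg_of_pos (mul_pos hε hgo)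
  -- The first sum takes the value `1 / a v (p ε)` at each vertex `v` of `T` and the value `B ε` at
  -- `p ε`. The multiple of `g T` leaves `T` alone and lowers the value at `p ε` to -1.
  let b : E4 →ᵃ[ℝ] ℝ :=
    ∑ v ∈ T, (1 / a v (p ε)) • β v + (-(1 + B ε) / g T (p ε)) • g T
  have hb : ∀ z, b z = ∑ v ∈ T, β v z / a v (p ε) + (-(1 + B ε) / g T (p ε)) * g T z := by
    intro z
    have : (∑ v ∈ T, (1 / a v (p ε)) • β v) z = ∑ v ∈ T, β v z / a v (p ε) := by
      rw [show (∑ v ∈ T, (1 / a v (p ε)) • β v) z = ∑ v ∈ T, ((1 / a v (p ε)) • β v) z from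
        map_sum (AddMonoidHom.mk' (fun h : E4 →ᵃ[ℝ] ℝ => h z) fun _ _ => rfl) _ _]
      refine sum_congr rfl fun v _ => ?_
      simp only [AffineMap.coe_smul, Pi.smul_apply, smul_eq_mul]
      ring
    simp only [b, AffineMap.coe_add, AffineMap.coe_smul, Pi.add_apply, Pi.smul_apply, smul_eq_mul,
      this]
  refine ⟨p ε, b, hgT', fun U hU hne => h1 U (mem_erase.2 ⟨hne, hU⟩),
    fun m hm => h2 m (mem_range.2 hm), ?_, fun v hv => ?_, fun u hu huT => ?_⟩
  · rw [hb, div_mul_cancel₀ _ hgT'.ne]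
    simp only [B]; ring
  · have hav := h2 v (mem_range.2 (hlt v hv))
    rw [hb, (hg T hT).1 v hv, mul_zero, add_zero, sum_eq_single v, hβ v hv v hv, if_pos rfl]
    · field_simp
    · intro k hk hkv
      rw [hβ k hk v hv, if_neg hkv, zero_div]
    · exact fun h => absurd hv h
  · have h4 := h3 u (mem_sdiff.2 ⟨mem_range.2 hu, huT⟩)
    have h5 : Φ u ε = ε * (b (y u) * a u (p ε) - 1) := by
      rw [hb, hgT]
      simp only [Φ]
      have := hε.ne'
      field_simp
    rw [h5] at h4
    have := (mul_pos_iff_of_pos_left hε).1 h4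
    linarith

end IsTruncation

/-- Every stacked complex has a realization with a deep vertex truncation. -/
lemma exists_truncation {n : ℕ} (hC : StackedComplex n 𝓕) :
    ∃ y a, Realizes (5 + n) 𝓕 y ∧ IsTruncation (5 + n) 𝓕 y a := by
  induction hC with
  | simplex =>
    obtain ⟨b⟩ : Nonempty (AffineBasis (Fin 5) ℝ E4) :=
      AffineBasis.exists_affineBasis_of_finiteDimensional (by simp)
    obtain ⟨y, hR, -, hy⟩ := realizes_simplex b
    have hy' : ∀ k (h : k < 5), y k = b ⟨k, h⟩ := fun k h => hy ⟨k, h⟩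
    -- For the simplex the cuts go through the edge midpoints: the functional is -1 at its own
    -- vertex and 1 at the others. Every pair of vertices is an edge.
    let a : ℕ → E4 →ᵃ[ℝ] ℝ := fun k =>
      if h : k < 5 then AffineMap.const ℝ E4 1 - (2 : ℝ) • b.coord ⟨k, h⟩ else 0
    have ha : ∀ i < 5, ∀ j < 5, a i (y j) = if i = j then -1 else 1 := by
      intro i hi j hj
      simp only [a, hi, dite_true, hy' j hj, AffineMap.coe_sub, AffineMap.coe_smul, Pi.sub_apply,
        Pi.smul_apply, AffineMap.const_apply, b.coord_apply, Fin.mk.injEq]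
      split_ifs <;> norm_num
    refine ⟨y, a, hR, ⟨?_, ?_, ?_, ?_⟩⟩
    · intro i hi; rw [ha i hi i hi, if_pos rfl]
    · intro i hi j hj hij; rw [ha i hi j hj, if_neg hij]; exact one_pos
    · intro i hi j hj hij _
      rw [ha i hi j hj, ha j hj i hi, if_neg hij, if_neg hij.symm, one_mul]
    · intro i hi j hj hij he
      exfalso
      apply he
      have : ({i, j} : Finset ℕ) ∈ facesCard ((range 5).powersetCard 4) 2 := by
        rw [facesCard_simplex (by norm_num), mem_powersetCard]
        exact ⟨by intro x; simp only [mem_insert, mem_singleton, mem_range]; omega,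
          card_pair hij⟩
      exact (mem_facesCard.1 this).1
  | stack n 𝓕 T hC hT ih =>
    obtain ⟨y, a, hR, hA⟩ := ih
    have hM := hC.isPseudoManifold
    obtain ⟨g, hg⟩ := hR.exists_supporting
    obtain ⟨w, b, h1, h2, h3, h4, h5, h6⟩ := hA.exists_apex hR hM hT hg
    refine ⟨Function.update y (5 + n) w, Function.update a (5 + n) b,
      hR.stack hM hT (fun f hf => ?_) fun U hU hne f hf => ?_, hA.stack hM hT h3 h4 h5 h6⟩
    · obtain ⟨r, hr, he⟩ := hR.supporting_unique hM hT (hg T hT) hf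
      rw [he]; exact mul_neg_of_pos_of_neg hr h1
    · obtain ⟨r, hr, he⟩ := hR.supporting_unique hM hU (hg U hU) hf
      rw [he]; exact mul_pos hr (h2 U hU hne)

end Truncation

/-! ### Counting the faces of a polyhedron from a list of tight sets by dimension. -/

section LabelledFaces

open Finset

variable {ι : Type*} {d : ℕ} {I : Finset ι} {h : ι → EuclideanSpace ℝ (Fin d) →ᵃ[ℝ] ℝ}

/-- If the sets of tight inequalities are listed by dimension, so are the faces. -/
lemma isFace_hpoly_iff {L : ℕ → Finset (Finset ι)}
    (hL : ∀ k, ∀ A ∈ L k, ∃ x ∈ hpoly I h, active I h x = A)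
    (hdim : ∀ k, ∀ A ∈ L k, polyDim (hface I h A) = k)
    (hcover : ∀ x ∈ hpoly I h, ∃ k, active I h x ∈ L k) {k : ℕ}
    {F : Set (EuclideanSpace ℝ (Fin d))} :
    IsFace k (hpoly I h) F ↔ ∃ A ∈ L k, F = hface I h A := by
  constructor
  · rintro ⟨hne, hF, hd⟩
    obtain ⟨x, hx, rfl⟩ := exists_eq_hface_active hF hne
    obtain ⟨m, hm⟩ := hcover x hx.1
    rw [hdim m _ hm] at hd
    exact ⟨_, hd ▸ hm, rfl⟩
  · rintro ⟨A, hA, rfl⟩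
    obtain ⟨x, hx, rfl⟩ := hL k A hA
    exact ⟨⟨x, mem_hface_active hx⟩, isExposed_hface (active_subset x), hdim k _ hA⟩

lemma hface_injOn {L : Finset (Finset ι)}
    (hL : ∀ A ∈ L, ∃ x ∈ hpoly I h, active I h x = A) :
    Set.InjOn (hface I h) (L : Set (Finset ι)) := by
  intro A hA B hB he
  obtain ⟨x, hx, rfl⟩ := hL A hA
  obtain ⟨z, hz, rfl⟩ := hL B hB
  exact hface_active_inj hx hz he

lemma faceCount_hpoly {L : ℕ → Finset (Finset ι)}
    (hL : ∀ k, ∀ A ∈ L k, ∃ x ∈ hpoly I h, active I h x = A)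
    (hdim : ∀ k, ∀ A ∈ L k, polyDim (hface I h A) = k)
    (hcover : ∀ x ∈ hpoly I h, ∃ k, active I h x ∈ L k) (k : ℕ) :
    faceCount (hpoly I h) k = (L k).card := by
  have hset : {F | IsFace k (hpoly I h) F} = hface I h '' (L k : Set (Finset ι)) := by
    ext F
    rw [Set.mem_ofPred_eq, isFace_hpoly_iff hL hdim hcover]
    simp [eq_comm]
  rw [faceCount, hset, Set.InjOn.ncard_image (hface_injOn (hL k)), Set.ncard_coe_finset]

lemma finite_faceLattice_hpoly : Finite (FaceLattice (hpoly I h)) := by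
  classical
  have hfin : {F | IsExposed ℝ (hpoly I h) F}.Finite := by
    refine ((I.powerset.image (hface I h)).finite_toSet.insert ∅).subset ?_
    intro F hF
    rcases F.eq_empty_or_nonempty with rfl | hne
    · exact Set.mem_insert _ _
    · obtain ⟨x, -, rfl⟩ := exists_eq_hface_active hF hne
      exact Set.mem_insert_of_mem _
        (mem_image_of_mem _ (mem_powerset.2 (active_subset x)))
  exact hfin.to_subtype

/-- A face of a polyhedron that is the hull of a finite set is the hull of a subset. -/
lemma hface_eq_convexHull {s : Set (EuclideanSpace ℝ (Fin d))} (hs : s.Finite)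
    (hQ : hpoly I h = convexHull ℝ s) {A : Finset ι} (hA : A ⊆ I) :
    hface I h A = convexHull ℝ {x | x ∈ s ∧ x ∈ hface I h A} := by
  classical
  apply Set.Subset.antisymm
  · intro x hx
    let f : EuclideanSpace ℝ (Fin d) →ᵃ[ℝ] ℝ := ∑ i ∈ A, h i
    have hf : ∀ z, f z = ∑ i ∈ A, h i z := fun z =>
      map_sum (AddMonoidHom.mk' (fun h : EuclideanSpace ℝ (Fin d) →ᵃ[ℝ] ℝ => h z)
        fun _ _ => rfl) _ _
    have hsub : ∀ z ∈ hs.toFinset, z ∈ hpoly I h := fun z hz => by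
      rw [hQ]; exact subset_convexHull ℝ _ (hs.mem_toFinset.1 hz)
    have hnn : ∀ z ∈ hs.toFinset, 0 ≤ f z := fun z hz => by
      rw [hf]; exact sum_nonneg fun i hi => hsub z hz i (hA hi)
    have := mem_convexHull_filter (s := hs.toFinset) (t := {z ∈ hs.toFinset | z ∈ hface I h A})
      (y := id) (x := x) (by rw [Set.image_id, hs.coe_toFinset, ← hQ]; exact hx.1) f ?_ hnn
      (by rw [hf, sum_eq_zero hx.2]) (filter_subset _ _)
    · simpa using this
    · intro z hz hzA
      refine lt_of_le_of_ne (hnn z hz) fun h0 => hzA (mem_filter.2 ⟨hz, hsub z hz, ?_⟩)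
      rw [id, hf] at h0
      exact (sum_eq_zero_iff_of_nonneg fun i hi => hsub z hz i (hA hi)).1 h0.symm
  · exact convexHull_min (fun x hx => hx.2) (convex_hface A)

/-- The direction of the face is the kernel of one linear form. That form is nonzero because its
functional vanishes at x but not everywhere. -/
lemma polyDim_hface_singleton {x : EuclideanSpace ℝ (Fin d)} (hx : x ∈ hpoly I h) {i : ι}
    (ha : active I h x = {i}) (hne : ∃ z, h i z ≠ 0) : polyDim (hface I h {i}) + 1 = d := by
  have hv := vectorSpan_hface_active hx
  rw [ha] at hv
  simp only [mem_singleton, iInf_iInf_eq_left] at hv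
  have h0 : (h i).linear ≠ 0 := by
    rintro h0
    obtain ⟨z, hz⟩ := hne
    have := (h i).linearMap_vsub z x
    have hx0 : h i x = 0 := (mem_active.1 (ha ▸ mem_singleton_self i : i ∈ active I h x)).2
    rw [h0, hx0] at this
    exact hz (by simpa using this.symm)
  rw [polyDim, hv, Module.Dual.finrank_ker_add_one_of_ne_zero h0]
  simp

lemma polyDim_hpoly {x : EuclideanSpace ℝ (Fin d)} (hx : x ∈ hpoly I h)
    (ha : active I h x = ∅) : polyDim (hpoly I h) = d := by
  have hv := vectorSpan_hface_active hx
  rw [ha, hface_empty] at hv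
  have htop : vectorSpan ℝ (hpoly I h) = ⊤ := by rw [hv]; simp
  rw [polyDim, htop]
  simp

end LabelledFaces

/-! ### The truncated polytope and the possible tight sets of its points. -/

section TruncatedPolytope

open Finset

variable {N : ℕ} {𝓕 : Finset (Finset ℕ)} {y : ℕ → E4} {a : ℕ → E4 →ᵃ[ℝ] ℝ}
  {g : Finset ℕ → E4 →ᵃ[ℝ] ℝ} {T σ τ : Finset ℕ} {x : E4}

/-- The facets containing a face. -/
def cofaces (𝓕 : Finset (Finset ℕ)) (τ : Finset ℕ) : Finset (Finset ℕ) := {T ∈ 𝓕 | τ ⊆ T}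

lemma mem_cofaces : T ∈ cofaces 𝓕 τ ↔ T ∈ 𝓕 ∧ τ ⊆ T := by simp [cofaces]

/-- The truncated polytope, described by inequalities. -/
abbrev truncated (N : ℕ) (𝓕 : Finset (Finset ℕ)) (a : ℕ → E4 →ᵃ[ℝ] ℝ)
    (g : Finset ℕ → E4 →ᵃ[ℝ] ℝ) : Set E4 :=
  hpoly ((range N).disjSum 𝓕) (Sum.elim a g)

/-- The face of the truncated polytope in the truncating hyperplanes with label in `V` and the
facet hyperplanes with label in `𝒯`. -/
abbrev truncFace (N : ℕ) (𝓕 : Finset (Finset ℕ)) (a : ℕ → E4 →ᵃ[ℝ] ℝ)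
    (g : Finset ℕ → E4 →ᵃ[ℝ] ℝ) (A : Finset (ℕ ⊕ Finset ℕ)) : Set E4 :=
  hface ((range N).disjSum 𝓕) (Sum.elim a g) A

/-- The tight inequalities at a point of the truncated polytope. -/
noncomputable abbrev truncActive (N : ℕ) (𝓕 : Finset (Finset ℕ)) (a : ℕ → E4 →ᵃ[ℝ] ℝ)
    (g : Finset ℕ → E4 →ᵃ[ℝ] ℝ) (x : E4) : Finset (ℕ ⊕ Finset ℕ) :=
  active ((range N).disjSum 𝓕) (Sum.elim a g) x

lemma mem_truncated_iff :
    x ∈ truncated N 𝓕 a g ↔ (∀ i < N, 0 ≤ a i x) ∧ x ∈ hpoly 𝓕 g := by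
  constructor
  · intro hx
    exact ⟨fun i hi => hx (.inl i) (inl_mem_disjSum.2 (mem_range.2 hi)),
      fun T hT => hx (.inr T) (inr_mem_disjSum.2 hT)⟩
  · rintro ⟨h1, h2⟩ (i | T) hi
    · exact h1 i (mem_range.1 (inl_mem_disjSum.1 hi))
    · exact h2 T (inr_mem_disjSum.1 hi)

lemma inl_mem_truncActive {i : ℕ} : .inl i ∈ truncActive N 𝓕 a g x ↔ i < N ∧ a i x = 0 := by
  simp [mem_active]

lemma inr_mem_truncActive : .inr T ∈ truncActive N 𝓕 a g x ↔ T ∈ active 𝓕 g x := by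
  simp [mem_active]

lemma truncActive_eq {V : Finset ℕ} {𝒯 : Finset (Finset ℕ)}
    (hV : ∀ i, i < N ∧ a i x = 0 ↔ i ∈ V) (h𝒯 : active 𝓕 g x = 𝒯) :
    truncActive N 𝓕 a g x = V.disjSum 𝒯 := by
  ext (i | T)
  · rw [inl_mem_truncActive, inl_mem_disjSum, hV]
  · rw [inr_mem_truncActive, inr_mem_disjSum, h𝒯]

namespace IsTruncation

variable (hA : IsTruncation N 𝓕 y a)
include hA

lemma edgePoint_comm {i j : ℕ} (hi : i < N) (hj : j < N) (hij : i ≠ j)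
    (he : {i, j} ∈ faces 𝓕) : edgePoint y a i j = edgePoint y a j i := by
  have h1 := hA.pos i hi j hj hij
  have h2 := hA.pos j hj i hi hij.symm
  have h3 := hA.edge i hi j hj hij he
  have h4 : 1 / (1 + a j (y i)) = 1 - 1 / (1 + a i (y j)) := by
    field_simp
    linarith
  rw [edgePoint, edgePoint, h4]
  module

/-- The cut-off parts at different vertices meet at most in the common edge point. -/
lemma eq_edgePoint (hx : x ∈ hull y (range N)) {i j : ℕ} (hi : i < N) (hj : j < N) (hij : i ≠ j)
    (hxi : a i x ≤ 0) (hxj : a j x ≤ 0) : {i, j} ∈ faces 𝓕 ∧ x = edgePoint y a i j := by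
  obtain ⟨w, hw0, hw1, rfl⟩ := (mem_convexHull_image_iff _ _ _).1 hx
  have hjm : j ∈ (range N).erase i := mem_erase.2 ⟨hij.symm, mem_range.2 hj⟩
  have split : ∀ (M : Type) [AddCommMonoid M] (F : ℕ → M),
      ∑ k ∈ range N, F k = F i + (F j + ∑ k ∈ ((range N).erase i).erase j, F k) := by
    intro M _ F
    rw [add_sum_erase _ _ hjm, add_sum_erase _ _ (mem_range.2 hi)]
  have hR : ∀ k ∈ ((range N).erase i).erase j, k < N ∧ k ≠ i ∧ k ≠ j := by
    intro k hk
    simp only [mem_erase, mem_range] at hk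
    tauto
  rw [affineMap_sum _ _ _ _ hw1, split, hA.self i hi] at hxi
  rw [affineMap_sum _ _ _ _ hw1, split, hA.self j hj] at hxj
  have hnn : ∀ m < N, m = i ∨ m = j → ∀ k ∈ ((range N).erase i).erase j, 0 ≤ w k * a m (y k) := by
    intro m hm hmij k hk
    obtain ⟨hk, hki, hkj⟩ := hR k hk
    refine mul_nonneg (hw0 k (mem_range.2 hk)) (hA.pos m hm k hk ?_).le
    rcases hmij with rfl | rfl
    · exact hki.symm
    · exact hkj.symm
  have ri := sum_nonneg (hnn i hi (Or.inl rfl))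
  have rj := sum_nonneg (hnn j hj (Or.inr rfl))
  have pij := hA.pos i hi j hj hij
  have pji := hA.pos j hj i hi hij.symm
  have wi := hw0 i (mem_range.2 hi)
  have wj := hw0 j (mem_range.2 hj)
  set Ri := ∑ k ∈ ((range N).erase i).erase j, w k * a i (y k) with hRi
  set Rj := ∑ k ∈ ((range N).erase i).erase j, w k * a j (y k)
  have hprod : 1 ≤ a i (y j) * a j (y i) := by
    by_cases he : {i, j} ∈ faces 𝓕
    · exact (hA.edge i hi j hj hij he).ge
    · exact (hA.nonedge i hi j hj hij he).le
  -- Adding `a i (y j)` times the inequality at `j` to the one at `i` eliminates `w j`. All three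
  -- remaining terms are nonnegative, so each vanishes. Then only `i` and `j` carry weight, and at a
  -- non-edge not even these.
  have key : (a i (y j) * a j (y i) - 1) * w i + a i (y j) * Rj + Ri ≤ 0 := by
    nlinarith [mul_le_mul_of_nonneg_left hxj pij.le]
  have k1 : 0 ≤ (a i (y j) * a j (y i) - 1) * w i := mul_nonneg (by linarith) wi
  have k2 : 0 ≤ a i (y j) * Rj := mul_nonneg pij.le rj
  have hRi0 : Ri = 0 := by linarith
  have hRj0 : Rj = 0 := by
    have : a i (y j) * Rj = 0 := by linarith
    exact (mul_eq_zero.1 this).resolve_left pij.ne'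
  have hz : ∀ k ∈ ((range N).erase i).erase j, w k = 0 := by
    intro k hk
    have := (sum_eq_zero_iff_of_nonneg (hnn i hi (Or.inl rfl))).1 (hRi ▸ hRi0) k hk
    obtain ⟨hk', hki, hkj⟩ := hR k hk
    exact (mul_eq_zero.1 this).resolve_right (hA.pos i hi k hk' hki.symm).ne'
  rw [split, sum_eq_zero hz, add_zero] at hw1
  have hwi : w i = a i (y j) * w j := by
    nlinarith [mul_le_mul_of_nonneg_left hxj pij.le]
  have hwj : w j = 1 / (1 + a i (y j)) := by
    rw [eq_div_iff (by positivity)]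
    rw [hwi] at hw1
    linarith
  refine ⟨?_, ?_⟩
  · by_contra he
    have h1 := hA.nonedge i hi j hj hij he
    have h2 : (a i (y j) * a j (y i) - 1) * w i = 0 := by linarith
    have h3 : w i = 0 := (mul_eq_zero.1 h2).resolve_left (by linarith)
    have h4 : w j = 0 := by
      rw [h3] at hwi
      exact (mul_eq_zero.1 hwi.symm).resolve_left pij.ne'
    linarith
  · rw [split, sum_eq_zero (fun k hk => by rw [hz k hk, zero_smul]), add_zero, edgePoint, ← hwj,
      show w i = 1 - w j by linarith]
    module

/-- On an edge, only the edge point is not cut off. -/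
lemma eq_edgePoint_of_mem_edge {i j : ℕ} (hi : i < N) (hj : j < N) (hij : i ≠ j)
    (he : {i, j} ∈ faces 𝓕) (hx : x ∈ hull y {i, j}) (hxi : 0 ≤ a i x) (hxj : 0 ≤ a j x) :
    x = edgePoint y a i j := by
  have hsub : ({i, j} : Finset ℕ) ⊆ range N := by
    intro k
    simp only [mem_insert, mem_singleton, mem_range]
    rintro (rfl | rfl) <;> assumption
  have hxN := hull_mono hsub hx
  obtain ⟨w, hw0, hw1, rfl⟩ := (mem_convexHull_image_iff _ _ _).1 hx
  have e := hA.edge i hi j hj hij he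
  have pij := hA.pos i hi j hj hij
  have ei : a i (∑ k ∈ {i, j}, w k • y k) = - w i + w j * a i (y j) := by
    rw [affineMap_sum _ _ _ _ hw1, sum_pair hij, hA.self i hi]; ring
  have ej : a j (∑ k ∈ {i, j}, w k • y k) = w i * a j (y i) - w j := by
    rw [affineMap_sum _ _ _ _ hw1, sum_pair hij, hA.self j hj]; ring
  -- Along the edge the two functionals are negative multiples of each other, so they are both
  -- nonnegative only at their common zero.
  have hs : a i (y j) * a j (∑ k ∈ {i, j}, w k • y k) + a i (∑ k ∈ {i, j}, w k • y k) = 0 := by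
    rw [ei, ej]; linear_combination (w i) * e
  have h1 := mul_nonneg pij.le hxj
  refine (hA.eq_edgePoint hxN hi hj hij (by linarith) ?_).2
  have : a i (y j) * a j (∑ k ∈ {i, j}, w k • y k) = 0 := by linarith
  exact ((mul_eq_zero.1 this).resolve_left pij.ne').le

lemma edgePoint_mem_hpoly (hg : ∀ T ∈ 𝓕, IsSupporting N y T (g T)) {i j : ℕ} (hi : i < N)
    (hj : j < N) (hij : i ≠ j) : edgePoint y a i j ∈ hpoly 𝓕 g := fun T hT =>
  hA.apply_edgePoint_nonneg hi hj hij ((hg T hT).nonneg hi) ((hg T hT).nonneg hj)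

lemma edgePoint_mem_truncated (hg : ∀ T ∈ 𝓕, IsSupporting N y T (g T)) {i j : ℕ} (hi : i < N)
    (hj : j < N) (hij : i ≠ j) (he : {i, j} ∈ faces 𝓕) :
    edgePoint y a i j ∈ truncated N 𝓕 a g :=
  mem_truncated_iff.2 ⟨fun _ hm => hA.apply_edgePoint_nonneg_of_edge hi hj hij hm he,
    hA.edgePoint_mem_hpoly hg hi hj hij⟩

lemma apply_edgePoint_eq_zero_iff {i j m : ℕ} (hi : i < N) (hj : j < N) (hij : i ≠ j)
    (hm : m < N) (he : {i, j} ∈ faces 𝓕) :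
    a m (edgePoint y a i j) = 0 ↔ m ∈ ({i, j} : Finset ℕ) := by
  rw [mem_insert, mem_singleton]
  constructor
  · intro h
    by_contra hne
    rw [not_or] at hne
    exact (hA.apply_edgePoint_of_ne hi hj hij hm hne.1 hne.2).ne' h
  · rintro (rfl | rfl)
    · exact hA.apply_edgePoint_left hi hj hij
    · exact hA.apply_edgePoint_right hi hj hij he

lemma supporting_edgePoint_eq_zero_iff {f : E4 →ᵃ[ℝ] ℝ} (hf : IsSupporting N y T f) {i j : ℕ}
    (hi : i < N) (hj : j < N) (hij : i ≠ j) :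
    f (edgePoint y a i j) = 0 ↔ ({i, j} : Finset ℕ) ⊆ T := by
  rw [insert_subset_iff, singleton_subset_iff]
  constructor
  · intro h
    by_contra hne
    refine (hA.apply_edgePoint_pos hi hj hij (hf.nonneg hi) (hf.nonneg hj) ?_).ne' h
    by_cases hiT : i ∈ T
    · exact Or.inr (hf.2 j hj fun hjT => hne ⟨hiT, hjT⟩)
    · exact Or.inl (hf.2 i hi hiT)
  · rintro ⟨hiT, hjT⟩
    rw [_root_.apply_edgePoint (hA.pos i hi j hj hij), hf.1 i hiT, hf.1 j hjT]
    simp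

lemma truncActive_edgePoint (hg : ∀ T ∈ 𝓕, IsSupporting N y T (g T)) {i j : ℕ} (hi : i < N)
    (hj : j < N) (hij : i ≠ j) (he : {i, j} ∈ faces 𝓕) :
    truncActive N 𝓕 a g (edgePoint y a i j) = ({i, j} : Finset ℕ).disjSum (cofaces 𝓕 {i, j}) := by
  apply truncActive_eq
  · intro m
    constructor
    · rintro ⟨hm, h⟩
      exact (hA.apply_edgePoint_eq_zero_iff hi hj hij hm he).1 h
    · intro hm
      have hmN : m < N := by
        rcases mem_insert.1 hm with rfl | h
        · exact hi
        · rwa [mem_singleton.1 h]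
      exact ⟨hmN, (hA.apply_edgePoint_eq_zero_iff hi hj hij hmN he).2 hm⟩
  · ext T
    rw [mem_active, mem_cofaces]
    exact and_congr_right fun hT => hA.supporting_edgePoint_eq_zero_iff (hg T hT) hi hj hij

lemma edgePoint_mem_truncFace_iff (hg : ∀ T ∈ 𝓕, IsSupporting N y T (g T)) {i j : ℕ} (hi : i < N)
    (hj : j < N) (hij : i ≠ j) (he : {i, j} ∈ faces 𝓕) {A : Finset (ℕ ⊕ Finset ℕ)}
    (hAI : A ⊆ (range N).disjSum 𝓕) :
    edgePoint y a i j ∈ truncFace N 𝓕 a g A ↔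
      A ⊆ ({i, j} : Finset ℕ).disjSum (cofaces 𝓕 {i, j}) := by
  rw [← hA.truncActive_edgePoint hg hi hj hij he]
  exact ⟨fun h α hα => mem_active.2 ⟨hAI hα, h.2 α hα⟩, fun h =>
    ⟨hA.edgePoint_mem_truncated hg hi hj hij he, fun α hα => (mem_active.1 (h hα)).2⟩⟩

/-- The possible sets of tight inequalities at points of the truncated polytope. -/
lemma truncActive_cases (hR : Realizes N 𝓕 y) (hM : IsPseudoManifold N 𝓕)
    (hg : ∀ T ∈ 𝓕, IsSupporting N y T (g T)) (hx : x ∈ truncated N 𝓕 a g) :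
    (∃ i < N, ∃ j < N, i ≠ j ∧ {i, j} ∈ faces 𝓕 ∧ x = edgePoint y a i j) ∨
    (∃ τ ∈ faces 𝓕, 3 ≤ τ.card ∧ truncActive N 𝓕 a g x = (∅ : Finset ℕ).disjSum (cofaces 𝓕 τ)) ∨
    (∃ τ ∈ faces 𝓕, 3 ≤ τ.card ∧ ∃ i ∈ τ,
      truncActive N 𝓕 a g x = ({i} : Finset ℕ).disjSum (cofaces 𝓕 τ)) ∨
    (∃ i < N, truncActive N 𝓕 a g x = {.inl i}) ∨ truncActive N 𝓕 a g x = ∅ := by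
  obtain ⟨hxa, hxP⟩ := mem_truncated_iff.1 hx
  have hxh : x ∈ hull y (range N) := by rw [hR.hull_eq_hpoly hM hg]; exact hxP
  by_cases htwo : ∃ i < N, ∃ j < N, i ≠ j ∧ a i x = 0 ∧ a j x = 0
  · obtain ⟨i, hi, j, hj, hij, h1, h2⟩ := htwo
    obtain ⟨he, hxe⟩ := hA.eq_edgePoint hxh hi hj hij h1.le h2.le
    exact Or.inl ⟨i, hi, j, hj, hij, he, hxe⟩
  have hV : (∀ i < N, a i x ≠ 0) ∨ ∃ i < N, ∀ m, m < N ∧ a m x = 0 ↔ m ∈ ({i} : Finset ℕ) := by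
    by_contra! hcon
    obtain ⟨⟨i, hi, h0⟩, h1⟩ := hcon
    obtain ⟨m, hm⟩ := h1 i hi
    rw [mem_singleton] at hm
    rcases hm with ⟨⟨hm, hm0⟩, hne⟩ | ⟨hm, rfl⟩
    · exact htwo ⟨m, hm, i, hi, hne, hm0, h0⟩
    · exact hm hi h0
  rcases (active 𝓕 g x).eq_empty_or_nonempty with h0 | h0
  · right; right; right
    rcases hV with hV | ⟨i, hi, hV⟩
    · exact Or.inr (truncActive_eq (V := ∅) (fun m => by simpa using hV m) h0)
    · exact Or.inl ⟨i, hi, truncActive_eq hV h0⟩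
  · obtain ⟨σ, hσ, w, hw0, hw1, hwx, ha⟩ := hR.exists_carrier hM hg hxP h0
    have hlt : ∀ {k}, k ∈ σ → k < N := fun hk => hM.lt_of_mem_faces hσ hk
    -- With at least three carrier vertices, a cut tight at `x` must belong to one of them, since
    -- other cuts are positive on the carrier. A single carrier vertex has been cut off, and a
    -- carrier edge leaves only its edge point.
    rcases le_or_gt 3 σ.card with hc | hc
    · right
      rcases hV with hV | ⟨i, hi, hV⟩
      · exact Or.inl ⟨σ, hσ, hc, truncActive_eq (fun m => by simpa using hV m) ha⟩
      · refine Or.inr (Or.inl ⟨σ, hσ, hc, i, ?_, truncActive_eq hV ha⟩)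
        by_contra hiσ
        have h1 := ((hV i).2 (mem_singleton_self i)).2
        rw [← hwx, affineMap_sum _ _ _ _ hw1] at h1
        refine (sum_pos (fun k hk => mul_pos (hw0 k hk) (hA.pos i hi k (hlt hk) ?_)) ?_).ne' h1
        · rintro rfl; exact hiσ hk
        · exact card_pos.1 (by omega)
    · left
      have hxσ : x ∈ hull y σ := (mem_convexHull_image_iff _ _ _).2
        ⟨w, fun k hk => (hw0 k hk).le, hw1, hwx⟩
      interval_cases hcard : σ.card
      · rw [card_eq_zero.1 hcard] at hw1
        simp at hw1
      · obtain ⟨k, rfl⟩ := card_eq_one.1 hcard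
        have hk := hlt (mem_singleton_self k)
        have := hxa k hk
        rw [← hwx, affineMap_sum _ _ _ _ hw1, sum_singleton, hA.self k hk] at this
        rw [sum_singleton] at hw1
        rw [hw1] at this
        norm_num at this
      · obtain ⟨i, j, hij, rfl⟩ := card_eq_two.1 hcard
        have hi : i < N := hlt (by simp)
        have hj : j < N := hlt (by simp)
        exact ⟨i, hi, j, hj, hij, hσ,
          hA.eq_edgePoint_of_mem_edge hi hj hij hσ hxσ (hxa i hi) (hxa j hj)⟩

end IsTruncation

end TruncatedPolytope

/-! ### The faces of the truncated polytope: labels, numbers, dimensions and shapes. -/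

section TruncatedFaces

open Finset

variable {N : ℕ} {𝓕 : Finset (Finset ℕ)} {y : ℕ → E4} {a : ℕ → E4 →ᵃ[ℝ] ℝ}
  {g : Finset ℕ → E4 →ᵃ[ℝ] ℝ} {T σ τ V : Finset ℕ} {x : E4}

/-- The label `V.disjSum (cofaces 𝓕 τ)` of the face of the truncated polytope lying in all facets
that contain `τ` and in the truncating hyperplanes at `V`. -/
def flagLabel (𝓕 : Finset (Finset ℕ)) (V τ : Finset ℕ) : Finset (ℕ ⊕ Finset ℕ) :=
  V.disjSum (cofaces 𝓕 τ)

/-- The labels `flagLabel 𝓕 {i} τ` with `i ∈ τ` and `τ` a face with `k` vertices. -/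
def vertexFlagLabels (𝓕 : Finset (Finset ℕ)) (k : ℕ) : Finset (Finset (ℕ ⊕ Finset ℕ)) :=
  ((facesCard 𝓕 k).sigma fun τ => τ).image fun p => flagLabel 𝓕 {p.2} p.1

/-- The labels of the faces of the truncated polytope, by dimension. -/
def truncLabels (N : ℕ) (𝓕 : Finset (Finset ℕ)) : ℕ → Finset (Finset (ℕ ⊕ Finset ℕ))
  | 0 => (facesCard 𝓕 2).image fun e => flagLabel 𝓕 e e
  | 1 => vertexFlagLabels 𝓕 3
  | 2 => (facesCard 𝓕 3).image (flagLabel 𝓕 ∅) ∪ vertexFlagLabels 𝓕 4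
  | 3 => ((range N).disjSum 𝓕).image singleton
  | 4 => {∅}
  | _ => ∅

lemma inl_mem_flagLabel {i : ℕ} : .inl i ∈ flagLabel 𝓕 V τ ↔ i ∈ V := inl_mem_disjSum

lemma inr_mem_flagLabel : .inr T ∈ flagLabel 𝓕 V τ ↔ T ∈ 𝓕 ∧ τ ⊆ T := by
  rw [flagLabel, inr_mem_disjSum, mem_cofaces]

lemma flagLabel_subset {V' τ' : Finset ℕ} (hV : V ⊆ V') (hτ : τ' ⊆ τ) :
    flagLabel 𝓕 V τ ⊆ flagLabel 𝓕 V' τ' := by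
  rintro (i | T) h
  · exact inl_mem_flagLabel.2 (hV (inl_mem_flagLabel.1 h))
  · obtain ⟨h1, h2⟩ := inr_mem_flagLabel.1 h
    exact inr_mem_flagLabel.2 ⟨h1, hτ.trans h2⟩

lemma mem_vertexFlagLabels {k : ℕ} {A : Finset (ℕ ⊕ Finset ℕ)} :
    A ∈ vertexFlagLabels 𝓕 k ↔ ∃ τ ∈ facesCard 𝓕 k, ∃ i ∈ τ, A = flagLabel 𝓕 {i} τ := by
  simp only [vertexFlagLabels, mem_image, mem_sigma]
  constructor
  · rintro ⟨⟨τ, i⟩, ⟨hτ, hi⟩, rfl⟩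
    exact ⟨τ, hτ, i, hi, rfl⟩
  · rintro ⟨τ, hτ, i, hi, rfl⟩
    exact ⟨⟨τ, i⟩, ⟨hτ, hi⟩, rfl⟩

/-- The points of the edges that are not cut off. -/
def edgePoints (𝓕 : Finset (Finset ℕ)) (y : ℕ → E4) (a : ℕ → E4 →ᵃ[ℝ] ℝ) : Set E4 :=
  {x | ∃ i j, i ≠ j ∧ {i, j} ∈ faces 𝓕 ∧ x = edgePoint y a i j}

namespace IsPseudoManifold

lemma finite_edgePoints (hM : IsPseudoManifold N 𝓕) : (edgePoints 𝓕 y a).Finite := by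
  refine (((range N ×ˢ range N).image fun p => edgePoint y a p.1 p.2).finite_toSet).subset ?_
  rintro x ⟨i, j, -, he, rfl⟩
  exact mem_coe.2 (mem_image.2 ⟨(i, j), mem_product.2
    ⟨mem_range.2 (hM.lt_of_mem_faces he (by simp)),
      mem_range.2 (hM.lt_of_mem_faces he (by simp))⟩, rfl⟩)

lemma flagLabel_subset_disjSum (hM : IsPseudoManifold N 𝓕) (hτ : τ ∈ faces 𝓕) (hV : V ⊆ τ) :
    flagLabel 𝓕 V τ ⊆ (range N).disjSum 𝓕 := by
  rintro (i | T) h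
  · exact inl_mem_disjSum.2 (mem_range.2 (hM.lt_of_mem_faces hτ (hV (inl_mem_flagLabel.1 h))))
  · exact inr_mem_disjSum.2 (inr_mem_flagLabel.1 h).1

/-- A face is the intersection of its cofaces, so having more cofaces means being smaller. Hence
labels determine the faces they come from. -/
lemma subset_of_flagLabel_subset (hM : IsPseudoManifold N 𝓕) (hτ : τ ∈ faces 𝓕)
    {V' : Finset ℕ} (h : flagLabel 𝓕 V τ ⊆ flagLabel 𝓕 V' σ) : σ ⊆ τ := by
  intro k hk
  by_contra hkτ
  obtain ⟨T, hT, hs, hkT⟩ := hM.exists_notMem hτ hkτ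
  exact hkT ((inr_mem_flagLabel.1 (h (inr_mem_flagLabel.2 ⟨hT, hs⟩))).2 hk)

lemma flagLabel_inj (hM : IsPseudoManifold N 𝓕) (hτ : τ ∈ faces 𝓕) (hσ : σ ∈ faces 𝓕)
    {V' : Finset ℕ} (h : flagLabel 𝓕 V τ = flagLabel 𝓕 V' σ) : V = V' ∧ τ = σ := by
  refine ⟨?_, (hM.subset_of_flagLabel_subset hσ h.ge).antisymm
    (hM.subset_of_flagLabel_subset hτ h.le)⟩
  ext i
  rw [← inl_mem_flagLabel (𝓕 := 𝓕) (τ := τ), h, inl_mem_flagLabel]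

lemma exists_edge_of_subset {W : Finset ℕ} (hτ : τ ∈ faces 𝓕) (hW : W ⊆ τ) (hWc : W.card ≤ 2)
    (hc : 2 ≤ τ.card) : ∃ e ∈ facesCard 𝓕 2, W ⊆ e ∧ e ⊆ τ := by
  obtain ⟨e, h1, h2, h3⟩ := exists_subsuperset_card_eq hW hWc hc
  exact ⟨e, mem_facesCard.2 ⟨faces_mono hτ h2, h3⟩, h1, h2⟩

lemma cofaces_of_mem (hM : IsPseudoManifold N 𝓕) (hT : T ∈ 𝓕) : cofaces 𝓕 T = {T} := by
  ext U
  rw [mem_cofaces, mem_singleton]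
  constructor
  · rintro ⟨hU, hs⟩
    exact (hM.eq_of_subset hT hU hs).symm
  · rintro rfl
    exact ⟨hT, Subset.rfl⟩

lemma flagLabel_empty_of_mem (hM : IsPseudoManifold N 𝓕) (hT : T ∈ 𝓕) :
    flagLabel 𝓕 ∅ T = {.inr T} := by
  rw [flagLabel, hM.cofaces_of_mem hT]
  ext (i | U) <;> simp

lemma card_vertexFlagLabels (hM : IsPseudoManifold N 𝓕) (k : ℕ) :
    (vertexFlagLabels 𝓕 k).card = k * (facesCard 𝓕 k).card := by
  rw [vertexFlagLabels, card_image_of_injOn, card_sigma,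
    sum_congr rfl fun τ hτ => (mem_facesCard.1 hτ).2, sum_const, smul_eq_mul, mul_comm]
  rintro ⟨τ, i⟩ hp ⟨σ, j⟩ hq he
  obtain ⟨h1, h2⟩ := hM.flagLabel_inj (mem_facesCard.1 (mem_sigma.1 hp).1).1
    (mem_facesCard.1 (mem_sigma.1 hq).1).1 he
  obtain rfl : τ = σ := h2
  obtain rfl : i = j := by simpa using h1
  rfl

lemma card_truncLabels (hM : IsPseudoManifold N 𝓕) :
    (truncLabels N 𝓕 0).card = (facesCard 𝓕 2).card ∧
    (truncLabels N 𝓕 1).card = 3 * (facesCard 𝓕 3).card ∧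
    (truncLabels N 𝓕 2).card = (facesCard 𝓕 3).card + 4 * 𝓕.card ∧
    (truncLabels N 𝓕 3).card = N + 𝓕.card := by
  refine ⟨?_, hM.card_vertexFlagLabels 3, ?_, ?_⟩
  · rw [truncLabels, card_image_of_injOn]
    intro e he e' he' h
    exact (hM.flagLabel_inj (mem_facesCard.1 he).1 (mem_facesCard.1 he').1 h).1
  · rw [truncLabels, card_union_of_disjoint, card_image_of_injOn, hM.card_vertexFlagLabels,
      hM.facesCard_four]
    · intro e he e' he' h
      exact (hM.flagLabel_inj (mem_facesCard.1 he).1 (mem_facesCard.1 he').1 h).2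
    · rw [disjoint_left]
      intro A h1 h2
      obtain ⟨τ, hτ, rfl⟩ := mem_image.1 h1
      obtain ⟨σ, hσ, i, hi, h⟩ := mem_vertexFlagLabels.1 h2
      exact (singleton_ne_empty i) (hM.flagLabel_inj (mem_facesCard.1 hτ).1
        (mem_facesCard.1 hσ).1 h).1.symm
  · rw [truncLabels, card_image_of_injective _ singleton_injective, card_disjSum, card_range]

end IsPseudoManifold

namespace IsTruncation

variable (hA : IsTruncation N 𝓕 y a) (hM : IsPseudoManifold N 𝓕)
  (hg : ∀ T ∈ 𝓕, IsSupporting N y T (g T))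
include hA hM hg

lemma exists_edgePoint {e : Finset ℕ} (he : e ∈ facesCard 𝓕 2) :
    ∃ x ∈ edgePoints 𝓕 y a, x ∈ truncated N 𝓕 a g ∧ truncActive N 𝓕 a g x = flagLabel 𝓕 e e := by
  obtain ⟨he, hc⟩ := mem_facesCard.1 he
  obtain ⟨i, j, hij, rfl⟩ := card_eq_two.1 hc
  have hi : i < N := hM.lt_of_mem_faces he (by simp)
  have hj : j < N := hM.lt_of_mem_faces he (by simp)
  exact ⟨_, ⟨i, j, hij, he, rfl⟩, hA.edgePoint_mem_truncated hg hi hj hij he,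
    hA.truncActive_edgePoint hg hi hj hij he⟩

lemma exists_edgePoint_mem_truncFace {e : Finset ℕ} (he : e ∈ facesCard 𝓕 2)
    {A : Finset (ℕ ⊕ Finset ℕ)} (hAe : A ⊆ flagLabel 𝓕 e e) :
    ∃ x ∈ edgePoints 𝓕 y a, x ∈ truncFace N 𝓕 a g A := by
  obtain ⟨x, hx, hxQ, hxa⟩ := hA.exists_edgePoint hM hg he
  exact ⟨x, hx, hxQ, fun α hα => (mem_active.1 (hxa.symm ▸ hAe hα :
    α ∈ truncActive N 𝓕 a g x)).2⟩

/-- Edge points serve as the witnesses in `exists_active_eq`, and their tight sets are known.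
Realizability of a tight set becomes a question about edges of the complex. -/
lemma exists_truncActive_eq {A : Finset (ℕ ⊕ Finset ℕ)} (hAI : A ⊆ (range N).disjSum 𝓕)
    (hne : ∃ e ∈ facesCard 𝓕 2, A ⊆ flagLabel 𝓕 e e)
    (hcl : ∀ α ∈ (range N).disjSum 𝓕, α ∉ A →
      ∃ e ∈ facesCard 𝓕 2, A ⊆ flagLabel 𝓕 e e ∧ α ∉ flagLabel 𝓕 e e) :
    ∃ x ∈ truncated N 𝓕 a g, truncActive N 𝓕 a g x = A := by
  refine exists_active_eq hAI (isExposed_hface hAI) ?_ fun α hα hαA => ?_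
  · obtain ⟨e, he, hAe⟩ := hne
    obtain ⟨x, -, hx⟩ := hA.exists_edgePoint_mem_truncFace hM hg he hAe
    exact ⟨x, hx⟩
  · obtain ⟨e, he, hAe, hαe⟩ := hcl α hα hαA
    obtain ⟨x, -, hxQ, hxa⟩ := hA.exists_edgePoint hM hg he
    refine ⟨x, ⟨hxQ, fun β hβ => (mem_active.1 (hxa.symm ▸ hAe hβ :
      β ∈ truncActive N 𝓕 a g x)).2⟩, fun h0 => hαe ?_⟩
    rw [← hxa]
    exact mem_active.2 ⟨hα, h0⟩

/-- The witnesses are edges e with V ⊆ e ⊆ τ. Against a cut m outside V, e avoids m, which needs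
three vertices in τ. Against a facet not containing τ, e passes through a vertex of τ outside it,
which needs |V| ≤ 1. -/
lemma exists_truncActive_eq_flagLabel (hτ : τ ∈ faces 𝓕) (hc : 3 ≤ τ.card) (hV : V ⊆ τ)
    (hVc : V.card ≤ 1) :
    ∃ x ∈ truncated N 𝓕 a g, truncActive N 𝓕 a g x = flagLabel 𝓕 V τ := by
  have hsub := hM.flagLabel_subset_disjSum hτ hV
  refine hA.exists_truncActive_eq hM hg hsub ?_ ?_
  · obtain ⟨e, he, h1, h2⟩ := IsPseudoManifold.exists_edge_of_subset hτ hV (by omega) (by omega)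
    exact ⟨e, he, flagLabel_subset h1 h2⟩
  · rintro (m | T) hα hαA
    · rw [inl_mem_flagLabel] at hαA
      obtain ⟨e, he, h1, h2⟩ := IsPseudoManifold.exists_edge_of_subset
        (faces_mono hτ (erase_subset m τ)) (subset_erase.2 ⟨hV, hαA⟩) (by omega)
        (by have := pred_card_le_card_erase (s := τ) (a := m); omega)
      exact ⟨e, he, flagLabel_subset h1 (h2.trans (erase_subset _ _)),
        fun h => notMem_erase m τ (h2 (inl_mem_flagLabel.1 h))⟩
    · have hT : T ∈ 𝓕 := inr_mem_disjSum.1 hα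
      rw [inr_mem_flagLabel, not_and] at hαA
      obtain ⟨k, hk, hkT⟩ := not_subset.1 (hαA hT)
      obtain ⟨e, he, h1, h2⟩ := IsPseudoManifold.exists_edge_of_subset hτ
        (insert_subset hk hV) ((card_insert_le k V).trans (by omega)) (by omega)
      exact ⟨e, he, flagLabel_subset ((subset_insert _ _).trans h1) h2,
        fun h => hkT ((inr_mem_flagLabel.1 h).2 (h1 (mem_insert_self _ _)))⟩

/-- Here no facet inequality may be tight. To avoid a facet T, use an edge through V and a vertex
outside T, taken from another facet that contains V. -/
lemma exists_truncActive_eq_disjSum_empty (hV : V ∈ faces 𝓕) (hVc : V.card ≤ 1) :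
    ∃ x ∈ truncated N 𝓕 a g, truncActive N 𝓕 a g x = V.disjSum ∅ := by
  have hsub : ∀ {e : Finset ℕ}, V ⊆ e → V.disjSum ∅ ⊆ flagLabel 𝓕 e e := fun h =>
    disjSum_mono h (empty_subset _)
  have hN : V ⊆ range N := fun k hk => mem_range.2 (hM.lt_of_mem_faces hV hk)
  obtain ⟨U, hU, hVU⟩ := mem_faces.1 hV
  have hUf := mem_faces_of_mem hU
  have hUc := hM.card U hU
  refine hA.exists_truncActive_eq hM hg (disjSum_mono hN (empty_subset _)) ?_ ?_
  · obtain ⟨e, he, h1, -⟩ := IsPseudoManifold.exists_edge_of_subset hUf hVU (by omega) (by omega)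
    exact ⟨e, he, hsub h1⟩
  · rintro (m | T) hα hαA
    · rw [inl_mem_disjSum] at hαA
      obtain ⟨e, he, h1, h2⟩ := IsPseudoManifold.exists_edge_of_subset
        (faces_mono hUf (erase_subset m U)) (subset_erase.2 ⟨hVU, hαA⟩) (by omega)
        (by have := pred_card_le_card_erase (s := U) (a := m); omega)
      exact ⟨e, he, hsub h1, fun h => notMem_erase m U (h2 (inl_mem_flagLabel.1 h))⟩
    · have hT : T ∈ 𝓕 := inr_mem_disjSum.1 hα
      have hTc := hM.card T hT
      obtain ⟨W, hW, hVW, hne⟩ : ∃ W ∈ 𝓕, V ⊆ W ∧ W ≠ T := by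
        by_cases hVT : V ⊆ T
        · obtain ⟨l, hl, hlV⟩ : ∃ l ∈ T, l ∉ V := by
            by_contra! hall
            have := card_le_card (show T ⊆ V from hall)
            omega
          obtain ⟨W, hW, hs, hlW⟩ := hM.exists_adjacent hT hl
          exact ⟨W, hW, (subset_erase.2 ⟨hVT, hlV⟩).trans hs, by rintro rfl; exact hlW hl⟩
        · exact ⟨U, hU, hVU, by rintro rfl; exact hVT hVU⟩
      obtain ⟨k, hk, hkT⟩ := hM.exists_mem_notMem hW hT hne
      obtain ⟨e, he, h1, -⟩ := IsPseudoManifold.exists_edge_of_subset (mem_faces_of_mem hW)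
        (insert_subset hk hVW) ((card_insert_le k V).trans (by omega))
        (by rw [hM.card W hW]; norm_num)
      exact ⟨e, he, hsub ((subset_insert _ _).trans h1),
        fun h => hkT ((inr_mem_flagLabel.1 h).2 (h1 (mem_insert_self _ _)))⟩

lemma exists_truncActive_eq_singleton {α : ℕ ⊕ Finset ℕ} (hα : α ∈ (range N).disjSum 𝓕) :
    ∃ x ∈ truncated N 𝓕 a g, truncActive N 𝓕 a g x = {α} := by
  rcases α with i | T
  · obtain ⟨T, hT, hi⟩ := hM.cover i (mem_range.1 (inl_mem_disjSum.1 hα))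
    obtain ⟨x, hx, hxa⟩ := hA.exists_truncActive_eq_disjSum_empty hM hg (V := {i})
      (mem_faces.2 ⟨T, hT, singleton_subset_iff.2 hi⟩) (by simp)
    refine ⟨x, hx, hxa.trans ?_⟩
    ext (j | U) <;> simp
  · have hT : T ∈ 𝓕 := inr_mem_disjSum.1 hα
    obtain ⟨x, hx, hxa⟩ := hA.exists_truncActive_eq_flagLabel hM hg (V := ∅) (mem_faces_of_mem hT)
      (by rw [hM.card T hT]; norm_num) (empty_subset _) (by simp)
    exact ⟨x, hx, hxa.trans (hM.flagLabel_empty_of_mem hT)⟩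

lemma exists_truncActive_eq_empty :
    ∃ x ∈ truncated N 𝓕 a g, truncActive N 𝓕 a g x = ∅ := by
  obtain ⟨T, hT⟩ := hM.nonempty
  obtain ⟨x, hx, hxa⟩ := hA.exists_truncActive_eq_disjSum_empty hM hg (V := ∅)
    (mem_faces.2 ⟨T, hT, empty_subset _⟩) (by simp)
  exact ⟨x, hx, hxa.trans (by simp)⟩

/-- Every member of `truncLabels` is the set of tight inequalities at some point. -/
lemma exists_of_mem_truncLabels (k : ℕ) (A : Finset (ℕ ⊕ Finset ℕ)) (hAk : A ∈ truncLabels N 𝓕 k) :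
    ∃ x ∈ truncated N 𝓕 a g, truncActive N 𝓕 a g x = A := by
  have hflag : ∀ {m}, 3 ≤ m → A ∈ vertexFlagLabels 𝓕 m →
      ∃ x ∈ truncated N 𝓕 a g, truncActive N 𝓕 a g x = A := by
    intro m hm hAm
    obtain ⟨τ, hτ, i, hi, rfl⟩ := mem_vertexFlagLabels.1 hAm
    obtain ⟨hτ, hc⟩ := mem_facesCard.1 hτ
    exact hA.exists_truncActive_eq_flagLabel hM hg hτ (by omega) (singleton_subset_iff.2 hi)
      (by simp)
  match k, hAk with
  | 0, h =>
    obtain ⟨e, he, rfl⟩ := mem_image.1 h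
    obtain ⟨x, -, hx, hxa⟩ := hA.exists_edgePoint hM hg he
    exact ⟨x, hx, hxa⟩
  | 1, h => exact hflag le_rfl h
  | 2, h =>
    rcases mem_union.1 h with h | h
    · obtain ⟨τ, hτ, rfl⟩ := mem_image.1 h
      obtain ⟨hτ, hc⟩ := mem_facesCard.1 hτ
      exact hA.exists_truncActive_eq_flagLabel hM hg hτ hc.ge (empty_subset _) (by simp)
    · exact hflag (by norm_num) h
  | 3, h =>
    obtain ⟨α, hα, rfl⟩ := mem_image.1 h
    exact hA.exists_truncActive_eq_singleton hM hg hα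
  | 4, h =>
    rw [mem_singleton.1 h]
    exact hA.exists_truncActive_eq_empty hM hg

variable (hR : Realizes N 𝓕 y)
include hR

/-- Every set of tight inequalities is listed in `truncLabels`. -/
lemma exists_mem_truncLabels (x : E4) (hx : x ∈ truncated N 𝓕 a g) :
    ∃ k, truncActive N 𝓕 a g x ∈ truncLabels N 𝓕 k := by
  rcases hA.truncActive_cases hR hM hg hx with ⟨i, hi, j, hj, hij, he, rfl⟩ | ⟨τ, hτ, hc, h⟩ |
    ⟨τ, hτ, hc, i, hi, h⟩ | ⟨i, hi, h⟩ | h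
  · rw [hA.truncActive_edgePoint hg hi hj hij he]
    exact ⟨0, mem_image.2 ⟨_, mem_facesCard.2 ⟨he, card_pair hij⟩, rfl⟩⟩
  · rw [h]
    have hc' := hM.card_le_of_mem_faces hτ
    obtain h3 | h4 : τ.card = 3 ∨ τ.card = 4 := by omega
    · exact ⟨2, mem_union_left _ (mem_image.2 ⟨τ, mem_facesCard.2 ⟨hτ, h3⟩, rfl⟩)⟩
    · have hT := hM.mem_of_mem_faces hτ h4
      refine ⟨3, mem_image.2 ⟨.inr τ, inr_mem_disjSum.2 hT, ?_⟩⟩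
      exact (hM.flagLabel_empty_of_mem hT).symm
  · rw [h]
    have hc' := hM.card_le_of_mem_faces hτ
    obtain h3 | h4 : τ.card = 3 ∨ τ.card = 4 := by omega
    · exact ⟨1, mem_vertexFlagLabels.2 ⟨τ, mem_facesCard.2 ⟨hτ, h3⟩, i, hi, rfl⟩⟩
    · exact ⟨2, mem_union_right _
        (mem_vertexFlagLabels.2 ⟨τ, mem_facesCard.2 ⟨hτ, h4⟩, i, hi, rfl⟩)⟩
  · rw [h]
    exact ⟨3, mem_image.2 ⟨.inl i, inl_mem_disjSum.2 (mem_range.2 hi), rfl⟩⟩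
  · rw [h]
    exact ⟨4, mem_singleton_self _⟩

/-- The truncated polytope is the hull of the edge points. -/
lemma truncated_eq_convexHull : truncated N 𝓕 a g = convexHull ℝ (edgePoints 𝓕 y a) := by
  have hfin : (edgePoints 𝓕 y a).Finite := hM.finite_edgePoints
  have hconv : Convex ℝ (truncated N 𝓕 a g) := by
    rw [truncated, ← hface_empty]
    exact convex_hface ∅
  apply Set.Subset.antisymm
  · have hclosed : IsClosed (truncated N 𝓕 a g) := by
      have : truncated N 𝓕 a g =
          ⋂ α ∈ (range N).disjSum 𝓕, {x | 0 ≤ (Sum.elim a g α : E4 →ᵃ[ℝ] ℝ) x} := by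
        ext x; simp [hpoly]
      rw [this]
      exact isClosed_biInter fun α _ => isClosed_le continuous_const
        (AffineMap.continuous_of_finiteDimensional _)
    have hcomp : IsCompact (truncated N 𝓕 a g) := by
      refine IsCompact.of_isClosed_subset
        (((range N).finite_toSet.image y).isCompact_convexHull ℝ) hclosed ?_
      intro x hx
      have := (mem_truncated_iff.1 hx).2
      rwa [← hR.hull_eq_hpoly hM hg] at this
    -- By Krein–Milman only extreme points matter. An extreme point is the sole point of the face
    -- cut out by its tight set; each possible tight set is contained in that of an edge point, so
    -- the two points coincide.
    rw [← closure_convexHull_extremePoints hcomp hconv]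
    refine closure_minimal (convexHull_mono ?_) (hfin.isClosed_convexHull ℝ)
    intro x hx
    have key : ∀ {e A}, truncActive N 𝓕 a g x = A → e ∈ facesCard 𝓕 2 →
        A ⊆ flagLabel 𝓕 e e → x ∈ edgePoints 𝓕 y a := by
      intro e A hxA he hAe
      obtain ⟨z, hz, hzA⟩ := hA.exists_edgePoint_mem_truncFace hM hg he hAe
      rw [← hxA] at hzA
      rwa [← eq_of_mem_extremePoints hx hzA]
    have key' : ∀ {V τ}, truncActive N 𝓕 a g x ⊆ flagLabel 𝓕 V τ → τ ∈ faces 𝓕 →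
        3 ≤ τ.card → V ⊆ τ → V.card ≤ 1 → x ∈ edgePoints 𝓕 y a := by
      intro V τ hxA hτ hc hV hVc
      obtain ⟨e, he, h1, h2⟩ := IsPseudoManifold.exists_edge_of_subset hτ hV
        (by omega) (by omega)
      exact key rfl he (hxA.trans (flagLabel_subset h1 h2))
    rcases hA.truncActive_cases hR hM hg hx.1 with ⟨i, -, j, -, hij, he, rfl⟩ | ⟨τ, hτ, hc, h⟩ |
      ⟨τ, hτ, hc, i, hi, h⟩ | ⟨i, hi, h⟩ | h
    · exact ⟨i, j, hij, he, rfl⟩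
    · exact key' h.le hτ hc (empty_subset _) (by simp)
    · exact key' h.le hτ hc (singleton_subset_iff.2 hi) (by simp)
    · obtain ⟨T, hT, hiT⟩ := hM.cover i hi
      refine key' (V := {i}) ?_ (mem_faces_of_mem hT) (by rw [hM.card T hT]; norm_num)
        (singleton_subset_iff.2 hiT) (by simp)
      rw [h, singleton_subset_iff]
      exact inl_mem_flagLabel.2 (mem_singleton_self i)
    · obtain ⟨T, hT⟩ := hM.nonempty
      exact key' (V := ∅) (h ▸ empty_subset _) (mem_faces_of_mem hT)
        (by rw [hM.card T hT]; norm_num) (empty_subset _) (by simp)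
  · refine convexHull_min ?_ hconv
    rintro x ⟨i, j, hij, he, rfl⟩
    exact hA.edgePoint_mem_truncated hg (hM.lt_of_mem_faces he (by simp))
      (hM.lt_of_mem_faces he (by simp)) hij he

lemma truncFace_eq_convexHull {A : Finset (ℕ ⊕ Finset ℕ)} (hAI : A ⊆ (range N).disjSum 𝓕) :
    truncFace N 𝓕 a g A = convexHull ℝ {x | x ∈ edgePoints 𝓕 y a ∧ x ∈ truncFace N 𝓕 a g A} :=
  hface_eq_convexHull hM.finite_edgePoints (hA.truncated_eq_convexHull hM hg hR) hAI

/-- The edge points on this face are those of the edges of τ at i, so the face is a vertex figure of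
the simplex τ. -/
lemma truncFace_vertexFlag (hτ : τ ∈ faces 𝓕) {i : ℕ} (hi : i ∈ τ) :
    truncFace N 𝓕 a g (flagLabel 𝓕 {i} τ) =
      convexHull ℝ (edgePoint y a i '' (τ.erase i : Set ℕ)) := by
  have hAI := hM.flagLabel_subset_disjSum hτ (singleton_subset_iff.2 hi)
  rw [hA.truncFace_eq_convexHull hM hg hR hAI]
  congr 1
  have hlt : ∀ {k}, k ∈ τ → k < N := fun hk => hM.lt_of_mem_faces hτ hk
  ext x
  constructor
  · rintro ⟨⟨j, l, hjl, he, rfl⟩, hx⟩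
    have hj : j < N := hM.lt_of_mem_faces he (by simp)
    have hl : l < N := hM.lt_of_mem_faces he (by simp)
    have hs := (hA.edgePoint_mem_truncFace_iff hg hj hl hjl he hAI).1 hx
    have hsub := hM.subset_of_flagLabel_subset hτ hs
    have him : i ∈ ({j, l} : Finset ℕ) :=
      inl_mem_flagLabel.1 (hs (inl_mem_flagLabel.2 (mem_singleton_self i)))
    rcases mem_insert.1 him with rfl | him
    · exact ⟨l, mem_erase.2 ⟨hjl.symm, hsub (by simp)⟩, rfl⟩
    · obtain rfl := mem_singleton.1 him
      exact ⟨j, mem_erase.2 ⟨hjl, hsub (by simp)⟩, (hA.edgePoint_comm hj hl hjl he).symm⟩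
  · rintro ⟨k, hk, rfl⟩
    obtain ⟨hki, hk⟩ := mem_erase.1 (mem_coe.1 hk)
    have hsub : ({i, k} : Finset ℕ) ⊆ τ := insert_subset hi (singleton_subset_iff.2 hk)
    have he := faces_mono hτ hsub
    refine ⟨⟨i, k, hki.symm, he, rfl⟩, ?_⟩
    rw [hA.edgePoint_mem_truncFace_iff hg (hlt hi) (hlt hk) hki.symm he hAI]
    exact flagLabel_subset (by simp) hsub

/-- Up to positive factors, the barycentric coordinates at the vertices of τ other than i are dual
to the edge points at i. -/
lemma isSimplex_vertexFlag (hτ : τ ∈ faces 𝓕) {i m : ℕ} (hi : i ∈ τ) (hc : τ.card = m + 2) :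
    IsSimplex m (truncFace N 𝓕 a g (flagLabel 𝓕 {i} τ)) := by
  rw [hA.truncFace_vertexFlag hM hg hR hτ hi]
  have hc' : (τ.erase i).card = m + 1 := by rw [card_erase_of_mem hi, hc]; rfl
  let e := ((τ.erase i).equivFinOfCardEq hc').symm
  obtain ⟨T, hT, hs⟩ := mem_faces.1 hτ
  obtain ⟨u, hu, huT⟩ := hM.exists_lt_notMem hT
  obtain ⟨β, hβ, -, -, -⟩ := exists_coords (hR.indep T hT) (hM.card T hT) (hg T hT).1
    ((hg T hT).2 u hu huT).ne'
  have hlt := hM.lt T hT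
  have key : ∀ k ∈ τ.erase i, ∀ l ∈ τ.erase i,
      β k (edgePoint y a i l) = (if k = l then 1 else 0) / (1 + a i (y l)) := by
    intro k hk l hl
    obtain ⟨hki, hk⟩ := mem_erase.1 hk
    obtain ⟨hli, hl⟩ := mem_erase.1 hl
    rw [apply_edgePoint (hA.pos i (hlt i (hs hi)) l (hlt l (hs hl)) hli.symm),
      hβ k (hs hk) i (hs hi), hβ k (hs hk) l (hs hl), if_neg hki, mul_zero, zero_add]
  refine ⟨fun k => edgePoint y a i (e k), affineIndependent_of_dual _ (fun k => β (e k)) ?_ ?_, ?_⟩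
  · intro k l hkl
    rw [key _ (e k).2 _ (e l).2, if_neg, zero_div]
    intro h
    exact hkl (e.injective (Subtype.ext h))
  · intro k
    rw [key _ (e k).2 _ (e k).2, if_pos rfl]
    obtain ⟨hki, hk⟩ := mem_erase.1 (e k).2
    have := hA.pos i (hlt i (hs hi)) _ (hlt _ (hs hk)) hki.symm
    positivity
  · refine congrArg (convexHull ℝ) (Set.ext fun x => ?_)
    constructor
    · rintro ⟨k, hk, rfl⟩
      exact ⟨e.symm ⟨k, hk⟩, by simp⟩
    · rintro ⟨k, rfl⟩
      exact ⟨_, (e k).2, rfl⟩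

lemma isSimplex_triangle (hτ : τ ∈ faces 𝓕) (hc : τ.card = 3) :
    IsSimplex 2 (truncFace N 𝓕 a g (flagLabel 𝓕 ∅ τ)) := by
  have hAI := hM.flagLabel_subset_disjSum hτ (empty_subset _)
  rw [hA.truncFace_eq_convexHull hM hg hR hAI]
  obtain ⟨i, j, k, hij, hik, hjk, rfl⟩ := card_eq_three.1 hc
  have hi : i < N := hM.lt_of_mem_faces hτ (by simp)
  have hj : j < N := hM.lt_of_mem_faces hτ (by simp)
  have hk : k < N := hM.lt_of_mem_faces hτ (by simp)
  have sij : ({i, j} : Finset ℕ) ⊆ {i, j, k} := by intro x; simp; tauto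
  have sik : ({i, k} : Finset ℕ) ⊆ {i, j, k} := by intro x; simp; tauto
  have sjk : ({j, k} : Finset ℕ) ⊆ {i, j, k} := subset_insert _ _
  have eij := faces_mono hτ sij
  have eik := faces_mono hτ sik
  have ejk := faces_mono hτ sjk
  -- Each edge point is paired with the cut at the opposite vertex: that cut is positive there and
  -- vanishes on the two edges at its own vertex.
  refine ⟨![edgePoint y a j k, edgePoint y a i k, edgePoint y a i j],
    affineIndependent_of_dual _ ![a i, a j, a k] ?_ ?_, ?_⟩
  · intro r s hrs
    fin_cases r <;> fin_cases s <;> first | exact absurd rfl hrs | skip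
    · exact hA.apply_edgePoint_left hi hk hik
    · exact hA.apply_edgePoint_left hi hj hij
    · exact hA.apply_edgePoint_left hj hk hjk
    · exact hA.apply_edgePoint_right hi hj hij eij
    · exact hA.apply_edgePoint_right hj hk hjk ejk
    · exact hA.apply_edgePoint_right hi hk hik eik
  · intro r
    fin_cases r
    · exact (hA.apply_edgePoint_of_ne hj hk hjk hi hij hik).ne'
    · exact (hA.apply_edgePoint_of_ne hi hk hik hj hij.symm hjk).ne'
    · exact (hA.apply_edgePoint_of_ne hi hj hij hk hik.symm hjk.symm).ne'
  · refine congrArg (convexHull ℝ) (Set.ext fun x => ?_)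
    have hmem : ∀ {r s}, r < N → s < N → r ≠ s → {r, s} ∈ faces 𝓕 →
        ({r, s} : Finset ℕ) ⊆ {i, j, k} →
        edgePoint y a r s ∈ {x | x ∈ edgePoints 𝓕 y a ∧
          x ∈ truncFace N 𝓕 a g (flagLabel 𝓕 ∅ {i, j, k})} := by
      intro r s hr hs hrs he hsub
      refine ⟨⟨r, s, hrs, he, rfl⟩, ?_⟩
      rw [hA.edgePoint_mem_truncFace_iff hg hr hs hrs he hAI]
      exact flagLabel_subset (empty_subset _) hsub
    constructor
    · rintro ⟨⟨r, s, hrs, he, rfl⟩, hx⟩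
      have hr : r < N := hM.lt_of_mem_faces he (by simp)
      have hs : s < N := hM.lt_of_mem_faces he (by simp)
      have hsub := hM.subset_of_flagLabel_subset hτ
        ((hA.edgePoint_mem_truncFace_iff hg hr hs hrs he hAI).1 hx)
      have hrm := hsub (mem_insert_self r {s})
      have hsm := hsub (mem_insert_of_mem (mem_singleton_self s))
      have hcomm := hA.edgePoint_comm hr hs hrs he
      simp only [mem_insert, mem_singleton] at hrm hsm
      rcases hrm with rfl | rfl | rfl <;> rcases hsm with rfl | rfl | rfl <;>
        first
          | exact absurd rfl hrs
          | exact ⟨0, rfl⟩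
          | exact ⟨1, rfl⟩
          | exact ⟨2, rfl⟩
          | exact ⟨0, hcomm.symm⟩
          | exact ⟨1, hcomm.symm⟩
          | exact ⟨2, hcomm.symm⟩
    · rintro ⟨r, rfl⟩
      fin_cases r
      · exact hmem hj hk hjk ejk sjk
      · exact hmem hi hk hik eik sik
      · exact hmem hi hj hij eij sij

lemma isSimplex_of_mem_truncLabels_two {A : Finset (ℕ ⊕ Finset ℕ)}
    (hA2 : A ∈ truncLabels N 𝓕 2) : IsSimplex 2 (truncFace N 𝓕 a g A) := by
  rcases mem_union.1 hA2 with h | h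
  · obtain ⟨τ, hτ, rfl⟩ := mem_image.1 h
    obtain ⟨hτ, hc⟩ := mem_facesCard.1 hτ
    exact hA.isSimplex_triangle hM hg hR hτ hc
  · obtain ⟨τ, hτ, i, hi, rfl⟩ := mem_vertexFlagLabels.1 h
    obtain ⟨hτ, hc⟩ := mem_facesCard.1 hτ
    exact hA.isSimplex_vertexFlag hM hg hR hτ hi hc

lemma polyDim_of_mem_truncLabels (k : ℕ) (A : Finset (ℕ ⊕ Finset ℕ))
    (hAk : A ∈ truncLabels N 𝓕 k) : polyDim (truncFace N 𝓕 a g A) = k := by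
  match k, hAk with
  | 0, h =>
    obtain ⟨e, he, rfl⟩ := mem_image.1 h
    obtain ⟨z, -, hz⟩ := hA.exists_edgePoint_mem_truncFace hM hg he Subset.rfl
    obtain ⟨he, hc⟩ := mem_facesCard.1 he
    obtain ⟨i, j, hij, rfl⟩ := card_eq_two.1 hc
    -- Imposing only the cut at `i` on the edge already leaves a single point.
    have h1 := hA.truncFace_vertexFlag hM hg hR he (mem_insert_self i {j})
    have h2 : ({i, j} : Finset ℕ).erase i = {j} := by
      rw [erase_insert]; simpa using hij
    rw [h2, coe_singleton, Set.image_singleton, convexHull_singleton] at h1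
    have h3 : truncFace N 𝓕 a g (flagLabel 𝓕 {i, j} {i, j}) ⊆ {edgePoint y a i j} := by
      rw [← h1]
      intro x hx
      exact ⟨hx.1, fun α hα => hx.2 α (flagLabel_subset (by simp) Subset.rfl hα)⟩
    have h4 : truncFace N 𝓕 a g (flagLabel 𝓕 {i, j} {i, j}) = {edgePoint y a i j} :=
      (Set.Nonempty.subset_singleton_iff ⟨z, hz⟩).1 h3
    simp [polyDim, h4]
  | 1, h =>
    obtain ⟨τ, hτ, i, hi, rfl⟩ := mem_vertexFlagLabels.1 h
    obtain ⟨hτ, hc⟩ := mem_facesCard.1 hτ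
    exact polyDim_of_isSimplex (hA.isSimplex_vertexFlag hM hg hR hτ hi hc)
  | 2, h => exact polyDim_of_isSimplex (hA.isSimplex_of_mem_truncLabels_two hM hg hR h)
  | 3, h =>
    obtain ⟨α, hα, rfl⟩ := mem_image.1 h
    obtain ⟨x, hx, hxa⟩ := hA.exists_truncActive_eq_singleton hM hg hα
    have := polyDim_hface_singleton hx hxa ?_
    · exact Nat.succ_injective this
    · rcases α with i | T
      · have hi := mem_range.1 (inl_mem_disjSum.1 hα)
        exact ⟨y i, by rw [Sum.elim_inl, hA.self i hi]; norm_num⟩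
      · have hT : T ∈ 𝓕 := inr_mem_disjSum.1 hα
        obtain ⟨u, hu, huT⟩ := hM.exists_lt_notMem hT
        exact ⟨y u, ((hg T hT).2 u hu huT).ne'⟩
  | 4, h =>
    obtain ⟨x, hx, hxa⟩ := hA.exists_truncActive_eq_empty hM hg
    rw [mem_singleton.1 h, truncFace, hface_empty]
    exact polyDim_hpoly hx hxa

lemma isFace_truncated_iff {k : ℕ} {F : Set E4} :
    IsFace k (truncated N 𝓕 a g) F ↔ ∃ A ∈ truncLabels N 𝓕 k, F = truncFace N 𝓕 a g A :=
  isFace_hpoly_iff (hA.exists_of_mem_truncLabels hM hg) (hA.polyDim_of_mem_truncLabels hM hg hR)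
    (hA.exists_mem_truncLabels hM hg hR)

lemma faceCount_truncated (k : ℕ) :
    faceCount (truncated N 𝓕 a g) k = (truncLabels N 𝓕 k).card :=
  faceCount_hpoly (hA.exists_of_mem_truncLabels hM hg) (hA.polyDim_of_mem_truncLabels hM hg hR)
    (hA.exists_mem_truncLabels hM hg hR) k

lemma polyDim_truncated : polyDim (truncated N 𝓕 a g) = 4 := by
  rw [truncated, ← hface_empty]
  exact hA.polyDim_of_mem_truncLabels hM hg hR 4 ∅ (mem_singleton_self _)

lemma isFacet_truncated_iff {F : Set E4} : IsFacet (truncated N 𝓕 a g) F ↔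
    ∃ α ∈ (range N).disjSum 𝓕, F = truncFace N 𝓕 a g {α} := by
  unfold IsFacet
  rw [hA.polyDim_truncated hM hg hR]
  constructor
  · rintro ⟨k, hF, hk⟩
    obtain rfl : k = 3 := by omega
    obtain ⟨A, hA3, rfl⟩ := (hA.isFace_truncated_iff hM hg hR).1 hF
    obtain ⟨α, hα, rfl⟩ := mem_image.1 hA3
    exact ⟨α, hα, rfl⟩
  · rintro ⟨α, hα, rfl⟩
    exact ⟨3, (hA.isFace_truncated_iff hM hg hR).2 ⟨_, mem_image_of_mem _ hα, rfl⟩, rfl⟩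

/-- Every inequality defines its own facet, and a face lies in that facet exactly when the
inequality belongs to its label. -/
lemma ncard_facets_containing {A : Finset (ℕ ⊕ Finset ℕ)} {k : ℕ}
    (hAk : A ∈ truncLabels N 𝓕 k) :
    Set.ncard {F | IsFacet (truncated N 𝓕 a g) F ∧ truncFace N 𝓕 a g A ⊆ F} = A.card := by
  obtain ⟨x, hx, rfl⟩ := hA.exists_of_mem_truncLabels hM hg k A hAk
  have hset : {F | IsFacet (truncated N 𝓕 a g) F ∧
      truncFace N 𝓕 a g (truncActive N 𝓕 a g x) ⊆ F} =
      (fun α => truncFace N 𝓕 a g {α}) '' (truncActive N 𝓕 a g x : Set (ℕ ⊕ Finset ℕ)) := by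
    ext F
    rw [Set.mem_ofPred_eq, hA.isFacet_truncated_iff hM hg hR]
    constructor
    · rintro ⟨⟨α, hα, rfl⟩, hs⟩
      exact ⟨α, mem_coe.2 (singleton_subset_iff.1
        ((hface_active_subset_iff hx (singleton_subset_iff.2 hα)).1 hs)), rfl⟩
    · rintro ⟨α, hα, rfl⟩
      have hα' : α ∈ (range N).disjSum 𝓕 := active_subset x hα
      exact ⟨⟨α, hα', rfl⟩, (hface_active_subset_iff hx (singleton_subset_iff.2 hα')).2
        (singleton_subset_iff.2 hα)⟩
  rw [hset, Set.InjOn.ncard_image, Set.ncard_coe_finset]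
  intro α hα β hβ he
  have hmem : ∀ {α}, α ∈ (truncActive N 𝓕 a g x : Set (ℕ ⊕ Finset ℕ)) →
      {α} ∈ truncLabels N 𝓕 3 := fun hα => mem_image_of_mem _ (active_subset x hα)
  exact singleton_injective
    (hface_injOn (hA.exists_of_mem_truncLabels hM hg 3) (hmem hα) (hmem hβ) he)

lemma is2Simple2Simplicial : Is2Simple2Simplicial (truncated N 𝓕 a g) := by
  refine ⟨⟨⟨(hM.finite_edgePoints (y := y) (a := a)).toFinset, ?_, ?_⟩, hA.polyDim_truncated hM hg hR⟩, ?_, ?_⟩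
  · obtain ⟨x, hx, -⟩ := hA.exists_truncActive_eq_empty hM hg
    rw [hA.truncated_eq_convexHull hM hg hR] at hx
    rw [Set.Finite.toFinset_nonempty]
    exact convexHull_nonempty_iff.1 ⟨x, hx⟩
  · rw [Set.Finite.coe_toFinset]
    exact hA.truncated_eq_convexHull hM hg hR
  · intro G hG
    obtain ⟨A, hA2, rfl⟩ := (hA.isFace_truncated_iff hM hg hR).1 hG
    exact hA.isSimplex_of_mem_truncLabels_two hM hg hR hA2
  · intro e he
    obtain ⟨A, hA1, rfl⟩ := (hA.isFace_truncated_iff hM hg hR).1 he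
    rw [hA.ncard_facets_containing hM hg hR hA1]
    obtain ⟨τ, hτ, i, hi, rfl⟩ := mem_vertexFlagLabels.1 hA1
    obtain ⟨hτ, hc⟩ := mem_facesCard.1 hτ
    -- One cut, at `i`, plus the two facets of the complex that share the ridge `τ`.
    rw [flagLabel, card_disjSum, card_singleton, cofaces, hM.ridge τ hτ hc]

end IsTruncation

end TruncatedFaces

/-! ### The deep vertex truncation property and the f-vectors. -/

section DeepVertexTruncation

open Finset

variable {N : ℕ} {𝓕 : Finset (Finset ℕ)} {y : ℕ → E4} {a : ℕ → E4 →ᵃ[ℝ] ℝ}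
  {g : Finset ℕ → E4 →ᵃ[ℝ] ℝ}

/-- On the line through u and v, the open condition f u < f z < f v only admits points of the
segment, so it defines a relative neighbourhood of p. -/
lemma mem_intrinsicInterior_segment {E : Type*} [NormedAddCommGroup E] [NormedSpace ℝ E]
    [FiniteDimensional ℝ E] (f : E →ᵃ[ℝ] ℝ) {u v p : E} (hp : p ∈ convexHull ℝ {u, v})
    (hu : f u < f p) (hv : f p < f v) : p ∈ intrinsicInterior ℝ (convexHull ℝ {u, v}) := by
  rw [mem_intrinsicInterior]
  refine ⟨⟨p, subset_affineSpan ℝ _ hp⟩, mem_interior.2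
    ⟨{z | f u < f z ∧ f z < f v}, ?_, ?_, hu, hv⟩, rfl⟩
  · rintro ⟨z, hz⟩ ⟨h1, h2⟩
    rw [affineSpan_convexHull, mem_affineSpan_pair_iff_exists_lineMap_eq] at hz
    obtain ⟨r, rfl⟩ := hz
    have hf : f (AffineMap.lineMap u v r) = r * (f v - f u) + f u := f.apply_lineMap u v r
    rw [hf] at h1 h2
    have hpos : 0 < f v - f u := by linarith
    have hr0 : 0 < r := (mul_pos_iff_of_pos_right hpos).1 (by linarith)
    have hr1 : r < 1 := by
      by_contra! hr
      nlinarith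
    change AffineMap.lineMap u v r ∈ convexHull ℝ {u, v}
    rw [convexHull_pair, segment_eq_image_lineMap]
    exact ⟨r, ⟨hr0.le, hr1.le⟩, rfl⟩
  · have hc : Continuous fun z : affineSpan ℝ (convexHull ℝ {u, v}) => f z :=
      (AffineMap.continuous_of_finiteDimensional f).comp continuous_subtype_val
    exact (isOpen_lt continuous_const hc).inter (isOpen_lt hc continuous_const)

namespace IsTruncation

lemma injOn (hA : IsTruncation N 𝓕 y a) : Set.InjOn y (range N : Set ℕ) := by
  intro i hi j hj he
  by_contra hne
  have h1 := hA.pos i (mem_range.1 hi) j (mem_range.1 hj) hne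
  rw [← he, hA.self i (mem_range.1 hi)] at h1
  norm_num at h1

lemma edgePoint_mem_hull (hA : IsTruncation N 𝓕 y a) {i j : ℕ} (hi : i < N) (hj : j < N)
    (hij : i ≠ j) : edgePoint y a i j ∈ hull y {i, j} := by
  have hp := hA.pos i hi j hj hij
  have hmi : y i ∈ hull y {i, j} := subset_convexHull ℝ _ ⟨i, by simp, rfl⟩
  have hmj : y j ∈ hull y {i, j} := subset_convexHull ℝ _ ⟨j, by simp, rfl⟩
  refine (convex_convexHull ℝ _).add_smul_sub_mem hmi hmj ⟨by positivity, ?_⟩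
  rw [div_le_one (by positivity)]
  linarith

lemma isDeepVertexTruncation (hA : IsTruncation N 𝓕 y a) (hM : IsPseudoManifold N 𝓕)
    (hg : ∀ T ∈ 𝓕, IsSupporting N y T (g T)) (hR : Realizes N 𝓕 y) :
    IsDeepVertexTruncation (hull y (range N)) (truncated N 𝓕 a g) := by
  let idx : E4 → ℕ := Function.invFunOn y (range N : Set ℕ)
  have hidx : ∀ k < N, idx (y k) = k := fun k hk =>
    hA.injOn.leftInvOn_invFunOn (mem_coe.2 (mem_range.2 hk))
  -- Splitting `a k` into its linear part and its constant turns `0 ≤ a k x` into the required form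
  -- `l x ≤ c`. Injectivity of `y` on the labels recovers `k` from the vertex.
  refine ⟨fun v => LinearMap.toContinuousLinearMap (-(a (idx v)).linear),
    fun v => a (idx v) 0, ?_, ?_, ?_⟩
  · rw [hR.exposedPoints_eq hM]
    rintro _ ⟨k, hk, rfl⟩
    have hk' := mem_range.1 (mem_coe.1 hk)
    have h1 := hA.self k hk'
    rw [affineMap_eq_linear_add] at h1
    simp only [hidx k hk', LinearMap.coe_toContinuousLinearMap', LinearMap.neg_apply]
    linarith
  · ext x
    rw [hR.exposedPoints_eq hM, hR.hull_eq_hpoly hM hg, mem_truncated_iff, and_comm,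
      Set.mem_inter_iff]
    refine and_congr_right fun _ => ?_
    simp only [Set.mem_iInter, Set.forall_mem_image, mem_coe, mem_range, Set.mem_ofPred_eq,
      LinearMap.coe_toContinuousLinearMap', LinearMap.neg_apply]
    refine forall₂_congr fun k hk => ?_
    rw [hidx k hk, affineMap_eq_linear_add (a k) x]
    constructor <;> intro h <;> linarith
  · intro e he
    obtain ⟨σ, hσ, rfl⟩ := (hR.isFace_iff hM (by norm_num)).1 he
    obtain ⟨hσ, hc⟩ := mem_facesCard.1 hσ
    obtain ⟨i, j, hij, rfl⟩ := card_eq_two.1 hc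
    have hi : i < N := hM.lt_of_mem_faces hσ (by simp)
    have hj : j < N := hM.lt_of_mem_faces hσ (by simp)
    have hm := hA.edgePoint_mem_hull hi hj hij
    refine ⟨edgePoint y a i j, ?_, ?_⟩
    · have hset : y '' (({i, j} : Finset ℕ) : Set ℕ) = {y i, y j} := by
        rw [coe_pair, Set.image_pair]
      have h0 := hA.apply_edgePoint_left hi hj hij
      rw [hull, hset] at hm ⊢
      refine mem_intrinsicInterior_segment (a i) hm ?_ ?_
      · rw [h0, hA.self i hi]; norm_num
      · rw [h0]; exact hA.pos i hi j hj hij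
    · ext x
      rw [Set.mem_singleton_iff]
      constructor
      · rintro ⟨hx, hxQ⟩
        have h := (mem_truncated_iff.1 hxQ).1
        exact hA.eq_edgePoint_of_mem_edge hi hj hij hσ hx (h i hi) (h j hj)
      · rintro rfl
        exact ⟨hm, hA.edgePoint_mem_truncated hg hi hj hij hσ⟩

end IsTruncation

/-- Every stacked complex is realized by a polytope with a deep vertex truncation that is
`2`-simple and `2`-simplicial. -/
lemma exists_deepVertexTruncation {n : ℕ} (hC : StackedComplex n 𝓕) :
    ∃ y a g, Realizes (5 + n) 𝓕 y ∧
      IsDeepVertexTruncation (hull y (range (5 + n))) (truncated (5 + n) 𝓕 a g) ∧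
      Is2Simple2Simplicial (truncated (5 + n) 𝓕 a g) ∧
      fVector (truncated (5 + n) 𝓕 a g) =
        ![10 + 4 * n, 30 + 18 * n, 30 + 18 * n, 10 + 4 * n] := by
  have hM := hC.isPseudoManifold
  obtain ⟨y, a, hR, hA⟩ := exists_truncation hC
  obtain ⟨g, hg⟩ := hR.exists_supporting
  refine ⟨y, a, g, hR, hA.isDeepVertexTruncation hM hg hR, hA.is2Simple2Simplicial hM hg hR, ?_⟩
  obtain ⟨-, c2, c3, c4⟩ := hC.card_eq
  obtain ⟨l0, l1, l2, l3⟩ := hM.card_truncLabels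
  ext k
  have hk := hA.faceCount_truncated hM hg hR k
  rw [fVector, hk]
  fin_cases k
  · change (truncLabels (5 + n) 𝓕 0).card = 10 + 4 * n
    omega
  · change (truncLabels (5 + n) 𝓕 1).card = 30 + 18 * n
    omega
  · change (truncLabels (5 + n) 𝓕 2).card = 30 + 18 * n
    omega
  · change (truncLabels (5 + n) 𝓕 3).card = 10 + 4 * n
    omega

lemma Realizes.fVector_eq {n : ℕ} (hR : Realizes (5 + n) 𝓕 y) (hC : StackedComplex n 𝓕) :
    fVector (hull y (range (5 + n))) = ![5 + n, 10 + 4 * n, 10 + 6 * n, 5 + 3 * n] := by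
  have hM := hC.isPseudoManifold
  obtain ⟨c1, c2, c3, c4⟩ := hC.card_eq
  rw [← hM.facesCard_four] at c4
  ext k
  rw [fVector, hR.faceCount_eq hM k.2]
  fin_cases k
  · exact c1
  · exact c2
  · exact c3
  · exact c4

/-- Since the number of faces is a combinatorial invariant, polytopes with arbitrarily many faces
have infinitely many combinatorial types. -/
lemma infinite_combType_image {d : ℕ} {𝒬 : Set (Set (EuclideanSpace ℝ (Fin d)))}
    (h : ∀ n, ∃ Q ∈ 𝒬, n < Nat.card (FaceLattice Q)) : (combType '' 𝒬).Infinite := by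
  intro hfin
  let κ : Quotient (combSetoid d) → ℕ := Quotient.lift (fun P => Nat.card (FaceLattice P))
    fun _ _ ⟨e⟩ => Nat.card_congr e.toEquiv
  obtain ⟨M, hM⟩ := (hfin.image κ).bddAbove
  obtain ⟨Q, hQ, hlt⟩ := h M
  exact absurd (hM ⟨_, ⟨Q, hQ, rfl⟩, rfl⟩) (not_le.2 hlt)

lemma faceCount_le_card_faceLattice {d : ℕ} {Q : Set (EuclideanSpace ℝ (Fin d))}
    [hfin : Finite (FaceLattice Q)] (k : ℕ) : faceCount Q k ≤ Nat.card (FaceLattice Q) :=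
  Set.ncard_le_ncard (t := {F | IsExposed ℝ Q F}) (fun _ hF => hF.2.1) hfin

end DeepVertexTruncation

/-! ### The corollary. -/

theorem mainTheorem6 :
    (∀ (n : ℕ) (S : Set (EuclideanSpace ℝ (Fin 4))), IsStacked n S →
      IsFullPolytope S ∧
      fVector S = ![5 + n, 10 + 4 * n, 10 + 6 * n, 5 + 3 * n] ∧
      ∃ P Q : Set (EuclideanSpace ℝ (Fin 4)),
        IsFullPolytope P ∧ CombEquiv P S ∧ IsDeepVertexTruncation P Q ∧
        Is2Simple2Simplicial Q ∧
        fVector Q = ![10 + 4 * n, 30 + 18 * n, 30 + 18 * n, 10 + 4 * n]) ∧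
    (combType '' {Q : Set (EuclideanSpace ℝ (Fin 4)) | Is2Simple2Simplicial Q}).Infinite := by
  constructor
  · intro n S hS
    obtain ⟨𝓕, x, hC, hRx, rfl⟩ := exists_realizes_of_isStacked hS
    have hM := hC.isPseudoManifold
    obtain ⟨y, a, g, hR, hD, h2, hf⟩ := exists_deepVertexTruncation hC
    exact ⟨hRx.isFullPolytope hM, hRx.fVector_eq hC, _, _, hR.isFullPolytope hM,
      hR.combEquiv hRx hM, hD, h2, hf⟩
  -- The truncation for `n` stackings has `10 + 4 * n > n` vertices, hence more than `n` faces.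
  · refine infinite_combType_image fun n => ?_
    obtain ⟨𝓕, hC⟩ := exists_stackedComplex n
    obtain ⟨y, a, g, -, -, h2, hf⟩ := exists_deepVertexTruncation hC
    refine ⟨_, h2, ?_⟩
    have : Finite (FaceLattice (truncated (5 + n) 𝓕 a g)) := finite_faceLattice_hpoly
    have h0 : faceCount (truncated (5 + n) 𝓕 a g) 0 = 10 + 4 * n := congrFun hf 0
    have := faceCount_le_card_faceLattice (Q := truncated (5 + n) 𝓕 a g) 0
    omega
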